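/- **Setting.** For $i=1,2,\dots$ let $(\Omega[i],\mathcal F[i],P[i])$ be the space of all maps $\frac1i\mathbb Z\to\{-1,+1\}$ with the product $\sigma$-field and the product of the uniform measures; $\tau_m$ ($m\in\frac1i\mathbb Z$) are the coordinate signs. A subset $A$ of the disjoint union $\Omega[\mathrm{all}]=\Omega[1]\uplus\Omega[2]\uplus\dots$ is identified with the sequence of its sections $A[i]=A\cap\Omega[i]$. A *coarse $\sigma$-field* on a sequence of probability spaces $(\Omega[i],\mathcal F[i],P[i])$ is a set $\mathcal A$ of subsets of $\Omega[\mathrm{all}]$ such that (a) $A[i]\in\mathcal F[i]$ for all $A\in\mathcal A$ and all $i$; (b) $\mathcal A$ is closed under finite unions, finite intersections and complements; (c) $\mathcal A$ contains every $A$ with $A[i]\in\mathcal F[i]$ for all $i$ and $P[i](A[i])\to0$; (d) $\bigcup_kA_k\in\mathcal A$ for pairwise disjoint $A_1,A_2,\dots\in\mathcal A$ with $\sum_k\sup_iP[i](A_k[i])<\infty$; (e) $\lim_iP[i](A[i])$ exists for all $A\in\mathcal A$; (f) some finite or countable subset of $\mathcal A$ generates $\mathcal A$, where the family generated by a set of subsets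 of $\Omega[\mathrm{all}]$ is the least family containing it and satisfying (b), (c), (d). A *coarse instant* is a sequence $t=(t[i])_i$ with $t[i]\in\frac1i\mathbb Z$ converging to some $t[\infty]\in\mathbb R$; $s\le t$ means $s[i]\le t[i]$ for all $i$. For coarse instants $s\le t$ let $\Omega_{s,t}[i]$ be the space of all maps $\frac1i\mathbb Z\cap[s[i],t[i])\to\{-1,+1\}$ with the uniform measure, and let $\mathcal A_{s,t}$ be the set of all $A\subset\Omega_{s,t}[\mathrm{all}]$ whose inverse image in $\Omega[\mathrm{all}]$ under the restriction maps belongs to $\mathcal A$. A *dyadic coarse factorization* is a coarse $\sigma$-field $\mathcal A$ on the above $(\Omega[i],\mathcal F[i],P[i])_i$ such that $\mathcal A_{r,t}=\mathcal A_{r,s}\otimes\mathcal A_{s,t}$ for all coarse instants $r\le s\le t$ (the right-hand side being generated by the sets $A_1\times A_2$, $A_1\in\mathcal A_{r,s}$, $A_2\in\mathcal A_{s,t}$), and $\mathcal A$ is generated by the inverse images of the members of all $\mathcal A_{s,t}$. $L_2(\mathcal A)$ is the space of sequences $x=(x[i])_i$, $x[i]\in L_2(\Omega[i],\mathcal F[i],P[i])$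 (real or complex scalars), which is the closure of the linear combinations of indicators of members of $\mathcal A$ in the norm $\sup_i\|x[i]\|$. The *spectral measure* $\mu_x[i]$ is the finite measure $\mu_x[i](\mathcal M)=\sum_{M\in\mathcal M}|\hat x[i]_M|^2$ on the set of finite subsets $M$ of $\frac1i\mathbb Z$, where $\hat x[i]_M=\mathbb E\big(x[i]\prod_{m\in M}\tau_m\big)$; it is regarded as a measure on the Polish space $\mathcal C[\infty]$ of compact subsets of $\mathbb R$ with the topology of the Hausdorff metric on nonempty sets, $\emptyset$ being an isolated point. A *refinement* of $\mathcal A$ is a probability space $(\Omega,\mathcal F,P)$ with a map $A\mapsto A[\infty]$ from $\mathcal A$ onto the measurable sets mod $0$ that respects intersections and complements and satisfies $P(A[\infty])=\lim_iP[i](A[i])$. It induces a linear map $L_2(\mathcal A)\to L_2(\Omega,\mathcal F,P)$, $x\mapsto x[\infty]$, the extension of $\mathbf 1_A\mapsto\mathbf 1_{A[\infty]}$ by linearity and continuity. For real $s\le t$ let $\mathcal F_{s,t}\subset\mathcal F$ be the sub-$\sigma$-field generated by the null sets and the refinements of (the inverse images of) members of $\mathcal A_{a,b}$, where $a\le b$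 are coarse instants with $a[\infty]=s$, $b[\infty]=t$. **Theorem.** For every dyadic coarse factorization $\mathcal A$ and every $x\in L_2(\mathcal A)$, the spectral measures $\mu_x[i]$ converge weakly, as $i\to\infty$, to a finite positive measure $\mu_x[\infty]$ on $\mathcal C[\infty]$. Moreover, $\mu_x[\infty]$ is the spectral measure of $x[\infty]$ for every refinement $(\Omega,\mathcal F,P)$ of $\mathcal A$: for every elementary set $E$, that is, every $E\subset\mathbb R$ that differs by a finite set from a finite union of intervals $(s_1,t_1)\cup\dots\cup(s_n,t_n)$ ($s_k\le t_k$), $$\mu_x[\infty]\big(\{M\in\mathcal C[\infty]:M\subset E\}\big)=\big\|\mathbb E\big(x[\infty]\,\big|\,\mathcal F_E\big)\big\|^2 ,$$ where $\mathcal F_E$ is the $\sigma$-field generated by $\mathcal F_{s_1,t_1},\dots,\mathcal F_{s_n,t_n}$. -/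

import Mathlib

open MeasureTheory Filter Topology TopologicalSpace
open scoped ENNReal symmDiff

namespace CoarseScaling

universe u v

/-! ### Coarse probability spaces -/

/-- A subset `A` of the disjoint union `Ω[1] ⊎ Ω[2] ⊎ …`, given by its sections `A i = A ∩ Ω[i]`. -/
abbrev SetSeq (Ω : ℕ+ → Type u) : Type u := ∀ i, Set (Ω i)

section Coarse

variable {Ω : ℕ+ → Type u} [∀ i, MeasurableSpace (Ω i)]

/-- The closure properties (b), (c), (d) of a coarse σ-field: Boolean operations, all
asymptotically negligible sets, and disjoint unions with summable `sup_i P[i](A_k ∩ Ω[i])`. -/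
structure CoarselyClosed (P : ∀ i, Measure (Ω i)) (ℬ : Set (SetSeq Ω)) : Prop where
  inter : ∀ A ∈ ℬ, ∀ B ∈ ℬ, (fun i => A i ∩ B i) ∈ ℬ
  union : ∀ A ∈ ℬ, ∀ B ∈ ℬ, (fun i => A i ∪ B i) ∈ ℬ
  compl : ∀ A ∈ ℬ, (fun i => (A i)ᶜ) ∈ ℬ
  negligible : ∀ A : SetSeq Ω, (∀ i, MeasurableSet (A i)) →
    Tendsto (fun i => P i (A i)) atTop (𝓝 0) → A ∈ ℬ
  iUnion : ∀ A : ℕ → SetSeq Ω, (∀ k, A k ∈ ℬ) →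
    (∀ i, Pairwise fun k l => Disjoint (A k i) (A l i)) →
    ∑' k, ⨆ i, P i (A k i) ≠ ∞ → (fun i => ⋃ k, A k i) ∈ ℬ

/-- The least family of sets containing `𝒢` and satisfying (b), (c), (d). -/
def coarseGenerate (P : ∀ i, Measure (Ω i)) (𝒢 : Set (SetSeq Ω)) : Set (SetSeq Ω) :=
  ⋂₀ {ℬ | CoarselyClosed P ℬ ∧ 𝒢 ⊆ ℬ}

/-- `𝒜` is a coarse σ-field on the coarse sample space `(Ω[i], ℱ[i], P[i])`. -/
structure IsCoarseSigmaField (P : ∀ i, Measure (Ω i)) (𝒜 : Set (SetSeq Ω)) : Prop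
    extends CoarselyClosed P 𝒜 where
  measurableSet : ∀ A ∈ 𝒜, ∀ i, MeasurableSet (A i)
  exists_lim : ∀ A ∈ 𝒜, ∃ l, Tendsto (fun i => P i (A i)) atTop (𝓝 l)
  countably_generated : ∃ 𝒢 ⊆ 𝒜, 𝒢.Countable ∧ coarseGenerate P 𝒢 = 𝒜

/-! ### The space `L₂(𝒜)` -/

/-- The indicator of `A ⊆ Ω[all]` as a bounded sequence of vectors of the spaces `L₂[i]`;
`lp (fun i => L₂[i]) ∞` carries the norm `sup_i ‖f[i]‖`. -/
noncomputable def coarseIndicator (𝕜 : Type v) [RCLike 𝕜] (P : ∀ i, Measure (Ω i))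
    [∀ i, IsProbabilityMeasure (P i)] (A : SetSeq Ω) (hA : ∀ i, MeasurableSet (A i)) :
    lp (fun i => Lp 𝕜 2 (P i)) ∞ :=
  ⟨fun i => indicatorConstLp 2 (hA i) (measure_ne_top (P i) _) (1 : 𝕜), by
    refine memℓp_infty ⟨1, ?_⟩
    rintro _ ⟨i, rfl⟩
    refine norm_indicatorConstLp_le.trans ?_
    rw [norm_one, one_mul]
    exact Real.rpow_le_one measureReal_nonneg measureReal_le_one (by positivity)⟩

/-- `L₂(𝒜)`: the closure, in the norm `sup_i ‖f[i]‖`, of the linear combinations of indicators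
of coarse events. -/
noncomputable def coarseL2 (𝕜 : Type v) [RCLike 𝕜] (P : ∀ i, Measure (Ω i))
    [∀ i, IsProbabilityMeasure (P i)] (𝒜 : Set (SetSeq Ω)) :
    Submodule 𝕜 (lp (fun i => Lp 𝕜 2 (P i)) ∞) :=
  (Submodule.span 𝕜 {f | ∃ A ∈ 𝒜, ∃ hA, f = coarseIndicator 𝕜 P A hA}).topologicalClosure

/-! ### Refinement -/

/-- A probability space `(Ω', Q)` with an isomorphism of measure algebras
`MALG[∞] ≅ MALG(Ω', Q)`, i.e. a refinement of the coarse probability space; `lim A` is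
(a representative of) the refinement `A[∞]` of the coarse event `A`. Since `lim` respects Boolean
operations and carries `lim_i P[i]` to `Q`, it identifies `A, B ∈ 𝒜` exactly when
`P[i](A[i] ∆ B[i]) → 0`. -/
structure CoarseRefinement (P : ∀ i, Measure (Ω i)) (𝒜 : Set (SetSeq Ω)) {Ω' : Type v}
    [MeasurableSpace Ω'] (Q : Measure Ω') where
  lim : SetSeq Ω → Set Ω'
  measurableSet_lim : ∀ A ∈ 𝒜, MeasurableSet (lim A)
  lim_inter : ∀ A ∈ 𝒜, ∀ B ∈ 𝒜, lim (fun i => A i ∩ B i) =ᵐ[Q] (lim A ∩ lim B : Set Ω')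
  lim_compl : ∀ A ∈ 𝒜, lim (fun i => (A i)ᶜ) =ᵐ[Q] ((lim A)ᶜ : Set Ω')
  tendsto : ∀ A ∈ 𝒜, Tendsto (fun i => P i (A i)) atTop (𝓝 (Q (lim A)))
  surjective : ∀ S, MeasurableSet S → ∃ A ∈ 𝒜, lim A =ᵐ[Q] S

namespace CoarseRefinement

variable {P : ∀ i, Measure (Ω i)} [∀ i, IsProbabilityMeasure (P i)] {𝒜 : Set (SetSeq Ω)}
  {Ω' : Type v} [MeasurableSpace Ω'] {Q : Measure Ω'} [IsProbabilityMeasure Q]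
  (𝕜 : Type*) [RCLike 𝕜]

/-- The graph of the linear map `∑ c_j 1_{A_j} ↦ ∑ c_j 1_{A_j[∞]}`. -/
noncomputable def simpleGraph (R : CoarseRefinement P 𝒜 Q) :
    Submodule 𝕜 (lp (fun i => Lp 𝕜 2 (P i)) ∞ × Lp 𝕜 2 Q) :=
  Submodule.span 𝕜 {p | ∃ A, ∃ hA : A ∈ 𝒜, ∃ hm, p = (coarseIndicator 𝕜 P A hm,
    indicatorConstLp 2 (R.measurableSet_lim A hA) (measure_ne_top Q _) (1 : 𝕜))}

theorem tendsto_inner_simpleGraph (R : CoarseRefinement P 𝒜 Q) (h𝒜 : CoarselyClosed P 𝒜)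
    {p q : lp (fun i => Lp 𝕜 2 (P i)) ∞ × Lp 𝕜 2 Q} (hp : p ∈ R.simpleGraph 𝕜)
    (hq : q ∈ R.simpleGraph 𝕜) :
    Tendsto (fun i => inner 𝕜 (p.1 i) (q.1 i)) atTop (𝓝 (inner 𝕜 p.2 q.2)) := by
  induction hp using Submodule.span_induction with
  | mem p hp =>
    obtain ⟨A, hA, hmA, rfl⟩ := hp
    induction hq using Submodule.span_induction with
    | mem q hq =>
      obtain ⟨B, hB, hmB, rfl⟩ := hq
      have h1 : ∀ i, inner 𝕜 (coarseIndicator 𝕜 P A hmA i) (coarseIndicator 𝕜 P B hmB i)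
          = (((P i).real (A i ∩ B i) : ℝ) : 𝕜) := fun i => by
        change inner 𝕜 (indicatorConstLp 2 (hmA i) (measure_ne_top (P i) _) (1 : 𝕜))
          (indicatorConstLp 2 (hmB i) (measure_ne_top (P i) _) (1 : 𝕜)) = _
        rw [L2.inner_indicatorConstLp_indicatorConstLp]
        simp [RCLike.real_smul_eq_coe_mul]
      have h2 : inner 𝕜
          (indicatorConstLp 2 (R.measurableSet_lim A hA) (measure_ne_top Q _) (1 : 𝕜))
          (indicatorConstLp 2 (R.measurableSet_lim B hB) (measure_ne_top Q _) (1 : 𝕜))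
          = ((Q.real (R.lim A ∩ R.lim B) : ℝ) : 𝕜) := by
        rw [L2.inner_indicatorConstLp_indicatorConstLp]
        simp [RCLike.real_smul_eq_coe_mul]
      simp only [h1, h2]
      refine (RCLike.continuous_ofReal.tendsto _).comp ?_
      have := R.tendsto _ (h𝒜.inter A hA B hB)
      rw [measure_congr (R.lim_inter A hA B hB)] at this
      exact (ENNReal.tendsto_toReal (measure_ne_top _ _)).comp this
    | zero => simp
    | add q q' _ _ h h' => simpa [inner_add_right] using h.add h'
    | smul c q _ h => simpa [inner_smul_right] using h.const_mul c
  | zero => simp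
  | add p p' _ _ h h' => simpa [inner_add_left] using h.add h'
  | smul c p _ h => simpa [inner_smul_left] using h.const_mul (starRingEnd 𝕜 c)

theorem norm_snd_le (R : CoarseRefinement P 𝒜 Q) (h𝒜 : CoarselyClosed P 𝒜)
    {p : lp (fun i => Lp 𝕜 2 (P i)) ∞ × Lp 𝕜 2 Q}
    (hp : p ∈ (R.simpleGraph 𝕜).topologicalClosure) : ‖p.2‖ ≤ ‖p.1‖ := by
  have hcl : IsClosed {p : lp (fun i => Lp 𝕜 2 (P i)) ∞ × Lp 𝕜 2 Q | ‖p.2‖ ≤ ‖p.1‖} :=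
    isClosed_le (by fun_prop) (by fun_prop)
  refine closure_minimal (fun p hp => ?_) hcl hp
  have h := (RCLike.continuous_re.tendsto _).comp (R.tendsto_inner_simpleGraph 𝕜 h𝒜 hp hp)
  have h' : ‖p.2‖ ^ 2 ≤ ‖p.1‖ ^ 2 := by
    rw [← inner_self_eq_norm_sq (𝕜 := 𝕜) p.2]
    refine le_of_tendsto h (Eventually.of_forall fun i => ?_)
    simp only [Function.comp_apply]
    rw [inner_self_eq_norm_sq]
    exact pow_le_pow_left₀ (norm_nonneg _) (lp.norm_apply_le_norm (by simp) p.1 i) 2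
  exact le_of_sq_le_sq h' (norm_nonneg _)

theorem existsUnique_limL2 (R : CoarseRefinement P 𝒜 Q) (h𝒜 : IsCoarseSigmaField P 𝒜)
    (x : coarseL2 𝕜 P 𝒜) :
    ∃! y : Lp 𝕜 2 Q, ((x : lp (fun i => Lp 𝕜 2 (P i)) ∞), y) ∈
      (R.simpleGraph 𝕜).topologicalClosure := by
  set G := (R.simpleGraph 𝕜).topologicalClosure with hG
  have hGc : IsClosed (G : Set (lp (fun i => Lp 𝕜 2 (P i)) ∞ × Lp 𝕜 2 Q)) :=
    Submodule.isClosed_topologicalClosure _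
  have : CompleteSpace G := hGc.completeSpace_coe
  let π : G →L[𝕜] lp (fun i => Lp 𝕜 2 (P i)) ∞ :=
    (ContinuousLinearMap.fst 𝕜 _ _).comp G.subtypeL
  have hπ : AntilipschitzWith 1 π := by
    refine AddMonoidHomClass.antilipschitz_of_bound π fun p => ?_
    rw [NNReal.coe_one, one_mul]
    exact max_le le_rfl (R.norm_snd_le 𝕜 h𝒜.toCoarselyClosed p.2)
  have hcl : IsClosed (Set.range π) := hπ.isClosed_range π.uniformContinuous
  have hcl_ : IsClosed (LinearMap.range π.toLinearMap : Set (lp (fun i => Lp 𝕜 2 (P i)) ∞)) := by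
    rw [LinearMap.coe_range]; exact hcl
  have hsub : coarseL2 𝕜 P 𝒜 ≤ LinearMap.range π.toLinearMap := by
    refine Submodule.topologicalClosure_minimal _ (Submodule.span_le.2 ?_) hcl_
    rintro _ ⟨A, hA, hm, rfl⟩
    exact ⟨⟨_, Submodule.le_topologicalClosure _ (Submodule.subset_span ⟨A, hA, hm, rfl⟩)⟩, rfl⟩
  obtain ⟨⟨p, hp⟩, hpx⟩ := hsub x.2
  have hpx : p.1 = x := hpx
  refine ⟨p.2, by rw [← hpx]; exact hp, fun y hy => ?_⟩
  have h := R.norm_snd_le 𝕜 h𝒜.toCoarselyClosed (G.sub_mem hy hp)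
  simp only [Prod.snd_sub, Prod.fst_sub, hpx, sub_self, norm_zero] at h
  exact sub_eq_zero.1 (norm_le_zero_iff.1 h)

/-- The refinement `x[∞] ∈ L₂(Ω', Q)` of `x ∈ L₂(𝒜)`: the map `1_A ↦ 1_{A[∞]}`, extended by
linearity and continuity. -/
noncomputable def limL2 (R : CoarseRefinement P 𝒜 Q) (h𝒜 : IsCoarseSigmaField P 𝒜)
    (x : coarseL2 𝕜 P 𝒜) : Lp 𝕜 2 Q :=
  (R.existsUnique_limL2 𝕜 h𝒜 x).choose

end CoarseRefinement

section Existence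

variable {X : Type*} [MeasurableSpace X]

/-- A family of subsets of `X` on which the images of `P i` under `φ i` converge to `Q`. -/
structure ApproxSystem (P : ∀ i, Measure (Ω i)) (φ : ∀ i, Ω i → X) (Q : Measure X)
    (𝒞 : Set (Set X)) : Prop where
  empty : ∅ ∈ 𝒞
  compl : ∀ C ∈ 𝒞, Cᶜ ∈ 𝒞
  inter : ∀ C ∈ 𝒞, ∀ D ∈ 𝒞, C ∩ D ∈ 𝒞
  tendsto : ∀ C ∈ 𝒞, Tendsto (fun i => P i (φ i ⁻¹' C)) atTop (𝓝 (Q C))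

/-- `A` and `S` are approximated by the same members of `𝒞`. -/
def Approx (P : ∀ i, Measure (Ω i)) (φ : ∀ i, Ω i → X) (Q : Measure X) (𝒞 : Set (Set X))
    (A : SetSeq Ω) (S : Set X) : Prop :=
  ∀ ε : ℝ≥0∞, ε ≠ 0 → ∃ C ∈ 𝒞, Q (S ∆ C) ≤ ε ∧ ∀ᶠ i in atTop, P i (A i ∆ (φ i ⁻¹' C)) ≤ ε

variable {P : ∀ i, Measure (Ω i)} {φ : ∀ i, Ω i → X} {Q : Measure X} {𝒞 : Set (Set X)}
  {A B : SetSeq Ω} {S T : Set X}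

theorem le_add_symmDiff {Y : Type*} [MeasurableSpace Y] (μ : Measure Y) (s t : Set Y) :
    μ s ≤ μ t + μ (s ∆ t) := by
  refine (measure_mono fun y hy => ?_).trans (measure_union_le t (s ∆ t))
  by_cases h : y ∈ t
  · exact Or.inl h
  · exact Or.inr (Or.inl ⟨hy, h⟩)

theorem Approx.congr (h : Approx P φ Q 𝒞 A S) (hAB : ∀ᶠ i in atTop, B i = A i) :
    Approx P φ Q 𝒞 B S := by
  intro ε hε
  obtain ⟨C, hC, h1, h2⟩ := h ε hε
  refine ⟨C, hC, h1, ?_⟩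
  filter_upwards [h2, hAB] with i hi hi'
  rwa [hi']

theorem Approx.of_mem {C : Set X} (hC : C ∈ 𝒞) : Approx P φ Q 𝒞 (fun i => φ i ⁻¹' C) C :=
  fun ε _ => ⟨C, hC, by simp, by simp⟩

theorem Approx.compl (h𝒞 : ApproxSystem P φ Q 𝒞) (h : Approx P φ Q 𝒞 A S) :
    Approx P φ Q 𝒞 (fun i => (A i)ᶜ) Sᶜ := by
  intro ε hε
  obtain ⟨C, hC, h1, h2⟩ := h ε hε
  refine ⟨Cᶜ, h𝒞.compl C hC, ?_, ?_⟩
  · rwa [compl_symmDiff_compl]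
  · simpa only [Set.preimage_compl, compl_symmDiff_compl] using h2

theorem inter_symmDiff_inter_subset {Y : Type*} (s t u v : Set Y) :
    (s ∩ t) ∆ (u ∩ v) ⊆ s ∆ u ∪ t ∆ v := by
  intro y
  simp only [Set.mem_symmDiff, Set.mem_inter_iff, Set.mem_union]
  tauto

theorem Approx.inter (h𝒞 : ApproxSystem P φ Q 𝒞) (hA : Approx P φ Q 𝒞 A S)
    (hB : Approx P φ Q 𝒞 B T) : Approx P φ Q 𝒞 (fun i => A i ∩ B i) (S ∩ T) := by
  intro ε hε
  have hε2 : ε / 2 ≠ 0 := by simpa using hε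
  obtain ⟨C, hC, h1, h2⟩ := hA _ hε2
  obtain ⟨D, hD, h3, h4⟩ := hB _ hε2
  refine ⟨C ∩ D, h𝒞.inter C hC D hD, ?_, ?_⟩
  · refine (measure_mono (inter_symmDiff_inter_subset _ _ _ _)).trans
      ((measure_union_le _ _).trans ((add_le_add h1 h3).trans_eq (ENNReal.add_halves ε)))
  · filter_upwards [h2, h4] with i hi hi'
    refine (measure_mono (inter_symmDiff_inter_subset _ _ _ _)).trans
      ((measure_union_le _ _).trans ((add_le_add hi hi').trans_eq (ENNReal.add_halves ε)))

theorem Approx.union (h𝒞 : ApproxSystem P φ Q 𝒞) (hA : Approx P φ Q 𝒞 A S)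
    (hB : Approx P φ Q 𝒞 B T) : Approx P φ Q 𝒞 (fun i => A i ∪ B i) (S ∪ T) := by
  simpa [Set.compl_inter] using ((hA.compl h𝒞).inter h𝒞 (hB.compl h𝒞)).compl h𝒞

theorem Approx.tendsto [IsProbabilityMeasure Q] (h𝒞 : ApproxSystem P φ Q 𝒞)
    (h : Approx P φ Q 𝒞 A S) : Tendsto (fun i => P i (A i)) atTop (𝓝 (Q S)) := by
  rw [ENNReal.tendsto_nhds (measure_ne_top Q S)]
  intro ε hε
  have hε3 : ε / 3 ≠ 0 := by simpa using hε.ne'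
  obtain ⟨C, hC, h1, h2⟩ := h _ hε3
  have h3 := (ENNReal.tendsto_nhds (measure_ne_top Q C)).1 (h𝒞.tendsto C hC) (ε / 3)
    (pos_iff_ne_zero.2 hε3)
  have he : ε / 3 + ε / 3 + ε / 3 = ε := ENNReal.add_thirds ε
  filter_upwards [h2, h3] with i hi hi'
  constructor
  · rw [tsub_le_iff_right]
    calc Q S ≤ Q C + ε / 3 := (le_add_symmDiff Q S C).trans (by gcongr)
      _ ≤ (P i (φ i ⁻¹' C) + ε / 3) + ε / 3 := by
        gcongr; exact tsub_le_iff_right.1 hi'.1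
      _ ≤ ((P i (A i) + ε / 3) + ε / 3) + ε / 3 := by
        gcongr
        refine (le_add_symmDiff (P i) _ (A i)).trans ?_
        rw [symmDiff_comm]; gcongr
      _ = P i (A i) + ε := by rw [add_assoc, add_assoc, ← add_assoc (ε / 3), he]
  · calc P i (A i) ≤ P i (φ i ⁻¹' C) + ε / 3 := (le_add_symmDiff (P i) _ _).trans (by gcongr)
      _ ≤ (Q C + ε / 3) + ε / 3 := by gcongr; exact hi'.2
      _ ≤ ((Q S + ε / 3) + ε / 3) + ε / 3 := by
        gcongr
        refine (le_add_symmDiff Q _ S).trans ?_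
        rw [symmDiff_comm]; gcongr
      _ = Q S + ε := by rw [add_assoc, add_assoc, ← add_assoc (ε / 3), he]

theorem Approx.unique [IsProbabilityMeasure Q] (h𝒞 : ApproxSystem P φ Q 𝒞)
    (h : Approx P φ Q 𝒞 A S) (h' : Approx P φ Q 𝒞 A T) : S =ᵐ[Q] T := by
  rw [← measure_symmDiff_eq_zero_iff]
  have h1 : ∀ S T, Approx P φ Q 𝒞 A S → Approx P φ Q 𝒞 A T → Q (S \ T) = 0 := by
    intro S T h h'
    have h2 := (h.inter h𝒞 (h'.compl h𝒞)).tendsto h𝒞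
    simp only [Set.inter_compl_self, measure_empty] at h2
    exact (tendsto_nhds_unique h2 tendsto_const_nhds)
  exact measure_union_null (h1 S T h h') (h1 T S h' h)

theorem Approx.negligible (h𝒞 : ApproxSystem P φ Q 𝒞)
    (hA : Tendsto (fun i => P i (A i)) atTop (𝓝 0)) : Approx P φ Q 𝒞 A ∅ := by
  intro ε hε
  refine ⟨∅, h𝒞.empty, by simp, ?_⟩
  filter_upwards [ENNReal.tendsto_nhds_zero.1 hA ε (pos_iff_ne_zero.2 hε)] with i hi
  rwa [Set.preimage_empty, ← Set.bot_eq_empty, symmDiff_bot]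

theorem iUnion_symmDiff_subset {Y : Type*} (N : ℕ) (B : ℕ → Set Y) (D : Set Y) :
    (⋃ k, B k) ∆ D ⊆ (⋃ k < N, B k) ∆ D ∪ ⋃ k, B (k + N) := by
  intro y
  simp only [Set.mem_symmDiff, Set.mem_union, Set.mem_iUnion, exists_prop]
  rintro (⟨⟨k, hk⟩, hy⟩ | ⟨hy, hk⟩)
  · by_cases hkN : k < N
    · exact Or.inl (Or.inl ⟨⟨k, hkN, hk⟩, hy⟩)
    · exact Or.inr ⟨k - N, by rwa [Nat.sub_add_cancel (not_lt.1 hkN)]⟩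
  · exact Or.inl (Or.inr ⟨hy, fun ⟨k, _, hk'⟩ => hk ⟨k, hk'⟩⟩)

theorem Approx.iUnion [IsProbabilityMeasure Q] (h𝒞 : ApproxSystem P φ Q 𝒞)
    {A : ℕ → SetSeq Ω} {S : ℕ → Set X} (h : ∀ k, Approx P φ Q 𝒞 (A k) (S k))
    (hs : ∑' k, ⨆ i, P i (A k i) ≠ ∞) :
    Approx P φ Q 𝒞 (fun i => ⋃ k, A k i) (⋃ k, S k) := by
  have hfin : ∀ N : ℕ, Approx P φ Q 𝒞 (fun i => ⋃ k < N, A k i) (⋃ k < N, S k) := by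
    intro N
    induction N with
    | zero => simpa using Approx.of_mem (P := P) (φ := φ) (Q := Q) h𝒞.empty
    | succ N ih => simpa only [Set.biUnion_lt_succ] using ih.union h𝒞 (h N)
  have hQ : ∀ k, Q (S k) ≤ ⨆ i, P i (A k i) := fun k =>
    le_of_tendsto ((h k).tendsto h𝒞)
      (Eventually.of_forall fun i => le_iSup (fun i => P i (A k i)) i)
  intro ε hε
  have hε2 : ε / 2 ≠ 0 := by simpa using hε
  obtain ⟨N, hN⟩ := ((ENNReal.tendsto_nhds_zero.1
    (ENNReal.tendsto_sum_nat_add _ hs)) (ε / 2) (pos_iff_ne_zero.2 hε2)).exists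
  obtain ⟨C, hC, h1, h2⟩ := hfin N _ hε2
  refine ⟨C, hC, ?_, ?_⟩
  · refine (measure_mono (iUnion_symmDiff_subset N S C)).trans ((measure_union_le _ _).trans
      ((add_le_add h1 ?_).trans_eq (ENNReal.add_halves ε)))
    exact (measure_iUnion_le _).trans ((ENNReal.tsum_le_tsum fun k => hQ (k + N)).trans hN)
  · filter_upwards [h2] with i hi
    refine (measure_mono (iUnion_symmDiff_subset N (fun k => A k i) _)).trans ((measure_union_le _ _).trans
      ((add_le_add hi ?_).trans_eq (ENNReal.add_halves ε)))
    exact (measure_iUnion_le _).trans ((ENNReal.tsum_le_tsum fun k =>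
      le_iSup (fun i => P i (A (k + N) i)) i).trans hN)

theorem CoarselyClosed.empty_mem {𝒜 : Set (SetSeq Ω)} (h : CoarselyClosed P 𝒜) :
    (fun _ => ∅) ∈ 𝒜 :=
  h.negligible _ (fun _ => MeasurableSet.empty) (by simp)

theorem CoarselyClosed.biUnion_lt {𝒜 : Set (SetSeq Ω)} (h : CoarselyClosed P 𝒜)
    {A : ℕ → SetSeq Ω} (hA : ∀ k, A k ∈ 𝒜) (N : ℕ) : (fun i => ⋃ k < N, A k i) ∈ 𝒜 := by
  induction N with
  | zero => simpa using h.empty_mem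
  | succ N ih => simpa only [Set.biUnion_lt_succ] using h.union _ ih _ (hA N)

theorem CoarselyClosed.tail_mem {𝒜 : Set (SetSeq Ω)} (h : CoarselyClosed P 𝒜)
    (hA : A ∈ 𝒜) (n : ℕ+) : (fun i => if n ≤ i then A i else ∅) ∈ 𝒜 := by
  classical
  have h1 : (fun i => if n ≤ i then (∅ : Set (Ω i)) else Set.univ) ∈ 𝒜 := by
    refine h.negligible _ (fun i => by split_ifs <;> simp) ?_
    refine tendsto_const_nhds.congr' ?_
    filter_upwards [eventually_ge_atTop n] with i hi
    simp [hi]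
  have h2 := h.inter _ hA _ (h.compl _ h1)
  convert h2 using 2 with i
  split_ifs <;> simp

/-- The pairs of a coarse event and an approximating subset of `X` exhaust the σ-field generated
by `𝒞`. -/
theorem exists_approx_of_measurableSet [IsProbabilityMeasure Q] {𝒜 : Set (SetSeq Ω)}
    (h𝒜 : CoarselyClosed P 𝒜) (h𝒞 : ApproxSystem P φ Q 𝒞)
    (hmem : ∀ C ∈ 𝒞, (fun i => φ i ⁻¹' C) ∈ 𝒜)
    (hgen : ‹MeasurableSpace X› = MeasurableSpace.generateFrom 𝒞) (S : Set X)
    (hS : MeasurableSet S) : ∃ A ∈ 𝒜, Approx P φ Q 𝒞 A S := by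
  classical
  induction S, hS using MeasurableSpace.induction_on_inter hgen
    (fun C hC D hD _ => h𝒞.inter C hC D hD) with
  | empty => exact ⟨_, h𝒜.empty_mem, by simpa using Approx.of_mem h𝒞.empty⟩
  | basic C hC => exact ⟨_, hmem C hC, Approx.of_mem hC⟩
  | compl S _ ih =>
    obtain ⟨A, hA, h⟩ := ih
    exact ⟨_, h𝒜.compl A hA, h.compl h𝒞⟩
  | iUnion S hd hm ih =>
    choose A hA h using ih
    let B : ℕ → SetSeq Ω := fun k i => A k i ∩ (⋃ j < k, A j i)ᶜ
    have hB : ∀ k, B k ∈ 𝒜 := fun k =>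
      h𝒜.inter _ (hA k) _ (h𝒜.compl _ (h𝒜.biUnion_lt hA k))
    have hfin : ∀ N : ℕ, Approx P φ Q 𝒞 (fun i => ⋃ k < N, A k i) (⋃ k < N, S k) := by
      intro N
      induction N with
      | zero => simpa using Approx.of_mem (P := P) (φ := φ) (Q := Q) h𝒞.empty
      | succ N ih => simpa only [Set.biUnion_lt_succ] using ih.union h𝒞 (h N)
    have hBS : ∀ k, Approx P φ Q 𝒞 (B k) (S k) := by
      intro k
      have h1 := (h k).inter h𝒞 ((hfin k).compl h𝒞)
      have h2 : S k ∩ (⋃ j < k, S j)ᶜ = S k := by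
        refine Set.inter_eq_left.2 fun y hy hy' => ?_
        simp only [Set.mem_iUnion, exists_prop] at hy'
        obtain ⟨j, hj, hyj⟩ := hy'
        exact Set.disjoint_left.1 (hd hj.ne) hyj hy
      rwa [h2] at h1
    have hn : ∀ k, ∃ n : ℕ+, ∀ i ≥ n, P i (B k i) ≤ Q (S k) + (2 : ℝ≥0∞)⁻¹ ^ k := by
      intro k
      refine eventually_atTop.1 ?_
      filter_upwards [(ENNReal.tendsto_nhds (measure_ne_top Q (S k))).1 ((hBS k).tendsto h𝒞)
        ((2 : ℝ≥0∞)⁻¹ ^ k) (by simp [pos_iff_ne_zero])] with i hi using hi.2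
    choose n hn using hn
    let D : ℕ → SetSeq Ω := fun k i => if n k ≤ i then B k i else ∅
    have hDB : ∀ k i, D k i ⊆ B k i := fun k i => by
      simp only [D]; split_ifs <;> simp
    have hD : ∀ k, D k ∈ 𝒜 := fun k => h𝒜.tail_mem (hB k) (n k)
    have hDS : ∀ k, Approx P φ Q 𝒞 (D k) (S k) := fun k => (hBS k).congr (by
      filter_upwards [eventually_ge_atTop (n k)] with i hi
      simp [D, hi])
    have hsum : ∑' k, ⨆ i, P i (D k i) ≠ ∞ := by
      refine ne_top_of_le_ne_top ?_ (ENNReal.tsum_le_tsum fun k =>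
        (iSup_le fun i => ?_ : ⨆ i, P i (D k i) ≤ Q (S k) + (2 : ℝ≥0∞)⁻¹ ^ k))
      · rw [ENNReal.tsum_add, ← measure_iUnion hd hm, ENNReal.tsum_geometric]
        simp
      · by_cases hi : n k ≤ i
        · simpa [D, hi] using hn k i hi
        · simp [D, hi]
    refine ⟨_, h𝒜.iUnion D hD (fun i => ?_) hsum, Approx.iUnion h𝒞 hDS hsum⟩
    have hlt : ∀ k l, k < l → Disjoint (D k i) (D l i) := fun k l hkl => by
      refine Set.disjoint_left.2 fun y hy hy' => (hDB l i hy').2 ?_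
      simp only [Set.mem_iUnion, exists_prop]
      exact ⟨k, hkl, (hDB k i hy).1⟩
    exact fun k l hkl => (lt_or_gt_of_ne hkl).elim (hlt k l) fun h => (hlt l k h).symm

/-- Every coarse probability space has a refinement. -/
theorem exists_coarseRefinement {P : ∀ i, Measure (Ω i)} [∀ i, IsProbabilityMeasure (P i)]
    {𝒜 : Set (SetSeq Ω)} (h𝒜 : IsCoarseSigmaField P 𝒜) :
    ∃ Q : ProbabilityMeasure (ℕ → Bool),
      Nonempty (CoarseRefinement P 𝒜 (Q : Measure (ℕ → Bool))) := by
  classical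
  obtain ⟨𝒢, h𝒢, hcount, hgen⟩ := h𝒜.countably_generated
  obtain ⟨g, hg⟩ := (hcount.insert (fun _ => ∅)).exists_eq_range (Set.insert_nonempty _ _)
  have hg𝒜 : ∀ n, g n ∈ 𝒜 := by
    intro n
    have : g n ∈ insert (fun _ => ∅) 𝒢 := hg ▸ Set.mem_range_self n
    rcases this with h | h
    · rw [h]; exact h𝒜.empty_mem
    · exact h𝒢 h
  let φ : ∀ i, Ω i → (ℕ → Bool) := fun i ω n => decide (ω ∈ g n i)
  have hφ : ∀ i, Measurable (φ i) := fun i => measurable_pi_lambda _ fun n =>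
    measurable_to_bool (by
      convert h𝒜.measurableSet _ (hg𝒜 n) i using 1
      ext ω; simp [φ])
  let ν : ℕ+ → ProbabilityMeasure (ℕ → Bool) := fun i =>
    ⟨(P i).map (φ i), Measure.isProbabilityMeasure_map (hφ i).aemeasurable⟩
  let 𝒰 : Ultrafilter ℕ+ := Ultrafilter.of atTop
  obtain ⟨Q, -, hQ⟩ := isCompact_univ.ultrafilter_le_nhds (𝒰.map ν) (by simp)
  have hQ : Tendsto ν 𝒰 (𝓝 Q) := hQ
  let 𝒞 : Set (Set (ℕ → Bool)) := {C | IsClopen C ∧ (fun i => φ i ⁻¹' C) ∈ 𝒜}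
  have h𝒞 : ApproxSystem P φ (Q : Measure (ℕ → Bool)) 𝒞 := by
    refine ⟨⟨isClopen_empty, h𝒜.empty_mem⟩, fun C hC => ⟨hC.1.compl, h𝒜.compl _ hC.2⟩,
      fun C hC D hD => ⟨hC.1.inter hD.1, h𝒜.inter _ hC.2 _ hD.2⟩, fun C hC => ?_⟩
    obtain ⟨l, hl⟩ := h𝒜.exists_lim _ hC.2
    have h1 := ProbabilityMeasure.tendsto_measure_of_null_frontier_of_tendsto' hQ
      (E := C) (by simp [hC.1.frontier_eq])
    have h2 : Tendsto (fun i => P i (φ i ⁻¹' C)) 𝒰 (𝓝 ((Q : Measure (ℕ → Bool)) C)) := by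
      refine h1.congr fun i => ?_
      exact Measure.map_apply (hφ i) hC.1.1.measurableSet
    rwa [tendsto_nhds_unique h2 (hl.mono_left (Ultrafilter.of_le _))]
  have hbasic : ∀ n, {ω : ℕ → Bool | ω n = true} ∈ 𝒞 := by
    intro n
    refine ⟨(isClopen_discrete {true}).preimage (continuous_apply n), ?_⟩
    convert hg𝒜 n using 2 with i
    ext ω; simp [φ]
  have hgenC : (inferInstance : MeasurableSpace (ℕ → Bool)) =
      MeasurableSpace.generateFrom 𝒞 := by
    refine le_antisymm ?_ (MeasurableSpace.generateFrom_le fun C hC => hC.1.1.measurableSet)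
    refine iSup_le fun n => ?_
    rw [← measurable_iff_comap_le]
    refine @measurable_to_bool _ (MeasurableSpace.generateFrom 𝒞) _ ?_
    exact MeasurableSpace.measurableSet_generateFrom (hbasic n)
  have hall : ∀ A ∈ 𝒜, ∃ S, MeasurableSet S ∧ Approx P φ (Q : Measure (ℕ → Bool)) 𝒞 A S := by
    have hcl : CoarselyClosed P
        {A | ∃ S, MeasurableSet S ∧ Approx P φ (Q : Measure (ℕ → Bool)) 𝒞 A S} := by
      refine ⟨?_, ?_, ?_, ?_, ?_⟩
      · rintro A ⟨S, hS, h⟩ B ⟨T, hT, h'⟩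
        exact ⟨_, hS.inter hT, h.inter h𝒞 h'⟩
      · rintro A ⟨S, hS, h⟩ B ⟨T, hT, h'⟩
        exact ⟨_, hS.union hT, h.union h𝒞 h'⟩
      · rintro A ⟨S, hS, h⟩
        exact ⟨_, hS.compl, h.compl h𝒞⟩
      · intro A _ hA
        exact ⟨∅, MeasurableSet.empty, Approx.negligible h𝒞 hA⟩
      · intro A hA _ hs
        choose S hS h using hA
        exact ⟨_, MeasurableSet.iUnion hS, Approx.iUnion h𝒞 h hs⟩
    intro A hA
    rw [← hgen] at hA
    refine hA _ ⟨hcl, fun B hB => ?_⟩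
    obtain ⟨n, rfl⟩ : B ∈ Set.range g := hg ▸ Set.mem_insert_of_mem _ hB
    refine ⟨_, (hbasic n).1.1.measurableSet, (Approx.of_mem (hbasic n)).congr ?_⟩
    refine Eventually.of_forall fun i => ?_
    ext ω; simp [φ]
  choose! R hR hRA using hall
  refine ⟨Q, ⟨⟨R, hR, fun A hA B hB => ?_, fun A hA => ?_, fun A hA => (hRA A hA).tendsto h𝒞,
    fun S hS => ?_⟩⟩⟩
  · exact (hRA _ (h𝒜.inter A hA B hB)).unique h𝒞 ((hRA A hA).inter h𝒞 (hRA B hB))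
  · exact (hRA _ (h𝒜.compl A hA)).unique h𝒞 ((hRA A hA).compl h𝒞)
  · obtain ⟨A, hA, h⟩ := exists_approx_of_measurableSet h𝒜.toCoarselyClosed h𝒞
      (fun C hC => hC.2) hgenC S hS
    exact ⟨A, hA, (hRA A hA).unique h𝒞 h⟩

end Existence

end Coarse

/-! ### Dyadic coarse factorizations -/

instance : MeasurableSingletonClass ℤˣ :=
  ⟨fun u => ⟨{(u : ℤ)}, measurableSet_singleton _, by ext; simp [Units.ext_iff]⟩⟩

/-- A random sign: `±1` with probabilities `1/2`, `1/2`. -/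
noncomputable def coin : Measure ℤˣ := (2 : ℝ≥0∞)⁻¹ • (Measure.dirac 1 + Measure.dirac (-1))

instance : IsProbabilityMeasure coin :=
  ⟨by simp [coin, ENNReal.inv_two_add_inv_two]⟩

/-- The law of independent random signs indexed by `ι`. -/
noncomputable def signMeasure (ι : Type) : Measure (ι → ℤˣ) := Measure.infinitePi fun _ => coin

instance (ι : Type) : IsProbabilityMeasure (signMeasure ι) := by
  unfold signMeasure; infer_instance

/-- `Ω[i]`, the space of all maps `(1/i)ℤ → {-1, +1}`; the value at `k / i` is the coordinate
`ω k`. -/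
abbrev DyadicSpace (_i : ℕ+) : Type := ℤ → ℤˣ

/-- The measures of the dyadic coarse sample space. -/
noncomputable abbrev dyadicMeasure (i : ℕ+) : Measure (DyadicSpace i) := signMeasure ℤ

/-- A coarse instant: points `t[i] = num i / i` of `(1/i)ℤ` converging to `t[∞] = lim`. -/
structure CoarseInstant where
  num : ℕ+ → ℤ
  lim : ℝ
  tendsto : Tendsto (fun i : ℕ+ => (num i : ℝ) / (i : ℝ)) atTop (𝓝 lim)

/-- `s ≤ t` if `s[i] ≤ t[i]` for all `i`. -/
instance : LE CoarseInstant := ⟨fun s t => ∀ i, s.num i ≤ t.num i⟩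

/-- `Ω_{s,t}[i]`, the space of all maps `(1/i)ℤ ∩ [s[i], t[i]) → {-1, +1}`. -/
abbrev IntervalSpace (s t : CoarseInstant) (i : ℕ+) : Type :=
  Set.Ico (s.num i) (t.num i) → ℤˣ

/-- The measures `P_{s,t}[i]`. -/
noncomputable abbrev intervalMeasure (s t : CoarseInstant) (i : ℕ+) :
    Measure (IntervalSpace s t i) := signMeasure (Set.Ico (s.num i) (t.num i))

/-- The inverse image in `Ω[all]` of a subset of `Ω_{s,t}[all]`. -/
def pullback (s t : CoarseInstant) (A : SetSeq (IntervalSpace s t)) : SetSeq DyadicSpace :=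
  fun i => {ω | (fun k : Set.Ico (s.num i) (t.num i) => ω k) ∈ A i}

/-- `𝒜_{s,t}`: the subsets of `Ω_{s,t}[all]` whose inverse image belongs to `𝒜`. -/
def intervalField (𝒜 : Set (SetSeq DyadicSpace)) (s t : CoarseInstant) :
    Set (SetSeq (IntervalSpace s t)) :=
  {A | pullback s t A ∈ 𝒜}

/-- `A₁ × A₂`, under the identification `Ω_{r,t}[i] = Ω_{r,s}[i] × Ω_{s,t}[i]`. -/
def rectangle {r s t : CoarseInstant} (hrs : r ≤ s) (hst : s ≤ t)
    (A₁ : SetSeq (IntervalSpace r s)) (A₂ : SetSeq (IntervalSpace s t)) :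
    SetSeq (IntervalSpace r t) :=
  fun i => {ω | ω ∘ Set.inclusion (Set.Ico_subset_Ico_right (hst i)) ∈ A₁ i ∧
    ω ∘ Set.inclusion (Set.Ico_subset_Ico_left (hrs i)) ∈ A₂ i}

/-- The product `𝒜₁ ⊗ 𝒜₂` of coarse σ-fields on `Ω_{r,s}[all]` and `Ω_{s,t}[all]`. -/
def coarseProd {r s t : CoarseInstant} (hrs : r ≤ s) (hst : s ≤ t)
    (𝒜₁ : Set (SetSeq (IntervalSpace r s))) (𝒜₂ : Set (SetSeq (IntervalSpace s t))) :
    Set (SetSeq (IntervalSpace r t)) :=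
  coarseGenerate (intervalMeasure r t) {A | ∃ A₁ ∈ 𝒜₁, ∃ A₂ ∈ 𝒜₂, A = rectangle hrs hst A₁ A₂}

/-- A dyadic coarse factorization. -/
structure IsDyadicCoarseFactorization (𝒜 : Set (SetSeq DyadicSpace)) : Prop where
  isCoarseSigmaField : IsCoarseSigmaField dyadicMeasure 𝒜
  factor : ∀ (r s t : CoarseInstant) (hrs : r ≤ s) (hst : s ≤ t),
    intervalField 𝒜 r t = coarseProd hrs hst (intervalField 𝒜 r s) (intervalField 𝒜 s t)
  generate : coarseGenerate dyadicMeasure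
    {B | ∃ s t : CoarseInstant, s ≤ t ∧ ∃ A ∈ intervalField 𝒜 s t, B = pullback s t A} = 𝒜

/-- The sub-σ-field `ℱ_{s,t}` (completed by null sets) of the refinement of a dyadic coarse
factorization: it consists of the refinements of coarse events of `𝒜_{a,b}`, where `(a, b)` is any
coarse time interval with `a[∞] = s`, `b[∞] = t`. -/
@[reducible] def CoarseRefinement.field {𝒜 : Set (SetSeq DyadicSpace)} {Ω' : Type v} [MeasurableSpace Ω']
    {Q : Measure Ω'} (R : CoarseRefinement dyadicMeasure 𝒜 Q) (s t : ℝ) : MeasurableSpace Ω' :=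
  MeasurableSpace.generateFrom {S | MeasurableSet S ∧ ∃ a b : CoarseInstant, a ≤ b ∧
    a.lim = s ∧ b.lim = t ∧ ∃ A ∈ intervalField 𝒜 a b, S =ᵐ[Q] R.lim (pullback a b A)}

/-! ### Spectral measures -/

/-- The Borel σ-field on the space `𝒞[∞]` of compact subsets of `ℝ`, which carries the topology
of the Hausdorff metric, `∅` being an isolated point. -/
instance : MeasurableSpace (Compacts ℝ) := borel _

instance : BorelSpace (Compacts ℝ) := ⟨rfl⟩

instance : PolishSpace (Compacts ℝ) := inferInstance

section Walsh

variable (𝕜 : Type v) [RCLike 𝕜]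

/-- The Fourier–Walsh function `τ_M = ∏_{m ∈ M} τ_m`. -/
def walsh (M : Finset ℤ) (ω : ℤ → ℤˣ) : 𝕜 := (((∏ k ∈ M, ω k : ℤˣ) : ℤ) : 𝕜)

variable {𝕜}

/-- The Fourier–Walsh coefficient `⟨τ_M, f⟩`. -/
noncomputable def walshCoeff (f : Lp 𝕜 2 (signMeasure ℤ)) (M : Finset ℤ) : 𝕜 :=
  ∫ ω, walsh 𝕜 M ω * f ω ∂(signMeasure ℤ)

/-- The finite set `{k / i : k ∈ M} ⊆ (1/i)ℤ`, as a compact subset of `ℝ`. -/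
noncomputable def latticeSet (i : ℕ+) (M : Finset ℤ) : Compacts ℝ :=
  ⟨(fun k : ℤ => (k : ℝ) / (i : ℝ)) '' M, (M.finite_toSet.image _).isCompact⟩

theorem walsh_memLp (M : Finset ℤ) : MemLp (walsh 𝕜 M) 2 (signMeasure ℤ) := by
  refine MemLp.of_bound (Measurable.aestronglyMeasurable ?_) 1 (Eventually.of_forall fun ω => ?_)
  · unfold walsh
    have : Measurable fun ω : ℤ → ℤˣ => ((∏ k ∈ M, ω k : ℤˣ)) :=
      Finset.measurable_fun_prod M fun k _ => measurable_pi_apply k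
    exact (measurable_of_countable fun u : ℤˣ => ((u : ℤ) : 𝕜)).comp this
  · unfold walsh
    rcases Int.units_eq_one_or (∏ k ∈ M, ω k) with h | h <;> simp [h]

theorem walsh_mul_walsh (M N : Finset ℤ) (ω : ℤ → ℤˣ) :
    walsh 𝕜 M ω * walsh 𝕜 N ω = walsh 𝕜 (M ∆ N) ω := by
  have h : ∏ k ∈ M ∆ N, ω k = (∏ k ∈ M, ω k) * ∏ k ∈ N, ω k := by
    have hd : Disjoint (M \ N) (N \ M) := disjoint_sdiff_sdiff
    rw [Finset.symmDiff_def, Finset.prod_union hd,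
      ← Finset.prod_sdiff (Finset.inter_subset_left (s₁ := M) (s₂ := N)),
      ← Finset.prod_sdiff (Finset.inter_subset_right (s₁ := M) (s₂ := N))]
    rw [Finset.sdiff_inter_self_left, Finset.sdiff_inter_self_right]
    generalize ∏ k ∈ M ∩ N, ω k = c
    rw [mul_mul_mul_comm, Int.units_mul_self, mul_one]
  simp only [walsh, h]
  push_cast
  rfl

theorem map_flip_signMeasure (k₀ : ℤ) :
    (signMeasure ℤ).map (fun ω k => if k = k₀ then -ω k else ω k) = signMeasure ℤ := by
  have h := Measure.infinitePi_map_pi (fun _ : ℤ => coin)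
    (f := fun k (u : ℤˣ) => if k = k₀ then -u else u) (fun _ => measurable_of_countable _)
  unfold signMeasure
  refine h.trans ?_
  congr 1
  funext k
  by_cases hk : k = k₀
  · simp only [hk, if_true, coin]
    rw [Measure.map_smul, Measure.map_add _ _ (measurable_of_countable _),
      Measure.map_dirac' (measurable_of_countable _), Measure.map_dirac' (measurable_of_countable _),
      neg_neg, add_comm]
  · simp only [hk, if_false]
    exact Measure.map_id

theorem integral_walsh {M : Finset ℤ} (hM : M.Nonempty) :
    ∫ ω, walsh 𝕜 M ω ∂(signMeasure ℤ) = 0 := by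
  obtain ⟨k₀, hk⟩ := hM
  have hm : Measurable fun (ω : ℤ → ℤˣ) (k : ℤ) => if k = k₀ then -ω k else ω k := by
    refine measurable_pi_lambda _ fun k => ?_
    exact (measurable_of_countable fun u : ℤˣ => if k = k₀ then -u else u).comp
      (measurable_pi_apply k)
  have h := integral_map (μ := signMeasure ℤ) (f := walsh 𝕜 M) hm.aemeasurable (by
    rw [map_flip_signMeasure]; exact (walsh_memLp M).1)
  rw [map_flip_signMeasure] at h
  have h2 : ∀ ω : ℤ → ℤˣ, walsh 𝕜 M (fun k => if k = k₀ then -ω k else ω k) = -walsh 𝕜 M ω := by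
    intro ω
    have : ∏ k ∈ M, (if k = k₀ then -ω k else ω k) = -∏ k ∈ M, ω k := by
      rw [← Finset.mul_prod_erase M _ hk, ← Finset.mul_prod_erase M ω hk, if_pos rfl, neg_mul]
      congr 2
      exact Finset.prod_congr rfl fun k hk' => if_neg (Finset.ne_of_mem_erase hk')
    simp [walsh, this]
  simp only [h2, integral_neg] at h
  exact self_eq_neg.1 h

theorem walshCoeff_eq_inner (f : Lp 𝕜 2 (signMeasure ℤ)) (M : Finset ℤ) :
    walshCoeff f M = inner 𝕜 (walsh_memLp (𝕜 := 𝕜) M).toLp f := by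
  rw [L2.inner_def]
  refine integral_congr_ae ?_
  filter_upwards [(walsh_memLp (𝕜 := 𝕜) M).coeFn_toLp] with ω hω
  simp [hω, walsh, mul_comm]

theorem orthonormal_walsh :
    Orthonormal 𝕜 fun M : Finset ℤ => (walsh_memLp (𝕜 := 𝕜) M).toLp := by
  classical
  rw [orthonormal_iff_ite]
  intro M N
  rw [← walshCoeff_eq_inner, walshCoeff]
  have h : ∫ ω, walsh 𝕜 M ω * ((walsh_memLp (𝕜 := 𝕜) N).toLp (walsh 𝕜 N)) ω ∂(signMeasure ℤ) =
      ∫ ω, walsh 𝕜 (M ∆ N) ω ∂(signMeasure ℤ) := by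
    refine integral_congr_ae ?_
    filter_upwards [(walsh_memLp (𝕜 := 𝕜) N).coeFn_toLp] with ω hω
    rw [hω, walsh_mul_walsh]
  rw [h]
  split_ifs with hMN
  · simp [hMN, walsh]
  · exact integral_walsh (Finset.nonempty_iff_ne_empty.2 fun h0 => hMN (symmDiff_eq_bot.1 h0))

theorem tsum_walshCoeff_ne_top (f : Lp 𝕜 2 (signMeasure ℤ)) :
    ∑' M, ENNReal.ofReal (‖walshCoeff f M‖ ^ 2) ≠ ∞ := by
  simp only [walshCoeff_eq_inner]
  exact ((orthonormal_walsh (𝕜 := 𝕜)).inner_products_summable f).tsum_ofReal_ne_top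

/-- The spectral measure `μ_f` of `f ∈ L₂[i]`, `μ_f(ℳ) = ∑_{M ∈ ℳ} |f̂_M|²`, as a measure on the
space of compact subsets of `ℝ`. -/
noncomputable def spectralMeasure (i : ℕ+) (f : Lp 𝕜 2 (dyadicMeasure i)) :
    FiniteMeasure (Compacts ℝ) :=
  ⟨Measure.sum fun M : Finset ℤ =>
    ENNReal.ofReal (‖walshCoeff f M‖ ^ 2) • Measure.dirac (latticeSet i M), ⟨by
      rw [Measure.sum_apply _ MeasurableSet.univ]
      simpa [lt_top_iff_ne_top] using tsum_walshCoeff_ne_top f⟩⟩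

/-- `μ` is the spectral measure of `y ∈ L₂(Ω', Q)` w.r.t. a continuous factorization
`(ℱ_{s,t})_{s ≤ t}`: for every elementary set `E`, i.e. a finite union of intervals
treated modulo finite sets, `μ {M | M ⊆ E} = ‖𝔼(y | ℱ_E)‖²`. -/
def IsSpectralMeasure {Ω' : Type*} [MeasurableSpace Ω'] {Q : Measure Ω'}
    (ℱ : ℝ → ℝ → MeasurableSpace Ω') (y : Lp 𝕜 2 Q) (μ : Measure (Compacts ℝ)) : Prop :=
  ∀ (n : ℕ) (a b : Fin n → ℝ), (∀ k, a k ≤ b k) →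
    ∀ E : Set ℝ, (E ∆ ⋃ k, Set.Ioo (a k) (b k)).Finite →
      μ {M | (M : Set ℝ) ⊆ E} = eLpNorm (Q[y | ⨆ k, ℱ (a k) (b k)]) 2 Q ^ 2

end Walsh

end CoarseScaling

open CoarseScaling

/-! For a finite set D of lattice points, μ_x[i] gives the family of all M ⊆ D the mass ∑_{M ⊆ D}
|x̂[i]_M|² = ‖Π_D x[i]‖², where Π_D is the conditional expectation given the signs on D
(`norm_walshProj_sq`). Convergence of the spectral measures therefore comes down to convergence of
these norms when D consists of the lattice points of a finite union of intervals.

Factorization provides this convergence. A coarse event of a long interval is approximated by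
Boolean combinations of intersections of coarse events of successive subintervals. If B depends on
the signs in D and C on signs outside D, independence gives Π_D 1_{B ∩ C} = P[i](C[i]) 1_B, and
P[i](C[i]) has a limit by (e). Hence Π_D x is again an asymptotic limit of combinations of coarse
events (`walshProj_mem_of_mem_prodEvents`, `walshProj_mem`) and has a limit z in any refinement
(`exists_refLim`). This z is measurable with respect to ℱ_E, and x[∞] - z is orthogonal to ℱ_E, so z
= 𝔼(x[∞] | ℱ_E) and the norms converge to its norm (`tendsto_sum_walshCoeff`).

Orthogonality to all of ℱ_E requires that 𝒜_{a,b} depend, asymptotically, only on a[∞] and b[∞].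
This is because a coarse interval with a[∞] = b[∞] carries only trivial events
(`intervalEvents_subset_trivialAlg`): cut it at the instant equal to a[i] for even i and to b[i] for
odd i. Each piece is empty for infinitely many i, so its events have limiting probability 0 or 1.

The passage to weak convergence uses three facts. The measures are tight, because x is approximated
by events of bounded intervals. The sets {M | M ⊆ E}, E a finite union of intervals [a,b), form a
π-system generating the Borel σ-field (`borel_compacts_eq`). No weak cluster point charges {M | s ∈
M}, because coarse intervals shrinking to s carry vanishing spectral mass
(`tendsto_spectralMeasure_zero`, `exists_spectralMeasure_hit_le`). So all cluster points take the
same values on the π-system and coincide, and Prokhorov's theorem gives the limit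
(`exists_tendsto_of_compactsIn`). Absence of fixed points also allows E to be changed by a finite
set. -/

namespace CoarseScaling

/-! ### Approximation of coarse events -/

/-- The sequences of measurable sets that are approximated by members of `𝒞`, asymptotically
and in measure. -/
def Approximable (𝒞 : Set (SetSeq DyadicSpace)) : Set (SetSeq DyadicSpace) :=
  {A | (∀ i, MeasurableSet (A i)) ∧ ∀ ε : ℝ≥0∞, ε ≠ 0 → ∃ C ∈ 𝒞,
    ∀ᶠ i in atTop, signMeasure ℤ (A i ∆ C i) ≤ ε}

/-- A Boolean algebra of sequences of sets. -/
structure IsBoolAlg (𝒞 : Set (SetSeq DyadicSpace)) : Prop where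
  empty : (fun _ => ∅) ∈ 𝒞
  compl : ∀ C ∈ 𝒞, (fun i => (C i)ᶜ) ∈ 𝒞
  inter : ∀ C ∈ 𝒞, ∀ D ∈ 𝒞, (fun i => C i ∩ D i) ∈ 𝒞

variable {𝒞 𝒟 : Set (SetSeq DyadicSpace)} {A B : SetSeq DyadicSpace}

theorem Approximable.of_mem (hm : ∀ i, MeasurableSet (A i)) (h : A ∈ 𝒞) : A ∈ Approximable 𝒞 :=
  ⟨hm, fun ε _ => ⟨A, h, by simp⟩⟩

theorem Approximable.mono (h : 𝒞 ⊆ 𝒟) : Approximable 𝒞 ⊆ Approximable 𝒟 := by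
  rintro A ⟨hA, h1⟩
  refine ⟨hA, fun ε hε => ?_⟩
  obtain ⟨C, hC, h2⟩ := h1 ε hε
  exact ⟨C, h hC, h2⟩

theorem Approximable.compl (h𝒞 : IsBoolAlg 𝒞) (hA : A ∈ Approximable 𝒞) :
    (fun i => (A i)ᶜ) ∈ Approximable 𝒞 := by
  refine ⟨fun i => (hA.1 i).compl, fun ε hε => ?_⟩
  obtain ⟨C, hC, h⟩ := hA.2 ε hε
  exact ⟨_, h𝒞.compl C hC, by simpa only [compl_symmDiff_compl] using h⟩

theorem Approximable.inter (h𝒞 : IsBoolAlg 𝒞) (hA : A ∈ Approximable 𝒞)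
    (hB : B ∈ Approximable 𝒞) : (fun i => A i ∩ B i) ∈ Approximable 𝒞 := by
  refine ⟨fun i => (hA.1 i).inter (hB.1 i), fun ε hε => ?_⟩
  have hε2 : ε / 2 ≠ 0 := by simpa using hε
  obtain ⟨C, hC, h⟩ := hA.2 _ hε2
  obtain ⟨D, hD, h'⟩ := hB.2 _ hε2
  refine ⟨_, h𝒞.inter C hC D hD, ?_⟩
  filter_upwards [h, h'] with i hi hi'
  exact (measure_mono (inter_symmDiff_inter_subset _ _ _ _)).trans
    ((measure_union_le _ _).trans ((add_le_add hi hi').trans_eq (ENNReal.add_halves ε)))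

theorem Approximable.union (h𝒞 : IsBoolAlg 𝒞) (hA : A ∈ Approximable 𝒞)
    (hB : B ∈ Approximable 𝒞) : (fun i => A i ∪ B i) ∈ Approximable 𝒞 := by
  simpa [Set.compl_inter] using
    Approximable.compl h𝒞 (Approximable.inter h𝒞 (Approximable.compl h𝒞 hA)
      (Approximable.compl h𝒞 hB))

theorem Approximable.negligible (h𝒞 : IsBoolAlg 𝒞) (hm : ∀ i, MeasurableSet (A i))
    (hA : Tendsto (fun i => signMeasure ℤ (A i)) atTop (𝓝 0)) : A ∈ Approximable 𝒞 := by
  refine ⟨hm, fun ε hε => ⟨_, h𝒞.empty, ?_⟩⟩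
  filter_upwards [ENNReal.tendsto_nhds_zero.1 hA ε (pos_iff_ne_zero.2 hε)] with i hi
  rwa [← Set.bot_eq_empty, symmDiff_bot]

/-- The sequences approximable by a Boolean algebra are closed under the operations (b), (c), (d)
of a coarse σ-field. -/
theorem Approximable.coarselyClosed (h𝒞 : IsBoolAlg 𝒞) :
    CoarselyClosed dyadicMeasure (Approximable 𝒞) where
  inter A hA B hB := Approximable.inter h𝒞 hA hB
  union A hA B hB := Approximable.union h𝒞 hA hB
  compl A hA := Approximable.compl h𝒞 hA
  negligible A hm hA := Approximable.negligible h𝒞 hm hA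
  iUnion A hA _ hs := by
    refine ⟨fun i => MeasurableSet.iUnion fun k => (hA k).1 i, fun ε hε => ?_⟩
    have hfin : ∀ N : ℕ, (fun i => ⋃ k < N, A k i) ∈ Approximable 𝒞 := by
      intro N
      induction N with
      | zero => simpa using Approximable.of_mem (fun _ => MeasurableSet.empty) h𝒞.empty
      | succ N ih => simpa only [Set.biUnion_lt_succ] using Approximable.union h𝒞 ih (hA N)
    have hε2 : ε / 2 ≠ 0 := by simpa using hε
    -- Summability of the suprema over i makes a tail of the union small uniformly in i; the
    -- remaining finite union is handled by the Boolean operations.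
    obtain ⟨N, hN⟩ := ((ENNReal.tendsto_nhds_zero.1
      (ENNReal.tendsto_sum_nat_add _ hs)) (ε / 2) (pos_iff_ne_zero.2 hε2)).exists
    obtain ⟨C, hC, h⟩ := (hfin N).2 _ hε2
    refine ⟨C, hC, ?_⟩
    filter_upwards [h] with i hi
    refine (measure_mono (iUnion_symmDiff_subset N (fun k => A k i) _)).trans
      ((measure_union_le _ _).trans ((add_le_add hi ?_).trans_eq (ENNReal.add_halves ε)))
    exact (measure_iUnion_le _).trans ((ENNReal.tsum_le_tsum fun k =>
      le_iSup (fun i => dyadicMeasure i (A (k + N) i)) i).trans hN)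

/-- Minimality of the generated family: an approximation property needs to be checked on generators
only. -/
theorem coarseGenerate_subset_approximable (h𝒞 : IsBoolAlg 𝒞) {𝒢 : Set (SetSeq DyadicSpace)}
    (h : 𝒢 ⊆ Approximable 𝒞) : coarseGenerate dyadicMeasure 𝒢 ⊆ Approximable 𝒞 :=
  Set.sInter_subset_of_mem ⟨Approximable.coarselyClosed h𝒞, h⟩

/-! ### Coarse events of a time interval -/

theorem measurable_restrict_sign (S : Set ℤ) :
    Measurable fun (ω : ℤ → ℤˣ) (k : S) => ω k :=
  measurable_pi_lambda _ fun k => measurable_pi_apply (k : ℤ)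

theorem map_restrict_signMeasure (S : Set ℤ) :
    (signMeasure ℤ).map (fun ω (k : S) => ω k) = signMeasure S :=
  Measure.infinitePi_map_restrict' (fun _ : ℤ => coin)

/-- A bounded interval contains finitely many lattice points, so its sign space is finite and
discrete. -/
theorem measurableSet_intervalSpace {s t : CoarseInstant} {i : ℕ+} (A : Set (IntervalSpace s t i)) :
    MeasurableSet A :=
  A.toFinite.measurableSet

theorem signMeasure_pullback (s t : CoarseInstant) (A : SetSeq (IntervalSpace s t)) (i : ℕ+) :
    signMeasure ℤ (pullback s t A i) = intervalMeasure s t i (A i) := by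
  rw [intervalMeasure, ← map_restrict_signMeasure,
    Measure.map_apply (measurable_restrict_sign _) (measurableSet_intervalSpace _)]
  rfl

theorem measurableSet_pullback (s t : CoarseInstant) (A : SetSeq (IntervalSpace s t)) (i : ℕ+) :
    MeasurableSet (pullback s t A i) :=
  measurable_restrict_sign _ (measurableSet_intervalSpace (A i))

/-- Restriction of signs preserves the measures, so (b), (c), (d) pass through inverse images. This
lets the minimality of a product on Ω_{r,t}[all] be tested against families of subsets of Ω[all]. -/
theorem CoarselyClosed.preimage_pullback {ℬ : Set (SetSeq DyadicSpace)}
    (h : CoarselyClosed dyadicMeasure ℬ) (s t : CoarseInstant) :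
    CoarselyClosed (intervalMeasure s t) {A | pullback s t A ∈ ℬ} where
  inter A hA B hB := h.inter _ hA _ hB
  union A hA B hB := h.union _ hA _ hB
  compl A hA := h.compl _ hA
  negligible A _ hA := h.negligible _ (measurableSet_pullback s t A)
    (by simpa only [dyadicMeasure, signMeasure_pullback] using hA)
  iUnion A hA hd hs := by
    have := h.iUnion _ hA (fun i k l hkl => (hd i hkl).preimage _)
      (by simpa only [dyadicMeasure, signMeasure_pullback] using hs)
    change pullback s t _ ∈ ℬ
    convert this using 2 with i
    ext ω
    simp [pullback]

/-- The inverse images in `Ω[all]` of the members of `𝒜_{s,t}`. -/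
def intervalEvents (𝒜 : Set (SetSeq DyadicSpace)) (s t : CoarseInstant) :
    Set (SetSeq DyadicSpace) :=
  {B | B ∈ 𝒜 ∧ ∃ A, B = pullback s t A}

variable {𝒜 : Set (SetSeq DyadicSpace)} {r s t : CoarseInstant}

instance : Preorder CoarseInstant where
  le_refl _ _ := le_rfl
  le_trans _ _ _ h h' i := (h i).trans (h' i)

/-- Restriction to the smaller interval factors through restriction to the larger one. -/
theorem intervalEvents_mono {s' t' : CoarseInstant} (hs : s' ≤ s) (ht : t ≤ t') :
    intervalEvents 𝒜 s t ⊆ intervalEvents 𝒜 s' t' := by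
  rintro _ ⟨hB, A, rfl⟩
  exact ⟨hB, fun i => {ω | ω ∘ Set.inclusion (Set.Ico_subset_Ico (hs i) (ht i)) ∈ A i}, rfl⟩

theorem intervalEvents.measurableSet (hB : B ∈ intervalEvents 𝒜 s t) (i : ℕ+) :
    MeasurableSet (B i) := by
  obtain ⟨_, A, rfl⟩ := hB
  exact measurableSet_pullback s t A i

theorem isBoolAlg_intervalEvents (h𝒜 : CoarselyClosed dyadicMeasure 𝒜) (s t : CoarseInstant) :
    IsBoolAlg (intervalEvents 𝒜 s t) where
  empty := ⟨h𝒜.empty_mem, fun _ => ∅, rfl⟩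
  compl := by
    rintro _ ⟨hC, A, rfl⟩
    exact ⟨h𝒜.compl _ hC, fun i => (A i)ᶜ, rfl⟩
  inter := by
    rintro _ ⟨hC, A, rfl⟩ _ ⟨hD, B, rfl⟩
    exact ⟨h𝒜.inter _ hC _ hD, fun i => A i ∩ B i, rfl⟩

theorem IsBoolAlg.univ (h : IsBoolAlg 𝒞) : (fun _ => Set.univ) ∈ 𝒞 := by
  simpa using h.compl _ h.empty

/-- Induction for the coarse events of `[r, t)`: they belong to every coarsely closed family that
contains the intersections of coarse events of `[r, s)` and of `[s, t)`. -/
theorem IsDyadicCoarseFactorization.intervalEvents_subset (h𝒜 : IsDyadicCoarseFactorization 𝒜)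
    (hrs : r ≤ s) (hst : s ≤ t) {ℬ : Set (SetSeq DyadicSpace)}
    (hℬ : CoarselyClosed dyadicMeasure ℬ)
    (h : ∀ A ∈ intervalEvents 𝒜 r s, ∀ B ∈ intervalEvents 𝒜 s t, (fun i => A i ∩ B i) ∈ ℬ) :
    intervalEvents 𝒜 r t ⊆ ℬ := by
  rintro _ ⟨hA, A, rfl⟩
  have hA' : A ∈ intervalField 𝒜 r t := hA
  rw [h𝒜.factor r s t hrs hst] at hA'
  refine hA' {A | pullback r t A ∈ ℬ} ⟨hℬ.preimage_pullback r t, ?_⟩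
  rintro _ ⟨A₁, h₁, A₂, h₂, rfl⟩
  exact h _ ⟨h₁, A₁, rfl⟩ _ ⟨h₂, A₂, rfl⟩

/-- The pointwise minimum of two coarse instants. -/
noncomputable def CoarseInstant.min (s t : CoarseInstant) : CoarseInstant where
  num i := Min.min (s.num i) (t.num i)
  lim := Min.min s.lim t.lim
  tendsto := by
    refine (s.tendsto.min t.tendsto).congr fun i => ?_
    rw [min_div_div_right (by positivity), Int.cast_min]

/-- The pointwise maximum of two coarse instants. -/
noncomputable def CoarseInstant.max (s t : CoarseInstant) : CoarseInstant where
  num i := Max.max (s.num i) (t.num i)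
  lim := Max.max s.lim t.lim
  tendsto := by
    refine (s.tendsto.max t.tendsto).congr fun i => ?_
    rw [max_div_div_right (by positivity), Int.cast_max]

theorem CoarseInstant.min_le_left (s t : CoarseInstant) : s.min t ≤ s :=
  fun _ => _root_.min_le_left _ _
theorem CoarseInstant.min_le_right (s t : CoarseInstant) : s.min t ≤ t :=
  fun _ => _root_.min_le_right _ _
theorem CoarseInstant.le_max_left (s t : CoarseInstant) : s ≤ s.max t :=
  fun _ => _root_.le_max_left _ _
theorem CoarseInstant.le_max_right (s t : CoarseInstant) : t ≤ s.max t :=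
  fun _ => _root_.le_max_right _ _

/-- Every coarse event is approximated by coarse events of bounded time intervals. -/
theorem IsDyadicCoarseFactorization.subset_approximable (h𝒜 : IsDyadicCoarseFactorization 𝒜) :
    𝒜 ⊆ Approximable (⋃ (s : CoarseInstant) (t : CoarseInstant) (_ : s ≤ t),
      intervalEvents 𝒜 s t) := by
  have hc := h𝒜.isCoarseSigmaField.toCoarselyClosed
  have hb : IsBoolAlg (⋃ (s : CoarseInstant) (t : CoarseInstant) (_ : s ≤ t),
      intervalEvents 𝒜 s t) := by
    refine ⟨?_, ?_, ?_⟩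
    · let z : CoarseInstant := ⟨fun _ => 0, 0, by simp⟩
      simp only [Set.mem_iUnion]
      exact ⟨z, z, le_refl z, (isBoolAlg_intervalEvents hc z z).empty⟩
    · simp only [Set.mem_iUnion]
      rintro C ⟨s, t, hst, hC⟩
      exact ⟨s, t, hst, (isBoolAlg_intervalEvents hc s t).compl C hC⟩
    · simp only [Set.mem_iUnion]
      rintro C ⟨s, t, hst, hC⟩ D ⟨s', t', hst', hD⟩
      -- The interval from the minimum of the left ends to the maximum of the right ends contains
      -- both given intervals, so the algebras form a directed family.
      exact ⟨s.min s', t.max t', ((s.min_le_left s').trans hst).trans (t.le_max_left t'),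
        (isBoolAlg_intervalEvents hc _ _).inter C
          (intervalEvents_mono (s.min_le_left s') (t.le_max_left t') hC) D
          (intervalEvents_mono (s.min_le_right s') (t.le_max_right t') hD)⟩
  intro A hA
  rw [← h𝒜.generate] at hA
  refine coarseGenerate_subset_approximable hb ?_ hA
  rintro _ ⟨s, t, hst, A, hA, rfl⟩
  refine Approximable.of_mem (measurableSet_pullback s t A) ?_
  simp only [Set.mem_iUnion]
  exact ⟨s, t, hst, hA, A, rfl⟩

end CoarseScaling

namespace CoarseScaling

/-! ### Indicators in `L₂` -/

section Indicator

variable (𝕜 : Type*) [RCLike 𝕜] {Y : Type*} [MeasurableSpace Y] (μ : Measure Y) [IsFiniteMeasure μ]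

open Classical in
/-- The indicator of a measurable set as a vector of `L₂` (zero if the set is not measurable). -/
noncomputable def indLp (A : Set Y) : Lp 𝕜 2 μ :=
  if h : MeasurableSet A then indicatorConstLp 2 h (measure_ne_top μ A) (1 : 𝕜) else 0

variable {𝕜 μ} {A B : Set Y}

theorem indLp_of_measurableSet (h : MeasurableSet A) :
    indLp 𝕜 μ A = indicatorConstLp 2 h (measure_ne_top μ A) (1 : 𝕜) := dif_pos h

theorem memLp_indicator_one (h : MeasurableSet A) :
    MemLp (A.indicator fun _ => (1 : 𝕜)) 2 μ :=
  memLp_indicator_const 2 h _ (Or.inr (measure_ne_top μ A))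

theorem indLp_eq_toLp (h : MeasurableSet A) :
    indLp 𝕜 μ A = (memLp_indicator_one (𝕜 := 𝕜) (μ := μ) h).toLp := indLp_of_measurableSet h

theorem indLp_congr (hA : MeasurableSet A) (hB : MeasurableSet B) (h : A =ᵐ[μ] B) :
    indLp 𝕜 μ A = indLp 𝕜 μ B := by
  rw [indLp_eq_toLp hA, indLp_eq_toLp hB, MemLp.toLp_eq_toLp_iff]
  exact indicator_ae_eq_of_ae_eq_set h

/-- This converts approximation in measure into approximation in norm and back; it is the source of
the ε² in later estimates. -/
theorem norm_indLp_sub_sq (hA : MeasurableSet A) (hB : MeasurableSet B) :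
    ‖indLp 𝕜 μ A - indLp 𝕜 μ B‖ ^ 2 = μ.real (A ∆ B) := by
  rw [← dist_eq_norm, indLp_of_measurableSet hA, indLp_of_measurableSet hB,
    dist_indicatorConstLp_eq_norm, norm_indicatorConstLp (by simp) (by simp), norm_one, one_mul,
    ENNReal.toReal_ofNat, ← Real.sqrt_eq_rpow, Real.sq_sqrt measureReal_nonneg]

theorem norm_indLp_sub_le {ε : ℝ} (hε : 0 ≤ ε) (hA : MeasurableSet A) (hB : MeasurableSet B)
    (h : μ (A ∆ B) ≤ ENNReal.ofReal (ε ^ 2)) : ‖indLp 𝕜 μ A - indLp 𝕜 μ B‖ ≤ ε := by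
  refine le_of_sq_le_sq ?_ hε
  rw [norm_indLp_sub_sq hA hB]
  exact ENNReal.toReal_le_of_le_ofReal (by positivity) h

theorem norm_indLp_le [IsProbabilityMeasure μ] : ‖indLp 𝕜 μ A‖ ≤ 1 := by
  by_cases h : MeasurableSet A
  · rw [indLp_of_measurableSet h, norm_indicatorConstLp (by simp) (by simp), norm_one, one_mul]
    exact Real.rpow_le_one measureReal_nonneg measureReal_le_one (by positivity)
  · simp [indLp, h]

end Indicator

/-! ### Asymptotic closure -/

section Closure

variable {𝕜 : Type*} [RCLike 𝕜] {H : Type*} [NormedAddCommGroup H] [NormedSpace 𝕜 H]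

/-- The sequences that are asymptotically approximated by members of `S`. -/
def asympClosure (S : Submodule 𝕜 (ℕ+ → H)) : Submodule 𝕜 (ℕ+ → H) where
  carrier := {w | ∀ ε : ℝ, 0 < ε → ∃ p ∈ S, ∀ᶠ i in atTop, ‖w i - p i‖ ≤ ε}
  zero_mem' := fun _ hε => ⟨0, S.zero_mem, by simp [hε.le]⟩
  add_mem' := by
    intro v w hv hw ε hε
    obtain ⟨p, hp, h⟩ := hv (ε / 2) (by positivity)
    obtain ⟨q, hq, h'⟩ := hw (ε / 2) (by positivity)
    refine ⟨p + q, S.add_mem hp hq, ?_⟩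
    filter_upwards [h, h'] with i hi hi'
    rw [Pi.add_apply, Pi.add_apply, add_sub_add_comm]
    exact (norm_add_le _ _).trans (by linarith)
  smul_mem' := by
    intro c w hw ε hε
    obtain ⟨p, hp, h⟩ := hw (ε / (‖c‖ + 1)) (by positivity)
    refine ⟨c • p, S.smul_mem c hp, ?_⟩
    filter_upwards [h] with i hi
    rw [Pi.smul_apply, Pi.smul_apply, ← smul_sub, norm_smul]
    calc ‖c‖ * ‖w i - p i‖ ≤ (‖c‖ + 1) * (ε / (‖c‖ + 1)) := by gcongr; linarith
      _ = ε := by field_simp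

variable {S T : Submodule 𝕜 (ℕ+ → H)} {w : ℕ+ → H}

theorem le_asympClosure : S ≤ asympClosure S := fun p hp _ hε => ⟨p, hp, by simp [hε.le]⟩

/-- Idempotence of the closure, by splitting ε in halves. -/
theorem mem_asympClosure_of_approx
    (h : ∀ ε : ℝ, 0 < ε → ∃ v ∈ asympClosure S, ∀ᶠ i in atTop, ‖w i - v i‖ ≤ ε) :
    w ∈ asympClosure S := by
  intro ε hε
  obtain ⟨v, hv, h1⟩ := h (ε / 2) (by positivity)
  obtain ⟨p, hp, h2⟩ := hv (ε / 2) (by positivity)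
  refine ⟨p, hp, ?_⟩
  filter_upwards [h1, h2] with i hi hi'
  have := norm_sub_le_norm_sub_add_norm_sub (w i) (v i) (p i)
  linarith

theorem asympClosure_le (h : S ≤ asympClosure T) : asympClosure S ≤ asympClosure T := by
  intro w hw
  refine mem_asympClosure_of_approx fun ε hε => ?_
  obtain ⟨p, hp, h'⟩ := hw ε hε
  exact ⟨p, h hp, h'⟩

theorem asympClosure_mono (h : S ≤ T) : asympClosure S ≤ asympClosure T :=
  asympClosure_le (h.trans le_asympClosure)

theorem mem_asympClosure_of_tendsto {v : ℕ+ → H} (hv : v ∈ asympClosure S)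
    (h : Tendsto (fun i => ‖w i - v i‖) atTop (𝓝 0)) : w ∈ asympClosure S :=
  mem_asympClosure_of_approx fun _ hε =>
    ⟨v, hv, (h.eventually_lt_const hε).mono fun _ hi => hi.le⟩

/-- A sequence of contractions that maps `S` to the closure of `T` maps the closure of `S` to the
closure of `T`. -/
theorem map_mem_asympClosure (Φ : ℕ+ → H →L[𝕜] H) (hΦ : ∀ i f, ‖Φ i f‖ ≤ ‖f‖)
    (h : ∀ p ∈ S, (fun i => Φ i (p i)) ∈ asympClosure T) (hw : w ∈ asympClosure S) :
    (fun i => Φ i (w i)) ∈ asympClosure T := by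
  refine mem_asympClosure_of_approx fun ε hε => ?_
  obtain ⟨p, hp, h'⟩ := hw ε hε
  refine ⟨_, h p hp, h'.mono fun i hi => ?_⟩
  rw [← map_sub]
  exact (hΦ i _).trans hi

end Closure

/-! ### The span of indicators of coarse events -/

section Span

variable (𝕜 : Type*) [RCLike 𝕜]

/-- The indicator of `A ⊆ Ω[all]`, as a sequence of vectors of `L₂`. -/
noncomputable def indSeq (A : SetSeq DyadicSpace) : ℕ+ → Lp 𝕜 2 (signMeasure ℤ) :=
  fun i => indLp 𝕜 (signMeasure ℤ) (A i)

/-- The linear combinations of indicators of members of `𝒢`. -/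
noncomputable def indSpan (𝒢 : Set (SetSeq DyadicSpace)) :
    Submodule 𝕜 (ℕ+ → Lp 𝕜 2 (signMeasure ℤ)) :=
  Submodule.span 𝕜 (indSeq 𝕜 '' 𝒢)

/-- The linear combinations of indicators of members of `𝒢`, as functions. -/
def indFunSpan (𝒢 : Set (SetSeq DyadicSpace)) : Submodule 𝕜 (ℕ+ → (ℤ → ℤˣ) → 𝕜) :=
  Submodule.span 𝕜 ((fun A i => (A i).indicator fun _ => 1) '' 𝒢)

/-- The sequences of measurable sets whose indicators are linear combinations of indicators of
members of `𝒢`. -/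
def spanAlg (𝒢 : Set (SetSeq DyadicSpace)) : Set (SetSeq DyadicSpace) :=
  {C | (∀ i, MeasurableSet (C i)) ∧ (fun i => (C i).indicator fun _ => (1 : 𝕜)) ∈ indFunSpan 𝕜 𝒢}

variable {𝕜} {𝒢 𝒢' : Set (SetSeq DyadicSpace)} {A : SetSeq DyadicSpace}

theorem indSeq_mem_indSpan (h : A ∈ 𝒢) : indSeq 𝕜 A ∈ indSpan 𝕜 𝒢 :=
  Submodule.subset_span ⟨A, h, rfl⟩

theorem spanAlg_mono (h : 𝒢 ⊆ 𝒢') : spanAlg 𝕜 𝒢 ⊆ spanAlg 𝕜 𝒢' := fun _ hC =>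
  ⟨hC.1, Submodule.span_mono (Set.image_mono h) hC.2⟩

theorem mem_spanAlg (hm : ∀ i, MeasurableSet (A i)) (h : A ∈ 𝒢) : A ∈ spanAlg 𝕜 𝒢 :=
  ⟨hm, Submodule.subset_span ⟨A, h, rfl⟩⟩

/-- If 𝒢 is closed under intersections and contains the whole space, the span of its indicators is
closed under products and contains 1. Complements and intersections then come from 1 - 1_C and 1_C
1_D. -/
theorem isBoolAlg_spanAlg (huniv : (fun _ => Set.univ) ∈ 𝒢)
    (hinter : ∀ A ∈ 𝒢, ∀ B ∈ 𝒢, (fun i => A i ∩ B i) ∈ 𝒢) : IsBoolAlg (spanAlg 𝕜 𝒢) where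
  empty := ⟨fun _ => MeasurableSet.empty, by
    convert (indFunSpan 𝕜 𝒢).zero_mem using 1
    ext; simp⟩
  compl := by
    rintro C ⟨hm, hC⟩
    refine ⟨fun i => (hm i).compl, ?_⟩
    have h1 : (fun _ => Set.univ.indicator fun _ => (1 : 𝕜)) ∈ indFunSpan 𝕜 𝒢 :=
      Submodule.subset_span ⟨_, huniv, rfl⟩
    convert (indFunSpan 𝕜 𝒢).sub_mem h1 hC using 1
    ext i ω
    by_cases h : ω ∈ C i <;> simp [h]
  inter := by
    rintro C ⟨hm, hC⟩ D ⟨hm', hD⟩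
    refine ⟨fun i => (hm i).inter (hm' i), ?_⟩
    have h := Submodule.mul_mem_mul hC hD
    rw [indFunSpan, Submodule.span_mul_span] at h
    have h2 := Submodule.span_mono (t := (fun (A : SetSeq DyadicSpace) (i : ℕ+) =>
      (A i).indicator fun _ => (1 : 𝕜)) '' 𝒢) ?_ h
    · rw [indFunSpan]
      convert h2 using 1
      ext i ω
      by_cases h : ω ∈ C i <;> by_cases h' : ω ∈ D i <;> simp [h, h']
    · rintro _ ⟨_, ⟨A, hA, rfl⟩, _, ⟨B, hB, rfl⟩, rfl⟩
      refine ⟨_, hinter A hA B hB, ?_⟩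
      ext i ω
      by_cases h : ω ∈ A i <;> by_cases h' : ω ∈ B i <;> simp [h, h']

/-- Products are formed for genuine functions; this returns from functions to classes in L₂, where
the projections act. -/
theorem indSeq_mem_of_mem_spanAlg (hm : ∀ A ∈ 𝒢, ∀ i, MeasurableSet (A i))
    (h : A ∈ spanAlg 𝕜 𝒢) : indSeq 𝕜 A ∈ indSpan 𝕜 𝒢 := by
  have key : ∀ f ∈ indFunSpan 𝕜 𝒢, ∃ hf : ∀ i, MemLp (f i) 2 (signMeasure ℤ),
      (fun i => (hf i).toLp) ∈ indSpan 𝕜 𝒢 := by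
    intro f hf
    induction hf using Submodule.span_induction with
    | mem f hf =>
      obtain ⟨B, hB, rfl⟩ := hf
      refine ⟨fun i => memLp_indicator_one (hm B hB i), ?_⟩
      convert indSeq_mem_indSpan (𝕜 := 𝕜) hB using 1
      ext1 i
      exact (indLp_eq_toLp (hm B hB i)).symm
    | zero => exact ⟨fun i => MemLp.zero, (indSpan 𝕜 𝒢).zero_mem⟩
    | add f g _ _ hf hg =>
      obtain ⟨hf, hf'⟩ := hf
      obtain ⟨hg, hg'⟩ := hg
      exact ⟨fun i => (hf i).add (hg i), (indSpan 𝕜 𝒢).add_mem hf' hg'⟩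
    | smul c f _ hf =>
      obtain ⟨hf, hf'⟩ := hf
      exact ⟨fun i => (hf i).const_smul c, (indSpan 𝕜 𝒢).smul_mem c hf'⟩
  obtain ⟨h1, h2⟩ := key _ h.2
  convert h2 using 1
  ext1 i
  exact indLp_eq_toLp (h.1 i)

theorem indSeq_mem_asympClosure_of_approximable {𝒞 : Set (SetSeq DyadicSpace)}
    {S : Submodule 𝕜 (ℕ+ → Lp 𝕜 2 (signMeasure ℤ))} (hm : ∀ C ∈ 𝒞, ∀ i, MeasurableSet (C i))
    (hS : ∀ C ∈ 𝒞, indSeq 𝕜 C ∈ asympClosure S)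
    (h : A ∈ Approximable 𝒞) : indSeq 𝕜 A ∈ asympClosure S := by
  refine mem_asympClosure_of_approx fun ε hε => ?_
  obtain ⟨C, hC, h'⟩ := h.2 (ENNReal.ofReal (ε ^ 2)) (by simpa using hε.ne')
  exact ⟨_, hS C hC, h'.mono fun i hi => norm_indLp_sub_le hε.le (h.1 i) (hm C hC i) hi⟩

/-- By linearity and contractivity, a statement about the whole closure reduces to indicators of
members of 𝒢. -/
theorem map_mem_asympClosure_indSpan {w : ℕ+ → Lp 𝕜 2 (signMeasure ℤ)}
    {T : Submodule 𝕜 (ℕ+ → Lp 𝕜 2 (signMeasure ℤ))}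
    (Φ : ℕ+ → Lp 𝕜 2 (signMeasure ℤ) →L[𝕜] Lp 𝕜 2 (signMeasure ℤ)) (hΦ : ∀ i f, ‖Φ i f‖ ≤ ‖f‖)
    (h : ∀ A ∈ 𝒢, (fun i => Φ i (indSeq 𝕜 A i)) ∈ asympClosure T)
    (hw : w ∈ asympClosure (indSpan 𝕜 𝒢)) : (fun i => Φ i (w i)) ∈ asympClosure T := by
  refine map_mem_asympClosure Φ hΦ (fun p hp => ?_) hw
  induction hp using Submodule.span_induction with
  | mem p hp =>
    obtain ⟨A, hA, rfl⟩ := hp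
    exact h A hA
  | zero =>
    simp only [Pi.zero_apply, map_zero]
    exact Submodule.zero_mem _
  | add p q _ _ hp hq =>
    simp only [Pi.add_apply, map_add]
    exact Submodule.add_mem _ hp hq
  | smul c p _ hp =>
    simp only [Pi.smul_apply, map_smul]
    exact Submodule.smul_mem _ c hp

end Span

end CoarseScaling

namespace CoarseScaling

/-! ### Fourier–Walsh projections -/

section WalshProjection

variable {𝕜 : Type*} [RCLike 𝕜]

/-- The Fourier–Walsh function `τ_M` as a vector of `L₂`. -/
noncomputable def walshVec (𝕜 : Type*) [RCLike 𝕜] (M : Finset ℤ) : Lp 𝕜 2 (signMeasure ℤ) :=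
  (walsh_memLp (𝕜 := 𝕜) M).toLp

theorem orthonormal_walshVec : Orthonormal 𝕜 (walshVec 𝕜) := orthonormal_walsh

theorem walshCoeff_eq_inner_walshVec (f : Lp 𝕜 2 (signMeasure ℤ)) (M : Finset ℤ) :
    walshCoeff f M = inner 𝕜 (walshVec 𝕜 M) f := walshCoeff_eq_inner f M

/-- The projection `f ↦ ∑_{M ⊆ D} ⟨τ_M, f⟩ τ_M`, i.e. the conditional expectation given the signs
at the points of `D`. -/
noncomputable def walshProj (𝕜 : Type*) [RCLike 𝕜] (D : Finset ℤ) :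
    Lp 𝕜 2 (signMeasure ℤ) →L[𝕜] Lp 𝕜 2 (signMeasure ℤ) :=
  ∑ M ∈ D.powerset, (innerSL 𝕜 (walshVec 𝕜 M)).smulRight (walshVec 𝕜 M)

theorem walshProj_apply (D : Finset ℤ) (f : Lp 𝕜 2 (signMeasure ℤ)) :
    walshProj 𝕜 D f = ∑ M ∈ D.powerset, walshCoeff f M • walshVec 𝕜 M := by
  simp [walshProj, walshCoeff_eq_inner_walshVec]

/-- Parseval for a finite orthonormal family. This identity links the spectral measure to
conditional expectations. -/
theorem norm_walshProj_sq (D : Finset ℤ) (f : Lp 𝕜 2 (signMeasure ℤ)) :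
    ‖walshProj 𝕜 D f‖ ^ 2 = ∑ M ∈ D.powerset, ‖walshCoeff f M‖ ^ 2 := by
  have h := (orthonormal_walshVec (𝕜 := 𝕜)).inner_sum (walshCoeff f) (walshCoeff f) D.powerset
  rw [← walshProj_apply, inner_self_eq_norm_sq_to_K] at h
  simp only [RCLike.conj_mul] at h
  exact_mod_cast h

theorem norm_walshProj_le (D : Finset ℤ) (f : Lp 𝕜 2 (signMeasure ℤ)) :
    ‖walshProj 𝕜 D f‖ ≤ ‖f‖ := by
  refine le_of_sq_le_sq ?_ (norm_nonneg _)
  rw [norm_walshProj_sq]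
  simp only [walshCoeff_eq_inner_walshVec]
  exact orthonormal_walshVec.sum_inner_products_le f

theorem inner_walshProj_left (D : Finset ℤ) (f g : Lp 𝕜 2 (signMeasure ℤ)) :
    inner 𝕜 (walshProj 𝕜 D f) g = inner 𝕜 f (walshProj 𝕜 D g) := by
  simp only [walshProj_apply, sum_inner, inner_sum, inner_smul_left, inner_smul_right,
    walshCoeff_eq_inner_walshVec, inner_conj_symm]
  exact Finset.sum_congr rfl fun M _ => mul_comm _ _

theorem walshProj_walshVec (D M : Finset ℤ) :
    walshProj 𝕜 D (walshVec 𝕜 M) = if M ⊆ D then walshVec 𝕜 M else 0 := by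
  classical
  rw [walshProj_apply]
  simp only [walshCoeff_eq_inner_walshVec, orthonormal_iff_ite.1 orthonormal_walshVec, ite_smul,
    one_smul, zero_smul, Finset.sum_ite_eq', Finset.mem_powerset]

theorem walsh_insert {k : ℤ} {M : Finset ℤ} (hk : k ∉ M) (ω : ℤ → ℤˣ) :
    walsh 𝕜 (insert k M) ω = ((ω k : ℤ) : 𝕜) * walsh 𝕜 M ω := by
  simp [walsh, Finset.prod_insert hk]

/-- A function of the signs at finitely many points is a linear combination of Fourier–Walsh
functions. -/
theorem exists_walsh_expansion (D : Finset ℤ) (f : (ℤ → ℤˣ) → 𝕜) (hf : DependsOn f (D : Set ℤ)) :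
    ∃ c : Finset ℤ → 𝕜, ∀ ω, f ω = ∑ M ∈ D.powerset, c M * walsh 𝕜 M ω := by
  induction D using Finset.induction_on generalizing f with
  | empty =>
    refine ⟨fun _ => f 1, fun ω => ?_⟩
    have : f ω = f 1 := hf fun i hi => by simp at hi
    simp [walsh, this]
  | insert k D hk ih =>
    have hu : ∀ u : ℤˣ, DependsOn (fun ω => f (Function.update ω k u)) (D : Set ℤ) := by
      intro u ω ω' h
      refine hf fun i hi => ?_
      by_cases hik : i = k
      · subst hik; simp
      · rw [Function.update_of_ne hik, Function.update_of_ne hik]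
        exact h i (by simpa [hik] using hi)
    obtain ⟨c, hc⟩ := ih _ (hu 1)
    obtain ⟨d, hd⟩ := ih _ (hu (-1))
    -- Here c and d are the coefficients of f with the sign at k frozen to +1 and to -1. The even
    -- part (f₊ + f₋)/2 contributes the sets without k, and τ_k (f₊ - f₋)/2 contributes those with
    -- k.
    refine ⟨fun M => if k ∈ M then (c (M.erase k) - d (M.erase k)) / 2 else (c M + d M) / 2,
      fun ω => ?_⟩
    rw [Finset.sum_powerset_insert hk]
    have h1 : f ω = (f (Function.update ω k 1) + f (Function.update ω k (-1))) / 2 +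
        ((ω k : ℤ) : 𝕜) * ((f (Function.update ω k 1) - f (Function.update ω k (-1))) / 2) := by
      rcases Int.units_eq_one_or (ω k) with h | h
      · have : f (Function.update ω k 1) = f ω := by rw [← h, Function.update_eq_self]
        rw [this, h]; push_cast; ring
      · have : f (Function.update ω k (-1)) = f ω := by rw [← h, Function.update_eq_self]
        rw [this, h]; push_cast; ring
    rw [h1, hc, hd, ← Finset.sum_add_distrib, ← Finset.sum_sub_distrib, Finset.sum_div,
      Finset.sum_div, Finset.mul_sum]
    congr 1
    · refine Finset.sum_congr rfl fun M hM => ?_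
      beta_reduce
      rw [if_neg fun h => hk (Finset.mem_powerset.1 hM h)]
      ring
    · refine Finset.sum_congr rfl fun M hM => ?_
      have hkM : k ∉ M := fun h => hk (Finset.mem_powerset.1 hM h)
      beta_reduce
      rw [if_pos (Finset.mem_insert_self _ _), Finset.erase_insert hkM, walsh_insert hkM]
      ring

theorem toLp_sum_walsh {ι : Type*} (s : Finset ι) (c : ι → 𝕜) (M : ι → Finset ℤ)
    {f : (ℤ → ℤˣ) → 𝕜} (hf : MemLp f 2 (signMeasure ℤ))
    (h : ∀ ω, f ω = ∑ j ∈ s, c j * walsh 𝕜 (M j) ω) :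
    hf.toLp = ∑ j ∈ s, c j • walshVec 𝕜 (M j) := by
  have : ∀ s : Finset ι, ∃ hg : MemLp (fun ω => ∑ j ∈ s, c j * walsh 𝕜 (M j) ω) 2 (signMeasure ℤ),
      hg.toLp = ∑ j ∈ s, c j • walshVec 𝕜 (M j) := by
    classical
    intro s
    induction s using Finset.induction_on with
    | empty => exact ⟨by simp, by simp only [Finset.sum_empty]; rfl⟩
    | insert j s hj ih =>
      obtain ⟨hg, hg'⟩ := ih
      have hj' := (walsh_memLp (𝕜 := 𝕜) (M j)).const_smul (c j)
      have heq : (fun ω => ∑ j ∈ insert j s, c j * walsh 𝕜 (M j) ω) =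
          c j • walsh 𝕜 (M j) + fun ω => ∑ j ∈ s, c j * walsh 𝕜 (M j) ω := by
        funext ω
        rw [Finset.sum_insert hj]
        rfl
      have hadd := hj'.add hg
      refine ⟨heq ▸ hadd, ?_⟩
      rw [Finset.sum_insert hj, ← hg', walshVec, ← MemLp.toLp_const_smul, ← MemLp.toLp_add hj' hg]
      exact MemLp.toLp_congr _ _ (Eventually.of_forall fun ω => congrFun heq ω)
  obtain ⟨hg, hg'⟩ := this s
  rw [← hg']
  exact MemLp.toLp_congr _ _ (Eventually.of_forall h)

theorem DependsOn.indicator_one {S : Set ℤ} {B : Set (ℤ → ℤˣ)} (hB : DependsOn (· ∈ B) S) :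
    DependsOn (B.indicator fun _ => (1 : 𝕜)) S := by
  classical
  intro ω ω' h
  simp only [Set.indicator_apply, hB h]

theorem exists_indLp_eq_sum {D : Finset ℤ} {B : Set (ℤ → ℤˣ)} (hm : MeasurableSet B)
    (hB : DependsOn (· ∈ B) (D : Set ℤ)) :
    ∃ c : Finset ℤ → 𝕜, (∀ ω, B.indicator (fun _ => (1 : 𝕜)) ω =
      ∑ M ∈ D.powerset, c M * walsh 𝕜 M ω) ∧
      indLp 𝕜 (signMeasure ℤ) B = ∑ M ∈ D.powerset, c M • walshVec 𝕜 M := by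
  obtain ⟨c, hc⟩ := exists_walsh_expansion D _ (DependsOn.indicator_one (𝕜 := 𝕜) hB)
  exact ⟨c, hc, by rw [indLp_eq_toLp hm]; exact toLp_sum_walsh _ _ _ _ hc⟩

/-- The Walsh expansion of the indicator involves only subsets of D, and the projection fixes each
of those terms. -/
theorem walshProj_indLp {D : Finset ℤ} {B : Set (ℤ → ℤˣ)} (hm : MeasurableSet B)
    (hB : DependsOn (· ∈ B) (D : Set ℤ)) :
    walshProj 𝕜 D (indLp 𝕜 (signMeasure ℤ) B) = indLp 𝕜 (signMeasure ℤ) B := by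
  obtain ⟨c, -, hc⟩ := exists_indLp_eq_sum (𝕜 := 𝕜) hm hB
  rw [hc, map_sum]
  refine Finset.sum_congr rfl fun M hM => ?_
  rw [map_smul, walshProj_walshVec, if_pos (Finset.mem_powerset.1 hM)]

/-- Independence of the signs at disjoint sets of points. -/
theorem walshProj_indLp_inter {D D' : Finset ℤ} (hD : Disjoint D D') {B C : Set (ℤ → ℤˣ)}
    (hm : MeasurableSet B) (hm' : MeasurableSet C) (hB : DependsOn (· ∈ B) (D : Set ℤ))
    (hC : DependsOn (· ∈ C) (D' : Set ℤ)) :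
    walshProj 𝕜 D (indLp 𝕜 (signMeasure ℤ) (B ∩ C)) =
      ((signMeasure ℤ).real C : 𝕜) • indLp 𝕜 (signMeasure ℤ) B := by
  classical
  obtain ⟨c, hc, hc'⟩ := exists_indLp_eq_sum (𝕜 := 𝕜) hm hB
  obtain ⟨d, hd, hd'⟩ := exists_indLp_eq_sum (𝕜 := 𝕜) hm' hC
  have h1 : indLp 𝕜 (signMeasure ℤ) (B ∩ C) =
      ∑ p ∈ D.powerset ×ˢ D'.powerset, (c p.1 * d p.2) • walshVec 𝕜 (p.1 ∆ p.2) := by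
    rw [indLp_eq_toLp (hm.inter hm')]
    refine toLp_sum_walsh _ _ _ _ fun ω => ?_
    have : (B ∩ C).indicator (fun _ => (1 : 𝕜)) ω =
        B.indicator (fun _ => 1) ω * C.indicator (fun _ => 1) ω := by
      by_cases h : ω ∈ B <;> by_cases h' : ω ∈ C <;> simp [h, h']
    rw [this, hc, hd, Finset.sum_mul_sum, Finset.sum_product]
    refine Finset.sum_congr rfl fun M _ => Finset.sum_congr rfl fun N _ => ?_
    rw [← walsh_mul_walsh]
    ring
  -- A point of N lies outside D, hence outside M, and survives in M ∆ N; so only N = ∅ is kept by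
  -- the projection.
  have h2 : ∀ M ∈ D.powerset, ∀ N ∈ D'.powerset,
      walshProj 𝕜 D (walshVec 𝕜 (M ∆ N)) = if N = ∅ then walshVec 𝕜 M else 0 := by
    intro M hM N hN
    rw [Finset.mem_powerset] at hM hN
    rw [walshProj_walshVec]
    by_cases h : N = ∅
    · rw [h, ← Finset.bot_eq_empty, symmDiff_bot, if_pos hM, if_pos rfl]
    · rw [if_neg h, if_neg]
      intro hMN
      obtain ⟨k, hk⟩ := Finset.nonempty_iff_ne_empty.2 h
      have hkD : k ∉ D := Finset.disjoint_right.1 hD (hN hk)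
      exact hkD (hMN (Finset.mem_symmDiff.2 (Or.inr ⟨hk, fun h' => hkD (hM h')⟩)))
  -- The constant term of the expansion is the mean, since all other Walsh functions integrate to
  -- zero.
  have h3 : d ∅ = ((signMeasure ℤ).real C : 𝕜) := by
    have h4 : ∫ ω, C.indicator (fun _ => (1 : 𝕜)) ω ∂(signMeasure ℤ) = d ∅ := by
      simp only [hd]
      rw [integral_finsetSum _ fun M _ =>
        ((walsh_memLp (𝕜 := 𝕜) M).integrable (by simp)).const_mul (d M)]
      simp only [integral_const_mul]
      rw [Finset.sum_eq_single ∅]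
      · simp [walsh]
      · intro M _ hM
        rw [integral_walsh (Finset.nonempty_iff_ne_empty.2 hM), mul_zero]
      · simp
    rw [← h4, integral_indicator_const _ hm', RCLike.real_smul_eq_coe_mul, mul_one]
  rw [h1, hc', map_sum, Finset.sum_product, Finset.smul_sum]
  refine Finset.sum_congr rfl fun M hM => ?_
  rw [Finset.sum_congr rfl fun N hN => by rw [map_smul, h2 M hM N hN]]
  simp [smul_smul, h3, mul_comm]

end WalshProjection

end CoarseScaling

namespace CoarseScaling

/-! ### Products of coarse events of adjacent time intervals -/

section Products

/-- The intersections of coarse events of the time intervals `[t_j, t_{j+1})`, `j ∈ J`. -/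
def prodEvents (𝒜 : Set (SetSeq DyadicSpace)) (t : ℕ → CoarseInstant) (J : Finset ℕ) :
    Set (SetSeq DyadicSpace) :=
  {B | ∃ A : ℕ → SetSeq DyadicSpace, (∀ j ∈ J, A j ∈ intervalEvents 𝒜 (t j) (t (j + 1))) ∧
    B = fun i => ⋂ j ∈ J, A j i}

/-- The union of the time intervals `[t_j[i], t_{j+1}[i])`, `j ∈ J`. -/
noncomputable def gridSet (t : ℕ → CoarseInstant) (J : Finset ℕ) (i : ℕ+) : Finset ℤ :=
  J.biUnion fun j => Finset.Ico ((t j).num i) ((t (j + 1)).num i)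

variable {𝒜 : Set (SetSeq DyadicSpace)} {t : ℕ → CoarseInstant} {J K : Finset ℕ}
  {A B : SetSeq DyadicSpace}

theorem univ_mem_prodEvents (h𝒜 : CoarselyClosed dyadicMeasure 𝒜) :
    (fun _ => Set.univ) ∈ prodEvents 𝒜 t J :=
  ⟨fun _ _ => Set.univ, fun _ _ => (isBoolAlg_intervalEvents h𝒜 _ _).univ, by simp⟩

theorem inter_mem_prodEvents (h𝒜 : CoarselyClosed dyadicMeasure 𝒜) (hA : A ∈ prodEvents 𝒜 t J)
    (hB : B ∈ prodEvents 𝒜 t J) : (fun i => A i ∩ B i) ∈ prodEvents 𝒜 t J := by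
  obtain ⟨A, hA, rfl⟩ := hA
  obtain ⟨B, hB, rfl⟩ := hB
  refine ⟨fun j i => A j i ∩ B j i, fun j hj =>
    (isBoolAlg_intervalEvents h𝒜 _ _).inter _ (hA j hj) _ (hB j hj), ?_⟩
  simp only [Set.iInter_inter_distrib]

/-- The missing factors are taken to be the whole space. -/
theorem prodEvents_mono (h𝒜 : CoarselyClosed dyadicMeasure 𝒜) (hJK : J ⊆ K) :
    prodEvents 𝒜 t J ⊆ prodEvents 𝒜 t K := by
  classical
  rintro _ ⟨A, hA, rfl⟩
  refine ⟨fun j i => if j ∈ J then A j i else Set.univ, fun j _ => ?_, ?_⟩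
  · by_cases hj : j ∈ J
    · simpa [hj] using hA j hj
    · simpa [hj] using (isBoolAlg_intervalEvents h𝒜 _ _).univ
  · ext i ω
    simp only [Set.mem_iInter]
    constructor
    · intro h j _
      by_cases hj : j ∈ J
      · simpa [hj] using h j hj
      · simp [hj]
    · intro h j hj
      simpa [hj] using h j (hJK hj)

theorem intervalEvents_subset_prodEvents (h𝒜 : CoarselyClosed dyadicMeasure 𝒜) {j : ℕ}
    (hj : j ∈ J) : intervalEvents 𝒜 (t j) (t (j + 1)) ⊆ prodEvents 𝒜 t J := by
  intro A hA
  refine prodEvents_mono h𝒜 (Finset.singleton_subset_iff.2 hj) ⟨fun _ => A, ?_, by simp⟩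
  simpa using hA

theorem prodEvents_subset (h𝒜 : CoarselyClosed dyadicMeasure 𝒜) : prodEvents 𝒜 t J ⊆ 𝒜 := by
  classical
  rintro _ ⟨A, hA, rfl⟩
  induction J using Finset.induction_on with
  | empty => simpa using h𝒜.compl _ h𝒜.empty_mem
  | insert j J _ ih =>
    simp only [Finset.set_biInter_insert]
    exact h𝒜.inter _ (hA j (Finset.mem_insert_self _ _)).1 _
      (ih fun k hk => hA k (Finset.mem_insert_of_mem hk))

theorem prodEvents.measurableSet (hB : B ∈ prodEvents 𝒜 t J) (i : ℕ+) : MeasurableSet (B i) := by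
  obtain ⟨A, hA, rfl⟩ := hB
  exact J.measurableSet_biInter fun j hj => intervalEvents.measurableSet (hA j hj) i

theorem intervalEvents.dependsOn {r s : CoarseInstant} (hB : B ∈ intervalEvents 𝒜 r s) (i : ℕ+) :
    DependsOn (· ∈ B i) (Set.Ico (r.num i) (s.num i)) := by
  obtain ⟨_, A, rfl⟩ := hB
  intro ω ω' h
  have : (fun k : Set.Ico (r.num i) (s.num i) => ω k) =
      fun k : Set.Ico (r.num i) (s.num i) => ω' k :=
    funext fun k => h _ k.2
  simp only [pullback, Set.mem_ofPred_eq, this]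

theorem prodEvents.dependsOn (hB : B ∈ prodEvents 𝒜 t J) (i : ℕ+) :
    DependsOn (· ∈ B i) (gridSet t J i : Set ℤ) := by
  obtain ⟨A, hA, rfl⟩ := hB
  intro ω ω' h
  simp only [Set.mem_iInter, eq_iff_iff]
  refine forall₂_congr fun j hj => Eq.to_iff (intervalEvents.dependsOn (hA j hj) i fun k hk => ?_)
  exact h k (Finset.mem_coe.2 (Finset.mem_biUnion.2 ⟨j, hj, Finset.mem_Ico.2 hk⟩))

theorem disjoint_gridSet (ht : Monotone t) (hJK : Disjoint J K) (i : ℕ+) :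
    Disjoint (gridSet t J i) (gridSet t K i) := by
  have hlt : ∀ j k : ℕ, j < k → Disjoint (Finset.Ico ((t j).num i) ((t (j + 1)).num i))
      (Finset.Ico ((t k).num i) ((t (k + 1)).num i)) := fun j k hjk => by
    refine Finset.disjoint_left.2 fun x hx hx' => ?_
    rw [Finset.mem_Ico] at hx hx'
    have := ht (Nat.succ_le_of_lt hjk) i
    simp only [Nat.succ_eq_add_one] at this
    omega
  rw [gridSet, gridSet, Finset.disjoint_biUnion_left]
  intro j hj
  rw [Finset.disjoint_biUnion_right]
  intro k hk
  rcases lt_trichotomy j k with h | h | h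
  · exact hlt j k h
  · exact absurd (h ▸ hk) (Finset.disjoint_left.1 hJK hj)
  · exact (hlt k j h).symm

theorem isBoolAlg_spanAlg_prodEvents (𝕜 : Type*) [RCLike 𝕜] (h𝒜 : CoarselyClosed dyadicMeasure 𝒜) :
    IsBoolAlg (spanAlg 𝕜 (prodEvents 𝒜 t J)) :=
  isBoolAlg_spanAlg (univ_mem_prodEvents h𝒜) fun _ hA _ hB => inter_mem_prodEvents h𝒜 hA hB

/-- Iterated factorization: the coarse events of `[t_0, t_{m+1})` are approximated by the algebra
generated by the coarse events of the intervals `[t_j, t_{j+1})`. -/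
theorem IsDyadicCoarseFactorization.intervalEvents_subset_approximable (𝕜 : Type*) [RCLike 𝕜]
    (h𝒜 : IsDyadicCoarseFactorization 𝒜) (ht : Monotone t) (m : ℕ) :
    intervalEvents 𝒜 (t 0) (t (m + 1)) ⊆
      Approximable (spanAlg 𝕜 (prodEvents 𝒜 t (Finset.range (m + 1)))) := by
  have hc := h𝒜.isCoarseSigmaField.toCoarselyClosed
  have hmem : ∀ (j : ℕ) (J : Finset ℕ), j ∈ J → intervalEvents 𝒜 (t j) (t (j + 1)) ⊆
      Approximable (spanAlg 𝕜 (prodEvents 𝒜 t J)) := fun j J hj A hA =>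
    Approximable.of_mem (intervalEvents.measurableSet hA)
      (mem_spanAlg (intervalEvents.measurableSet hA) (intervalEvents_subset_prodEvents hc hj hA))
  induction m with
  | zero => exact hmem 0 _ (by simp)
  | succ m ih =>
    -- Factorization at the last interior instant t_{m+1}; the left part is covered by induction and
    -- the right part is a single grid interval.
    refine h𝒜.intervalEvents_subset (ht (Nat.zero_le (m + 1))) (ht (Nat.le_succ _))
      (Approximable.coarselyClosed (isBoolAlg_spanAlg_prodEvents 𝕜 hc)) fun A hA B hB => ?_
    refine Approximable.inter (isBoolAlg_spanAlg_prodEvents 𝕜 hc)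
      (Approximable.mono (spanAlg_mono (prodEvents_mono hc ?_)) (ih hA)) (hmem _ _ (by simp) hB)
    exact Finset.range_subset_range.2 (Nat.le_succ _)

variable {𝕜 : Type*} [RCLike 𝕜]

theorem IsCoarseSigmaField.tendsto_real (h𝒜 : IsCoarseSigmaField dyadicMeasure 𝒜) (hA : A ∈ 𝒜) :
    ∃ l : ℝ, Tendsto (fun i => (signMeasure ℤ).real (A i)) atTop (𝓝 l) := by
  obtain ⟨l, hl⟩ := h𝒜.exists_lim A hA
  refine ⟨l.toReal, (ENNReal.tendsto_toReal (ne_top_of_le_ne_top ENNReal.one_ne_top ?_)).comp hl⟩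
  exact le_of_tendsto hl (Eventually.of_forall fun i => prob_le_one)

/-- Split the event as B ∩ C with B the factors in J and C those outside. Independence turns the
projection into P[i](C[i]) 1_B. The coefficient depends on i, but it converges by (e), so
asymptotically it may be replaced by its limit, and the result lies in the closure of the span. -/
theorem walshProj_mem_of_mem_prodEvents (h𝒜 : IsCoarseSigmaField dyadicMeasure 𝒜)
    (ht : Monotone t) (hJK : J ⊆ K) (hB : B ∈ prodEvents 𝒜 t K) :
    (fun i => walshProj 𝕜 (gridSet t J i) (indSeq 𝕜 B i)) ∈
      asympClosure (indSpan 𝕜 (prodEvents 𝒜 t J)) := by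
  classical
  obtain ⟨A, hA, rfl⟩ := hB
  set B : SetSeq DyadicSpace := fun i => ⋂ j ∈ J, A j i
  set C : SetSeq DyadicSpace := fun i => ⋂ j ∈ K \ J, A j i
  have hB : B ∈ prodEvents 𝒜 t J := ⟨A, fun j hj => hA j (hJK hj), rfl⟩
  have hC : C ∈ prodEvents 𝒜 t (K \ J) :=
    ⟨A, fun j hj => hA j (Finset.sdiff_subset hj), rfl⟩
  have hBC : ∀ i, ⋂ j ∈ K, A j i = B i ∩ C i := fun i => by
    simp only [B, C]
    rw [← Finset.set_biInter_inter, Finset.union_sdiff_of_subset hJK]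
  obtain ⟨l, hl⟩ := h𝒜.tendsto_real (prodEvents_subset h𝒜.toCoarselyClosed hC)
  refine mem_asympClosure_of_tendsto
    (Submodule.smul_mem _ (l : 𝕜) (le_asympClosure (indSeq_mem_indSpan hB))) ?_
  have hl0 : Tendsto (fun i => |(signMeasure ℤ).real (C i) - l|) atTop (𝓝 0) := by
    have := (hl.sub_const l).abs
    simpa using this
  refine squeeze_zero (fun i => norm_nonneg _) (fun i => ?_) hl0
  rw [indSeq, hBC, walshProj_indLp_inter (disjoint_gridSet ht Finset.disjoint_sdiff i)
    (prodEvents.measurableSet hB i) (prodEvents.measurableSet hC i) (prodEvents.dependsOn hB i)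
    (prodEvents.dependsOn hC i), Pi.smul_apply, indSeq, ← sub_smul, norm_smul,
    ← RCLike.ofReal_sub, RCLike.norm_ofReal]
  exact mul_le_of_le_one_right (abs_nonneg _) norm_indLp_le

/-- The conditional expectation of a coarse event given the signs on finitely many coarse time
intervals is approximated by combinations of coarse events of these intervals. -/
theorem IsDyadicCoarseFactorization.walshProj_indSeq_mem (h𝒜 : IsDyadicCoarseFactorization 𝒜)
    (ht : Monotone t) {m : ℕ} (hJ : J ⊆ Finset.Ico 1 (m + 1)) (hA : A ∈ 𝒜) :
    (fun i => walshProj 𝕜 (gridSet t J i) (indSeq 𝕜 A i)) ∈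
      asympClosure (indSpan 𝕜 (prodEvents 𝒜 t J)) := by
  have hc := h𝒜.isCoarseSigmaField.toCoarselyClosed
  set 𝒞 : Set (SetSeq DyadicSpace) := ⋃ (r : CoarseInstant) (s : CoarseInstant) (_ : r ≤ s),
      intervalEvents 𝒜 r s with h𝒞
  have hm𝒞 : ∀ C ∈ 𝒞, ∀ i, MeasurableSet (C i) := by
    simp only [h𝒞, Set.mem_iUnion]
    rintro C ⟨r, s, _, hC⟩
    exact intervalEvents.measurableSet hC
  -- The projections are contractions, so it suffices to treat events of bounded coarse intervals.
  refine map_mem_asympClosure_indSpan (𝒢 := 𝒞) _ (fun i f => norm_walshProj_le _ f) ?_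
    (indSeq_mem_asympClosure_of_approximable hm𝒞
      (fun C hC => le_asympClosure (indSeq_mem_indSpan hC)) (h𝒜.subset_approximable hA))
  intro C hC
  simp only [h𝒞, Set.mem_iUnion] at hC
  obtain ⟨r, s, hrs, hC⟩ := hC
  -- The grid is altered only at index 0 and beyond m + 1, so that it covers [r, s). Since J ⊆ [1,
  -- m], no endpoint of an interval indexed by J changes; this is why J has to avoid index 0.
  let t' : ℕ → CoarseInstant := fun j =>
    if j = 0 then r.min (t 1) else if j ≤ m + 1 then t j else (t (m + 1)).max s
  have ht'0 : t' 0 = r.min (t 1) := rfl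
  have ht'1 : ∀ j, j ≠ 0 → j ≤ m + 1 → t' j = t j := fun j h h' => by simp [t', h, h']
  have ht'2 : ∀ j, m + 1 < j → t' j = (t (m + 1)).max s := fun j h => by
    have h0 : j ≠ 0 := by omega
    simp [t', h0, not_le.2 h]
  have ht' : Monotone t' := by
    refine monotone_nat_of_le_succ fun j => ?_
    rcases Nat.eq_zero_or_pos j with rfl | hj
    · rw [ht'0, ht'1 1 (by simp) (by simp)]
      exact r.min_le_right _
    · rcases lt_trichotomy j (m + 1) with h | rfl | h
      · rw [ht'1 j hj.ne' h.le, ht'1 (j + 1) (by simp) h]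
        exact ht (Nat.le_succ j)
      · rw [ht'1 _ hj.ne' le_rfl, ht'2 _ (Nat.lt_succ_self _)]
        exact CoarseInstant.le_max_left _ _
      · rw [ht'2 _ h, ht'2 _ (h.trans (Nat.lt_succ_self _))]
  have hJ' : ∀ j ∈ J, t' j = t j ∧ t' (j + 1) = t (j + 1) := fun j hj => by
    have := Finset.mem_Ico.1 (hJ hj)
    exact ⟨ht'1 j (by omega) (by omega), ht'1 (j + 1) (by omega) (by omega)⟩
  have hgrid : ∀ i, gridSet t J i = gridSet t' J i := fun i => by
    refine Finset.biUnion_congr rfl fun j hj => ?_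
    rw [(hJ' j hj).1, (hJ' j hj).2]
  have hprod : prodEvents 𝒜 t J = prodEvents 𝒜 t' J := by
    ext B
    refine exists_congr fun A => and_congr_left fun _ => forall₂_congr fun j hj => ?_
    rw [(hJ' j hj).1, (hJ' j hj).2]
  have hCt' : C ∈ intervalEvents 𝒜 (t' 0) (t' (m + 2)) := by
    rw [ht'2 (m + 2) (by omega)]
    exact intervalEvents_mono (r.min_le_left _) (CoarseInstant.le_max_right _ _) hC
  simp only [hgrid, hprod]
  refine map_mem_asympClosure_indSpan (𝒢 := prodEvents 𝒜 t' (Finset.range (m + 2))) _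
    (fun i f => norm_walshProj_le _ f) ?_
    (indSeq_mem_asympClosure_of_approximable (fun C hC => hC.1)
      (fun C hC => le_asympClosure (indSeq_mem_of_mem_spanAlg
        (fun _ h => prodEvents.measurableSet h) hC))
      (h𝒜.intervalEvents_subset_approximable 𝕜 ht' (m + 1) hCt'))
  intro B hB
  refine walshProj_mem_of_mem_prodEvents h𝒜.isCoarseSigmaField ht' (fun j hj => ?_) hB
  have := Finset.mem_Ico.1 (hJ hj)
  simp only [Finset.mem_range]
  omega

/-- Members of `L₂(𝒜)` are approximated by combinations of coarse events. -/
theorem coarseL2_apply_mem_asympClosure {x : lp (fun i => Lp 𝕜 2 (dyadicMeasure i)) ∞}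
    (hx : x ∈ coarseL2 𝕜 dyadicMeasure 𝒜) : (fun i => x i) ∈ asympClosure (indSpan 𝕜 𝒜) := by
  intro ε hε
  obtain ⟨p, hp, hxp⟩ := Metric.mem_closure_iff.1 hx ε hε
  refine ⟨fun i => p i, ?_, Eventually.of_forall fun i => ?_⟩
  · clear hxp
    induction hp using Submodule.span_induction with
    | zero => exact Submodule.zero_mem _
    | add p q _ _ hp hq => exact Submodule.add_mem _ hp hq
    | smul c p _ hp => exact Submodule.smul_mem _ c hp
    | mem p hp =>
      obtain ⟨A, hA, hm, rfl⟩ := hp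
      convert indSeq_mem_indSpan (𝕜 := 𝕜) hA using 1
      ext1 i
      exact (indLp_of_measurableSet (hm i)).symm
  · rw [dist_eq_norm] at hxp
    exact (lp.norm_apply_le_norm (by simp) (x - p) i).trans hxp.le

theorem IsDyadicCoarseFactorization.walshProj_mem (h𝒜 : IsDyadicCoarseFactorization 𝒜)
    (ht : Monotone t) {m : ℕ} (hJ : J ⊆ Finset.Ico 1 (m + 1))
    {w : ℕ+ → Lp 𝕜 2 (signMeasure ℤ)} (hw : w ∈ asympClosure (indSpan 𝕜 𝒜)) :
    (fun i => walshProj 𝕜 (gridSet t J i) (w i)) ∈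
      asympClosure (indSpan 𝕜 (prodEvents 𝒜 t J)) := by
  exact map_mem_asympClosure_indSpan _ (fun i f => norm_walshProj_le _ f)
    (fun A hA => h𝒜.walshProj_indSeq_mem ht hJ hA) hw

end Products

end CoarseScaling

namespace CoarseScaling

/-! ### Dependence of `𝒜_{s,t}` on the coarse instants -/

section Instants

variable {𝒜 : Set (SetSeq DyadicSpace)} {a b a' b' : CoarseInstant} {B : SetSeq DyadicSpace}

/-- The Boolean algebra with two elements. -/
def trivialAlg : Set (SetSeq DyadicSpace) := {fun _ => ∅, fun _ => Set.univ}

theorem isBoolAlg_trivialAlg : IsBoolAlg trivialAlg where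
  empty := Or.inl rfl
  compl := by rintro C (rfl | rfl) <;> simp [trivialAlg]
  inter := by rintro C (rfl | rfl) D (rfl | rfl) <;> simp [trivialAlg]

/-- When the interval is empty, the section of B is empty or everything and has probability 0 or 1.
This occurs for infinitely many i, and the probabilities converge by (e), so their limit is 0 or 1;
then B or its complement is negligible. -/
theorem mem_approximable_trivialAlg_of_frequently (h𝒜 : IsCoarseSigmaField dyadicMeasure 𝒜)
    (hB : B ∈ intervalEvents 𝒜 a b) (hab : ∃ᶠ i in atTop, a.num i = b.num i) :
    B ∈ Approximable trivialAlg := by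
  obtain ⟨l, hl⟩ := h𝒜.exists_lim B hB.1
  have hl01 : l ∈ ({0, 1} : Set ℝ≥0∞) := by
    refine IsClosed.mem_of_frequently_of_tendsto (Set.toFinite _).isClosed
      (hab.mono fun i hi => ?_) hl
    have hd := intervalEvents.dependsOn hB i
    rw [hi, Set.Ico_self] at hd
    have hall : ∀ ω ω' : ℤ → ℤˣ, ω ∈ B i → ω' ∈ B i := fun ω ω' h =>
      (hd (x := ω) (y := ω') fun k hk => by simp at hk).mp h
    rcases (B i).eq_empty_or_nonempty with h | ⟨ω, h⟩
    · exact Or.inl (by rw [h, measure_empty])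
    · refine Or.inr ?_
      rw [Set.eq_univ_of_forall fun ω' => hall ω ω' h, measure_univ]
      rfl
  rcases hl01 with rfl | rfl
  · exact Approximable.negligible isBoolAlg_trivialAlg (intervalEvents.measurableSet hB) hl
  · have h := Approximable.negligible isBoolAlg_trivialAlg
      (fun i => (intervalEvents.measurableSet hB i).compl) (A := fun i => (B i)ᶜ) (by
        simp only [prob_compl_eq_one_sub (intervalEvents.measurableSet hB _)]
        simpa using ENNReal.Tendsto.sub (tendsto_const_nhds (x := (1 : ℝ≥0∞))) hl (by simp))
    simpa using Approximable.compl isBoolAlg_trivialAlg h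

/-- Coarse events of a coarse time interval of vanishing length are trivial. -/
theorem IsDyadicCoarseFactorization.intervalEvents_subset_trivialAlg
    (h𝒜 : IsDyadicCoarseFactorization 𝒜) (hab : a ≤ b) (hlim : a.lim = b.lim) :
    intervalEvents 𝒜 a b ⊆ Approximable trivialAlg := by
  classical
  -- This instant alternates between a (even i) and b (odd i), and converges because the limits
  -- agree. Hence [a, c) is empty for even i and [c, b) for odd i, and the factorization at c leaves
  -- two trivial pieces.
  let c : CoarseInstant :=
    ⟨fun i => if Even (i : ℕ) then a.num i else b.num i, a.lim, by
      refine tendsto_of_tendsto_of_tendsto_of_le_of_le a.tendsto (hlim ▸ b.tendsto)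
        (fun i => ?_) (fun i => ?_)
      all_goals
        have := hab i
        dsimp only
        gcongr
        split_ifs <;> omega⟩
  have hac : a ≤ c := fun i => by
    have := hab i
    simp only [c]
    split_ifs <;> omega
  have hcb : c ≤ b := fun i => by
    have := hab i
    simp only [c]
    split_ifs <;> omega
  refine h𝒜.intervalEvents_subset hac hcb (Approximable.coarselyClosed isBoolAlg_trivialAlg)
    fun A hA B hB => Approximable.inter isBoolAlg_trivialAlg
      (mem_approximable_trivialAlg_of_frequently h𝒜.isCoarseSigmaField hA
        (frequently_atTop.2 fun n => ⟨2 * n, ?_, ?_⟩))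
      (mem_approximable_trivialAlg_of_frequently h𝒜.isCoarseSigmaField hB
        (frequently_atTop.2 fun n => ⟨2 * n + 1, ?_, ?_⟩))
  · rw [← PNat.coe_le_coe]; push_cast; omega
  · simp [c]
  · rw [← PNat.coe_le_coe]; push_cast; omega
  · simp [c]

/-- Asymptotically, `𝒜_{a,b}` depends on `a[∞]` and `b[∞]` only. -/
theorem IsDyadicCoarseFactorization.intervalEvents_subset_approximable_of_lim_eq
    (h𝒜 : IsDyadicCoarseFactorization 𝒜) (hab : a ≤ b) (ha : a.lim = a'.lim) (hb : b.lim = b'.lim) :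
    intervalEvents 𝒜 a' b' ⊆ Approximable (intervalEvents 𝒜 a b) := by
  have hc := h𝒜.isCoarseSigmaField.toCoarselyClosed
  have hbool := isBoolAlg_intervalEvents hc a b
  have htriv : Approximable trivialAlg ⊆ Approximable (intervalEvents 𝒜 a b) := by
    refine Approximable.mono ?_
    rintro C (rfl | rfl)
    · exact hbool.empty
    · exact hbool.univ
  -- Enlarge [a', b') to an interval that also contains [a, b). The two flanks around [a, b) have
  -- vanishing length in the limit, so their events are trivial and only the middle part remains.
  refine (intervalEvents_mono (a.min_le_right a') (b.le_max_right b')).trans ?_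
  refine h𝒜.intervalEvents_subset (a.min_le_left a') (hab.trans (b.le_max_left b'))
    (Approximable.coarselyClosed hbool) fun A hA B hB => Approximable.inter hbool
      (htriv (h𝒜.intervalEvents_subset_trivialAlg (a.min_le_left a')
        (by simp [CoarseInstant.min, ha]) hA)) ?_
  refine h𝒜.intervalEvents_subset hab (b.le_max_left b')
    (Approximable.coarselyClosed hbool) (fun A hA B hB => Approximable.inter hbool
      (Approximable.of_mem (intervalEvents.measurableSet hA) hA)
      (htriv (h𝒜.intervalEvents_subset_trivialAlg (b.le_max_left b')
        (by simp [CoarseInstant.max, hb]) hB))) hB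

end Instants

/-! ### Limits of sequences in a refinement -/

section Refinement

variable {𝕜 : Type*} [RCLike 𝕜] {𝒜 ℬ : Set (SetSeq DyadicSpace)} {Y : Type*} [MeasurableSpace Y]
  {Q : Measure Y} [IsProbabilityMeasure Q] (R : CoarseRefinement dyadicMeasure 𝒜 Q)

/-- The linear combinations `∑ c_j (1_{A_j}, 1_{A_j[∞]})`, `A_j ∈ ℬ`. -/
noncomputable def refSpan (𝕜 : Type*) [RCLike 𝕜] (R : CoarseRefinement dyadicMeasure 𝒜 Q)
    (ℬ : Set (SetSeq DyadicSpace)) :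
    Submodule 𝕜 (ℕ+ → Lp 𝕜 2 (signMeasure ℤ) × Lp 𝕜 2 Q) :=
  Submodule.span 𝕜 ((fun A i => (indSeq 𝕜 A i, indLp 𝕜 Q (R.lim A))) '' ℬ)

/-- `z ∈ L₂(Q)` is the limit of the sequence `w`, both being approximated by the same linear
combinations of coarse events from `ℬ`. -/
def RefLim (R : CoarseRefinement dyadicMeasure 𝒜 Q) (ℬ : Set (SetSeq DyadicSpace))
    (w : ℕ+ → Lp 𝕜 2 (signMeasure ℤ)) (z : Lp 𝕜 2 Q) : Prop :=
  (fun i => (w i, z)) ∈ asympClosure (refSpan 𝕜 R ℬ)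

variable {R} {v w : ℕ+ → Lp 𝕜 2 (signMeasure ℤ)} {y z : Lp 𝕜 2 Q}

/-- Returns such a combination to the graph of the refinement map, where convergence of inner
products is known. -/
theorem exists_of_mem_refSpan {p : ℕ+ → Lp 𝕜 2 (signMeasure ℤ) × Lp 𝕜 2 Q}
    (hℬ : ℬ ⊆ 𝒜) (h𝒜 : IsCoarseSigmaField dyadicMeasure 𝒜) (hp : p ∈ refSpan 𝕜 R ℬ) :
    ∃ q ∈ R.simpleGraph 𝕜, p = fun i => (q.1 i, q.2) := by
  induction hp using Submodule.span_induction with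
  | mem p hp =>
    obtain ⟨A, hA, rfl⟩ := hp
    refine ⟨_, Submodule.subset_span ⟨A, hℬ hA, h𝒜.measurableSet A (hℬ hA), rfl⟩, ?_⟩
    ext1 i
    exact Prod.ext (indLp_of_measurableSet (h𝒜.measurableSet A (hℬ hA) i))
      (indLp_of_measurableSet (R.measurableSet_lim A (hℬ hA)))
  | zero => exact ⟨0, Submodule.zero_mem _, rfl⟩
  | add p p' _ _ hp hp' =>
    obtain ⟨q, hq, rfl⟩ := hp
    obtain ⟨q', hq', rfl⟩ := hp'
    exact ⟨q + q', Submodule.add_mem _ hq hq', rfl⟩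
  | smul c p _ hp =>
    obtain ⟨q, hq, rfl⟩ := hp
    exact ⟨c • q, Submodule.smul_mem _ c hq, rfl⟩

theorem RefLim.mono {ℬ' : Set (SetSeq DyadicSpace)} (h : ℬ ⊆ ℬ') (hw : RefLim R ℬ w z) :
    RefLim R ℬ' w z :=
  asympClosure_mono (Submodule.span_mono (Set.image_mono h)) hw

theorem RefLim.indSeq {A : SetSeq DyadicSpace} (hA : A ∈ ℬ) :
    RefLim R ℬ (indSeq 𝕜 A) (indLp 𝕜 Q (R.lim A)) :=
  le_asympClosure (Submodule.subset_span ⟨A, hA, rfl⟩)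

theorem RefLim.add (hv : RefLim R ℬ v y) (hw : RefLim R ℬ w z) :
    RefLim R ℬ (v + w) (y + z) := by
  rw [RefLim] at *
  simpa only [Pi.add_def, Prod.mk_add_mk] using Submodule.add_mem _ hv hw

theorem RefLim.sub (hv : RefLim R ℬ v y) (hw : RefLim R ℬ w z) :
    RefLim R ℬ (v - w) (y - z) := by
  rw [RefLim] at *
  simpa only [Pi.sub_def, Prod.mk_sub_mk] using Submodule.sub_mem _ hv hw

theorem RefLim.smul (c : 𝕜) (hw : RefLim R ℬ w z) :
    RefLim R ℬ (c • w) (c • z) := Submodule.smul_mem _ c hw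

/-- For combinations of indicators the squared norms converge because P[i](A[i] ∩ B[i]) → Q(A[∞] ∩
B[∞]). In general, w and z are uniformly close to the two components of one such combination. -/
theorem RefLim.tendsto_norm (h𝒜 : IsCoarseSigmaField dyadicMeasure 𝒜) (hw : RefLim R 𝒜 w z) :
    Tendsto (fun i => ‖w i‖) atTop (𝓝 ‖z‖) := by
  rw [Metric.tendsto_nhds]
  intro ε hε
  obtain ⟨p, hp, hwp⟩ := hw (ε / 4) (by positivity)
  obtain ⟨q, hq, rfl⟩ := exists_of_mem_refSpan subset_rfl h𝒜 hp
  have h1 : Tendsto (fun i => ‖q.1 i‖ ^ 2) atTop (𝓝 (‖q.2‖ ^ 2)) := by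
    have := (RCLike.continuous_re.tendsto _).comp
      (R.tendsto_inner_simpleGraph 𝕜 h𝒜.toCoarselyClosed hq hq)
    simpa only [Function.comp_def, inner_self_eq_norm_sq] using this
  have h2 : Tendsto (fun i => ‖q.1 i‖) atTop (𝓝 ‖q.2‖) := by
    simpa only [Function.comp_def, Real.sqrt_sq (norm_nonneg _)] using
      (Real.continuous_sqrt.tendsto _).comp h1
  filter_upwards [hwp, Metric.tendsto_nhds.1 h2 (ε / 4) (by positivity)] with i hi hi'
  have hi1 : ‖w i - q.1 i‖ ≤ ε / 4 := (norm_fst_le ((w i - q.1 i, z - q.2) : _ × _)).trans hi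
  have hi2 : ‖z - q.2‖ ≤ ε / 4 := (norm_snd_le ((w i - q.1 i, z - q.2) : _ × _)).trans hi
  have h3 := abs_norm_sub_norm_le (w i) (q.1 i)
  have h4 := abs_norm_sub_norm_le z q.2
  rw [Real.dist_eq] at hi' ⊢
  rw [abs_lt] at hi' ⊢
  rw [abs_le] at h3 h4
  constructor <;> linarith

/-- Polarization reduces the claim to norms. -/
theorem RefLim.tendsto_inner (h𝒜 : IsCoarseSigmaField dyadicMeasure 𝒜) (hv : RefLim R 𝒜 v y)
    (hw : RefLim R 𝒜 w z) : Tendsto (fun i => inner 𝕜 (v i) (w i)) atTop (𝓝 (inner 𝕜 y z)) := by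
  simp only [inner_eq_sum_norm_sq_div_four]
  have hc : ∀ {u : ℕ+ → Lp 𝕜 2 (signMeasure ℤ)} {x : Lp 𝕜 2 Q}, RefLim R 𝒜 u x →
      Tendsto (fun i => (‖u i‖ : 𝕜) ^ 2) atTop (𝓝 ((‖x‖ : 𝕜) ^ 2)) := fun h =>
    ((RCLike.continuous_ofReal.tendsto _).comp (h.tendsto_norm h𝒜)).pow 2
  have h1 := hc (hv.add hw)
  have h2 := hc (hv.sub hw)
  have h3 := hc (hv.sub (hw.smul RCLike.I))
  have h4 := hc (hv.add (hw.smul RCLike.I))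
  exact ((h1.sub h2).add ((h3.sub h4).mul_const _)).div_const 4

theorem exists_refSpan_of_mem_indSpan (R : CoarseRefinement dyadicMeasure 𝒜 Q)
    {p : ℕ+ → Lp 𝕜 2 (signMeasure ℤ)} (hp : p ∈ indSpan 𝕜 ℬ) :
    ∃ q : Lp 𝕜 2 Q, (fun i => (p i, q)) ∈ refSpan 𝕜 R ℬ := by
  induction hp using Submodule.span_induction with
  | mem p hp =>
    obtain ⟨A, hA, rfl⟩ := hp
    exact ⟨_, Submodule.subset_span ⟨A, hA, rfl⟩⟩
  | zero => exact ⟨0, Submodule.zero_mem _⟩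
  | add p p' _ _ hp hp' =>
    obtain ⟨q, hq⟩ := hp
    obtain ⟨q', hq'⟩ := hp'
    exact ⟨q + q', Submodule.add_mem _ hq hq'⟩
  | smul c p _ hp =>
    obtain ⟨q, hq⟩ := hp
    exact ⟨c • q, Submodule.smul_mem _ c hq⟩

/-- A sequence approximated by coarse events has a limit in the refinement. -/
theorem exists_refLim (R : CoarseRefinement dyadicMeasure 𝒜 Q) (hℬ : ℬ ⊆ 𝒜)
    (h𝒜 : IsCoarseSigmaField dyadicMeasure 𝒜)
    (hw : w ∈ asympClosure (indSpan 𝕜 ℬ)) : ∃ z : Lp 𝕜 2 Q, RefLim R ℬ w z := by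
  choose p hp hpw using fun n : ℕ => hw (1 / ((n : ℝ) + 1)) (by positivity)
  choose q hq using fun n => exists_refSpan_of_mem_indSpan R (hp n)
  have hlim : ∀ n, RefLim R ℬ (p n) (q n) := fun n => le_asympClosure (hq n)
  -- The distance between two limits is the limit of the distances between the sequences, and both
  -- sequences are close to w. So the limits q_n form a Cauchy sequence.
  have hdist : ∀ n m, dist (q n) (q m) ≤ 1 / ((n : ℝ) + 1) + 1 / ((m : ℝ) + 1) := by
    intro n m
    rw [dist_eq_norm]
    refine le_of_tendsto ((((hlim n).sub (hlim m)).mono hℬ).tendsto_norm h𝒜) ?_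
    filter_upwards [hpw n, hpw m] with i hi hi'
    have := norm_sub_le_norm_sub_add_norm_sub (p n i) (w i) (p m i)
    rw [norm_sub_rev] at hi
    simp only [Pi.sub_apply]
    linarith
  have hmono : ∀ n N : ℕ, N ≤ n → 1 / ((n : ℝ) + 1) ≤ 1 / ((N : ℝ) + 1) :=
    fun n N h => Nat.one_div_le_one_div h
  have hcauchy : CauchySeq q := by
    refine cauchySeq_of_le_tendsto_0 (fun N : ℕ => 2 * (1 / ((N : ℝ) + 1)))
      (fun n m N hn hm => ?_) ?_
    · have := hdist n m
      have := hmono n N hn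
      have := hmono m N hm
      linarith
    · simpa using tendsto_one_div_add_atTop_nhds_zero_nat.const_mul (2 : ℝ)
  obtain ⟨z, hz⟩ := cauchySeq_tendsto_of_complete hcauchy
  refine ⟨z, fun ε hε => ?_⟩
  have h1 := Metric.tendsto_nhds.1 hz ε hε
  have h2 := (tendsto_one_div_add_atTop_nhds_zero_nat (𝕜 := ℝ)).eventually_lt_const hε
  obtain ⟨n, hn1, hn2⟩ := (h1.and h2).exists
  refine ⟨_, hq n, (hpw n).mono fun i hi => ?_⟩
  rw [dist_comm, dist_eq_norm] at hn1
  exact max_le (hi.trans hn2.le) hn1.le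

theorem refLim_limL2 (h𝒜 : IsCoarseSigmaField dyadicMeasure 𝒜) (x : coarseL2 𝕜 dyadicMeasure 𝒜) :
    RefLim R 𝒜 (fun i => (x : lp (fun i => Lp 𝕜 2 (dyadicMeasure i)) ∞) i) (R.limL2 𝕜 h𝒜 x) := by
  intro ε hε
  have hx : ((x : lp (fun i => Lp 𝕜 2 (dyadicMeasure i)) ∞), R.limL2 𝕜 h𝒜 x) ∈
      (R.simpleGraph 𝕜).topologicalClosure := (R.existsUnique_limL2 𝕜 h𝒜 x).choose_spec.1
  obtain ⟨p, hp, hxp⟩ := Metric.mem_closure_iff.1 hx ε hε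
  refine ⟨fun i => (p.1 i, p.2), ?_, Eventually.of_forall fun i => ?_⟩
  · clear hxp
    induction hp using Submodule.span_induction with
    | zero => exact Submodule.zero_mem _
    | add p q _ _ hp hq => exact Submodule.add_mem _ hp hq
    | smul c p _ hp => exact Submodule.smul_mem _ c hp
    | mem p hp =>
      obtain ⟨A, hA, hm, rfl⟩ := hp
      refine Submodule.subset_span ⟨A, hA, ?_⟩
      ext1 i
      exact Prod.ext (indLp_of_measurableSet (hm i))
        (indLp_of_measurableSet (R.measurableSet_lim A hA))
  · rw [dist_eq_norm] at hxp
    have h1 := (norm_fst_le (((x : lp (fun i => Lp 𝕜 2 (dyadicMeasure i)) ∞),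
      R.limL2 𝕜 h𝒜 x) - p)).trans hxp.le
    have h2 := (norm_snd_le (((x : lp (fun i => Lp 𝕜 2 (dyadicMeasure i)) ∞),
      R.limL2 𝕜 h𝒜 x) - p)).trans hxp.le
    refine max_le ?_ h2
    exact (lp.norm_apply_le_norm (by simp) _ i).trans h1

end Refinement

end CoarseScaling

namespace CoarseScaling

/-! ### Conditional expectations in the refinement -/

section Field

variable {𝕜 : Type*} [RCLike 𝕜] {𝒜 : Set (SetSeq DyadicSpace)} {Y : Type*} {m : MeasurableSpace Y}
  [mY : MeasurableSpace Y] {Q : Measure Y}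
  {R : CoarseRefinement dyadicMeasure 𝒜 Q} {t : ℕ → CoarseInstant} {J : Finset ℕ}
  {A B : SetSeq DyadicSpace}

theorem CoarseRefinement.lim_empty (R : CoarseRefinement dyadicMeasure 𝒜 Q)
    (h𝒜 : CoarselyClosed dyadicMeasure 𝒜) : R.lim (fun _ => ∅) =ᵐ[Q] (∅ : Set Y) := by
  have h := R.tendsto _ h𝒜.empty_mem
  simp only [measure_empty] at h
  exact ae_eq_empty.2 (tendsto_nhds_unique h tendsto_const_nhds)

theorem CoarseRefinement.field_le (R : CoarseRefinement dyadicMeasure 𝒜 Q) (r s : ℝ) :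
    R.field r s ≤ mY :=
  MeasurableSpace.generateFrom_le fun _ h => h.1

theorem CoarseRefinement.lim_univ (R : CoarseRefinement dyadicMeasure 𝒜 Q)
    (h𝒜 : CoarselyClosed dyadicMeasure 𝒜) : R.lim (fun _ => Set.univ) =ᵐ[Q] (Set.univ : Set Y) := by
  have h := (R.lim_compl _ h𝒜.empty_mem).trans (R.lim_empty h𝒜).compl
  simpa using h

/-- Limits of combinations of coarse events of given time intervals are measurable with respect
to the σ-field generated by the fields of these intervals. -/
theorem exists_measurableSet_lim (R : CoarseRefinement dyadicMeasure 𝒜 Q)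
    (h𝒜 : CoarselyClosed dyadicMeasure 𝒜)
    (hm : ∀ j ∈ J, ∀ A ∈ intervalEvents 𝒜 (t j) (t (j + 1)), MeasurableSet[m] (R.lim A))
    (hB : B ∈ prodEvents 𝒜 t J) : ∃ S, MeasurableSet[m] S ∧ R.lim B =ᵐ[Q] S := by
  classical
  obtain ⟨A, hA, rfl⟩ := hB
  induction J using Finset.induction_on with
  | empty => exact ⟨Set.univ, MeasurableSet.univ, by simpa using R.lim_univ h𝒜⟩
  | insert j J _ ih =>
    have hA' : ∀ k ∈ J, A k ∈ intervalEvents 𝒜 (t k) (t (k + 1)) :=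
      fun k hk => hA k (Finset.mem_insert_of_mem hk)
    obtain ⟨S, hS, h⟩ := ih (fun k hk => hm k (Finset.mem_insert_of_mem hk)) hA'
    refine ⟨R.lim (A j) ∩ S, (hm j (Finset.mem_insert_self _ _) _
      (hA j (Finset.mem_insert_self _ _))).inter hS, ?_⟩
    simp only [Finset.set_biInter_insert]
    exact (R.lim_inter _ (hA j (Finset.mem_insert_self _ _)).1 _
      (prodEvents_subset h𝒜 ⟨A, hA', rfl⟩)).trans ((EventuallyEq.refl _ _).inter h)

variable [IsProbabilityMeasure Q]

/-- The measure of a symmetric difference is a squared distance between indicators, so convergence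
of norms applies. -/
theorem CoarseRefinement.tendsto_symmDiff (R : CoarseRefinement dyadicMeasure 𝒜 Q)
    (h𝒜 : IsCoarseSigmaField dyadicMeasure 𝒜) (hA : A ∈ 𝒜) (hB : B ∈ 𝒜) :
    Tendsto (fun i => signMeasure ℤ (A i ∆ B i)) atTop (𝓝 (Q (R.lim A ∆ R.lim B))) := by
  have h := (((RefLim.indSeq (𝕜 := ℝ) (R := R) hA).sub (RefLim.indSeq hB)).tendsto_norm h𝒜).pow 2
  simp only [Pi.sub_apply, CoarseScaling.indSeq,
    norm_indLp_sub_sq (h𝒜.measurableSet A hA _) (h𝒜.measurableSet B hB _),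
    norm_indLp_sub_sq (R.measurableSet_lim A hA) (R.measurableSet_lim B hB)] at h
  have h' := ENNReal.tendsto_ofReal h
  simpa only [ofReal_measureReal (measure_ne_top _ _)] using h'

/-- Limits of product events are almost everywhere equal to m-measurable sets, and the m-measurable
vectors form a closed subspace of L₂. -/
theorem RefLim.aestronglyMeasurable (h𝒜 : CoarselyClosed dyadicMeasure 𝒜)
    (hle : m ≤ mY)
    (hm : ∀ j ∈ J, ∀ A ∈ intervalEvents 𝒜 (t j) (t (j + 1)), MeasurableSet[m] (R.lim A))
    {w : ℕ+ → Lp 𝕜 2 (signMeasure ℤ)} {z : Lp 𝕜 2 Q} (h : RefLim R (prodEvents 𝒜 t J) w z) :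
    AEStronglyMeasurable[m] z Q := by
  have hcl := isClosed_aestronglyMeasurable (F := 𝕜) (p := 2) (μ := Q) hle
  refine hcl.closure_subset_iff.2 subset_rfl (Metric.mem_closure_iff.2 fun ε hε => ?_)
  obtain ⟨p, hp, hzp⟩ := h (ε / 2) (by positivity)
  -- The component z does not depend on i, so a single index yields the approximating vector.
  obtain ⟨i, hi⟩ := hzp.exists
  refine ⟨(p i).2, ?_, ?_⟩
  · change (p i).2 ∈ lpMeas 𝕜 𝕜 m 2 Q
    clear hzp hi
    induction hp using Submodule.span_induction with
    | zero => exact Submodule.zero_mem _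
    | add p q _ _ hp hq => exact Submodule.add_mem _ hp hq
    | smul c p _ hp => exact Submodule.smul_mem _ c hp
    | mem p hp =>
      obtain ⟨B, hB, rfl⟩ := hp
      obtain ⟨S, hS, hBS⟩ := exists_measurableSet_lim R h𝒜 hm hB
      change indLp 𝕜 Q (R.lim B) ∈ lpMeas 𝕜 𝕜 m 2 Q
      rw [indLp_congr (R.measurableSet_lim B (prodEvents_subset h𝒜 hB)) (hle S hS) hBS,
        indLp_of_measurableSet (hle S hS)]
      exact mem_lpMeas_indicatorConstLp hle hS (measure_ne_top Q S)
  · rw [dist_eq_norm]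
    exact ((norm_snd_le _).trans hi).trans_lt (by linarith)

/-- The measurable sets approximated by refinements of coarse events from a Boolean algebra form a
σ-field. -/
abbrev approxField (R : CoarseRefinement dyadicMeasure 𝒜 Q) (h𝒜 : CoarselyClosed dyadicMeasure 𝒜)
    {𝒟 : Set (SetSeq DyadicSpace)} (h𝒟 : IsBoolAlg 𝒟) (hsub : 𝒟 ⊆ 𝒜) : MeasurableSpace Y where
  MeasurableSet' S := MeasurableSet S ∧ ∀ ε : ℝ≥0∞, ε ≠ 0 → ∃ B ∈ 𝒟, Q (S ∆ R.lim B) ≤ ε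
  measurableSet_empty := ⟨MeasurableSet.empty, fun ε _ => ⟨_, h𝒟.empty, by
    rw [measure_congr ((EventuallyEq.refl _ _).symmDiff (R.lim_empty h𝒜))]
    simp⟩⟩
  measurableSet_compl := by
    rintro S ⟨hS, h⟩
    refine ⟨hS.compl, fun ε hε => ?_⟩
    obtain ⟨B, hB, h'⟩ := h ε hε
    refine ⟨_, h𝒟.compl B hB, ?_⟩
    rw [measure_congr ((EventuallyEq.refl _ _).symmDiff (R.lim_compl B (hsub hB))),
      compl_symmDiff_compl]
    exact h'
  measurableSet_iUnion := by
    intro f hf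
    refine ⟨MeasurableSet.iUnion fun k => (hf k).1, fun ε hε => ?_⟩
    -- The algebra offers intersections, so complements of partial unions are approximated; a final
    -- complement returns to the union.
    have hfin : ∀ N : ℕ, ∀ ε : ℝ≥0∞, ε ≠ 0 →
        ∃ B ∈ 𝒟, Q ((Set.accumulate f N)ᶜ ∆ R.lim B) ≤ ε := by
      have hcompl : ∀ k, ∀ ε : ℝ≥0∞, ε ≠ 0 → ∃ B ∈ 𝒟, Q ((f k)ᶜ ∆ R.lim B) ≤ ε := by
        intro k ε hε
        obtain ⟨B, hB, h'⟩ := (hf k).2 ε hε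
        refine ⟨_, h𝒟.compl B hB, ?_⟩
        rw [measure_congr ((EventuallyEq.refl _ _).symmDiff (R.lim_compl B (hsub hB))),
          compl_symmDiff_compl]
        exact h'
      intro N
      induction N with
      | zero => simpa using hcompl 0
      | succ N ih =>
        intro ε hε
        have hε2 : ε / 2 ≠ 0 := by simpa using hε
        obtain ⟨B, hB, h⟩ := ih _ hε2
        obtain ⟨C, hC, h'⟩ := hcompl (N + 1) _ hε2
        refine ⟨_, h𝒟.inter B hB C hC, ?_⟩
        rw [measure_congr ((EventuallyEq.refl _ _).symmDiff
          (R.lim_inter B (hsub hB) C (hsub hC))), Set.accumulate_succ, Set.compl_union]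
        exact (measure_mono (inter_symmDiff_inter_subset _ _ _ _)).trans
          ((measure_union_le _ _).trans ((add_le_add h h').trans_eq (ENNReal.add_halves ε)))
    have hε2 : ε / 2 ≠ 0 := by simpa using hε
    have hm : ∀ N, MeasurableSet (Set.accumulate f N) := fun N =>
      MeasurableSet.biUnion (Set.to_countable _) fun k _ => (hf k).1
    have hsub' : ∀ N, Set.accumulate f N ⊆ ⋃ k, f k := fun N =>
      Set.accumulate_subset_iUnion N
    have htend : Tendsto (fun N => Q ((⋃ k, f k) \ Set.accumulate f N)) atTop (𝓝 0) := by
      have h1 := ENNReal.Tendsto.sub (tendsto_const_nhds (x := Q (⋃ k, f k)) (f := atTop))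
        (tendsto_measure_iUnion_accumulate (μ := Q) (f := f)) (Or.inl (measure_ne_top _ _))
      rw [tsub_self] at h1
      refine h1.congr fun N => ?_
      rw [measure_sdiff (hsub' N) (hm N).nullMeasurableSet (measure_ne_top _ _)]
    obtain ⟨N, hN⟩ := (ENNReal.tendsto_nhds_zero.1 htend _ (pos_iff_ne_zero.2 hε2)).exists
    obtain ⟨B, hB, h⟩ := hfin N _ hε2
    refine ⟨_, h𝒟.compl B hB, ?_⟩
    rw [measure_congr ((EventuallyEq.refl _ _).symmDiff (R.lim_compl B (hsub hB)))]
    refine (measure_symmDiff_le _ (Set.accumulate f N) _).trans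
      ((add_le_add ?_ ?_).trans_eq (ENNReal.add_halves ε))
    · rw [Set.symmDiff_def, Set.sdiff_eq_empty.2 (hsub' N), Set.union_empty]
      exact hN
    · rwa [← compl_symmDiff_compl, compl_compl]

/-- Consecutive grid intervals leave no gap: induct on the right end and test whether k lies in the
last interval. -/
theorem subset_gridSet {p q : ℕ} (hpq : p ≤ q) (hJ : Finset.Ico p q ⊆ J) (i : ℕ+) :
    Set.Ico ((t p).num i) ((t q).num i) ⊆ (gridSet t J i : Set ℤ) := by
  rintro k ⟨hpk, hkq⟩
  have key : ∀ q, k < (t q).num i → p ≤ q →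
      ∃ j ∈ Finset.Ico p q, k ∈ Finset.Ico ((t j).num i) ((t (j + 1)).num i) := by
    intro q
    induction q with
    | zero =>
      intro h1 h2
      have h0 : p = 0 := by omega
      subst h0
      omega
    | succ q ih =>
      intro h1 h2
      by_cases h : (t q).num i ≤ k
      · rcases Nat.lt_or_ge q p with hqp | hqp
        · have h0 : p = q + 1 := by omega
          subst h0
          omega
        · exact ⟨q, Finset.mem_Ico.2 ⟨hqp, Nat.lt_succ_self q⟩, Finset.mem_Ico.2 ⟨h, h1⟩⟩
      · rcases Nat.lt_or_ge q p with hqp | hqp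
        · have h0 : p = q + 1 := by omega
          subst h0
          omega
        · obtain ⟨j, hj, hk⟩ := ih (not_le.1 h) hqp
          rw [Finset.mem_Ico] at hj
          exact ⟨j, Finset.mem_Ico.2 ⟨hj.1, by omega⟩, hk⟩
  obtain ⟨j, hj, hk⟩ := key q hkq hpq
  exact Finset.mem_coe.2 (Finset.mem_biUnion.2 ⟨j, hJ hj, hk⟩)

/-- The coarse events that depend on the signs at the points of the intervals `[t_j, t_{j+1})`,
`j ∈ J`, only. -/
def gridEvents (𝒜 : Set (SetSeq DyadicSpace)) (t : ℕ → CoarseInstant) (J : Finset ℕ) :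
    Set (SetSeq DyadicSpace) :=
  {B | B ∈ 𝒜 ∧ ∀ i, DependsOn (· ∈ B i) (gridSet t J i : Set ℤ)}

theorem isBoolAlg_gridEvents (h𝒜 : CoarselyClosed dyadicMeasure 𝒜) :
    IsBoolAlg (gridEvents 𝒜 t J) where
  empty := ⟨h𝒜.empty_mem, fun i ω ω' _ => rfl⟩
  compl := fun B hB => ⟨h𝒜.compl _ hB.1, fun i ω ω' h => by
    simpa only [Set.mem_compl_iff] using congrArg Not (hB.2 i h)⟩
  inter := fun B hB C hC => ⟨h𝒜.inter _ hB.1 _ hC.1, fun i ω ω' h => by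
    simpa only [Set.mem_inter_iff] using congrArg₂ And (hB.2 i h) (hC.2 i h)⟩

/-- Every set of the σ-field generated by `ℱ_{t_p,t_q}` with `[p, q) ⊆ J` is approximated by
coarse events of the intervals `[t_j, t_{j+1})`, `j ∈ J`. -/
theorem IsDyadicCoarseFactorization.field_le_approxField (h𝒜 : IsDyadicCoarseFactorization 𝒜)
    (R : CoarseRefinement dyadicMeasure 𝒜 Q) (ht : Monotone t) {p q : ℕ} (hpq : p ≤ q)
    (hJ : Finset.Ico p q ⊆ J) :
    R.field (t p).lim (t q).lim ≤
      approxField R h𝒜.isCoarseSigmaField.toCoarselyClosed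
        (isBoolAlg_gridEvents (J := J) (t := t) h𝒜.isCoarseSigmaField.toCoarselyClosed)
        fun _ h => h.1 := by
  refine MeasurableSpace.generateFrom_le ?_
  rintro S ⟨hS, a, b, hab, ha, hb, A, hA, hSA⟩
  refine ⟨hS, fun ε hε => ?_⟩
  have hA' : pullback a b A ∈ intervalEvents 𝒜 a b := ⟨hA, A, rfl⟩
  -- The generator may come from any coarse interval with the right limits; it is replaced by a
  -- nearby event of the grid interval [t_p, t_q).
  obtain ⟨C, hC, hAC⟩ := (h𝒜.intervalEvents_subset_approximable_of_lim_eq (ht hpq) ha.symm hb.symm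
    hA').2 ε hε
  refine ⟨C, ⟨hC.1, fun i ω ω' h => intervalEvents.dependsOn hC i fun k hk =>
    h k (subset_gridSet hpq hJ i hk)⟩, ?_⟩
  refine (measure_congr (hSA.symmDiff (EventuallyEq.refl _ (R.lim C)))).trans_le ?_
  exact le_of_tendsto (R.tendsto_symmDiff h𝒜.isCoarseSigmaField hA hC.1) hAC

/-- Sums of squared Fourier–Walsh coefficients over the subsets of a finite union of coarse time
intervals converge to the squared norm of the conditional expectation with respect to a σ-field
`m` that lies between the limits of the events of these intervals and their approximations. -/
theorem IsDyadicCoarseFactorization.tendsto_sum_walshCoeff_of_le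
    (h𝒜 : IsDyadicCoarseFactorization 𝒜) (R : CoarseRefinement dyadicMeasure 𝒜 Q) (ht : Monotone t)
    {N : ℕ} (hJN : J ⊆ Finset.Ico 1 (N + 1)) (hle : m ≤ mY)
    (hm : ∀ j ∈ J, ∀ A ∈ intervalEvents 𝒜 (t j) (t (j + 1)), MeasurableSet[m] (R.lim A))
    (happ : m ≤ approxField R h𝒜.isCoarseSigmaField.toCoarselyClosed
      (isBoolAlg_gridEvents (J := J) (t := t) h𝒜.isCoarseSigmaField.toCoarselyClosed)
      fun _ h => h.1)
    {x : ℕ+ → Lp 𝕜 2 (signMeasure ℤ)} {y : Lp 𝕜 2 Q} (hxy : RefLim R 𝒜 x y)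
    (hx : x ∈ asympClosure (indSpan 𝕜 𝒜)) :
    Tendsto (fun i => ENNReal.ofReal
      (∑ M ∈ (gridSet t J i).powerset, ‖walshCoeff (x i) M‖ ^ 2)) atTop
      (𝓝 (eLpNorm (Q[y | m]) 2 Q ^ 2)) := by
  have hs := h𝒜.isCoarseSigmaField
  have hc := hs.toCoarselyClosed
  have hw := h𝒜.walshProj_mem ht hJN hx
  -- The limit z of the projected sequence is the candidate for the conditional expectation.
  obtain ⟨z, hz⟩ := exists_refLim R (prodEvents_subset hc) hs hw
  have hz𝒜 := hz.mono (prodEvents_subset hc)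
  have hzF : AEStronglyMeasurable[m] z Q := hz.aestronglyMeasurable hc hle hm
  -- The projection is self-adjoint and fixes 1_B, so 1_B is exactly orthogonal to x[i] minus its
  -- projection at every i; the inner products pass to the limit.
  have horth : ∀ B ∈ gridEvents 𝒜 t J, inner 𝕜 (indLp 𝕜 Q (R.lim B)) (y - z) = 0 := by
    intro B hB
    refine tendsto_nhds_unique ((RefLim.indSeq hB.1).tendsto_inner hs (hxy.sub hz𝒜)) ?_
    refine tendsto_const_nhds.congr fun i => ?_
    rw [Pi.sub_apply, inner_sub_right, ← inner_walshProj_left, indSeq,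
      walshProj_indLp (hs.measurableSet B hB.1 i) (hB.2 i), sub_self]
  -- Sets of m are approximated by limits of grid events, and the inner product is continuous; the
  -- +1 in the denominator guards against y = z.
  have horthS : ∀ S, MeasurableSet[m] S → inner 𝕜 (indLp 𝕜 Q S) (y - z) = 0 := by
    intro S hS
    refine norm_le_zero_iff.1 (le_of_forall_pos_le_add fun ε hε => ?_)
    rw [zero_add]
    have hδ : 0 < ε / (‖y - z‖ + 1) := by positivity
    obtain ⟨B, hB, hSB⟩ := (happ S hS).2 (ENNReal.ofReal ((ε / (‖y - z‖ + 1)) ^ 2))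
      (ENNReal.ofReal_pos.2 (pow_pos hδ 2) |>.ne')
    have h1 := norm_indLp_sub_le (𝕜 := 𝕜) hδ.le (hle S hS) (R.measurableSet_lim B hB.1) hSB
    have h2 : inner 𝕜 (indLp 𝕜 Q S) (y - z) =
        inner 𝕜 (indLp 𝕜 Q S - indLp 𝕜 Q (R.lim B)) (y - z) := by
      rw [inner_sub_left, horth B hB, sub_zero]
    rw [h2]
    calc _ ≤ ‖indLp 𝕜 Q S - indLp 𝕜 Q (R.lim B)‖ * ‖y - z‖ := norm_inner_le_norm _ _
      _ ≤ ε / (‖y - z‖ + 1) * (‖y - z‖ + 1) := by gcongr; linarith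
      _ = ε := by field_simp
  have hint : ∀ u : Lp 𝕜 2 Q, Integrable u Q := fun u => (Lp.memLp u).integrable (by simp)
  -- Orthogonality to indicators of m-measurable sets is equality of integrals over them, which
  -- together with measurability characterizes the conditional expectation.
  have hcond : z =ᵐ[Q] Q[y | m] := by
    refine ae_eq_condExp_of_forall_setIntegral_eq hle (hint y) (fun S _ _ => (hint z).integrableOn)
      (fun S hS _ => ?_) hzF
    have h := horthS S hS
    rw [inner_sub_right, indLp_of_measurableSet (hle S hS), L2.inner_indicatorConstLp_one,
      L2.inner_indicatorConstLp_one, sub_eq_zero] at h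
    exact h.symm
  have hlim := ENNReal.tendsto_ofReal ((hz𝒜.tendsto_norm hs).pow 2)
  simp only [norm_walshProj_sq] at hlim
  convert hlim using 2
  rw [← eLpNorm_congr_ae hcond, ENNReal.ofReal_pow (norm_nonneg _), Lp.norm_def,
    ENNReal.ofReal_toReal (Lp.eLpNorm_ne_top z)]

/-- Sums of squared Fourier–Walsh coefficients over the subsets of a finite union of
coarse time intervals converges to the squared norm of a conditional expectation. -/
theorem IsDyadicCoarseFactorization.tendsto_sum_walshCoeff (h𝒜 : IsDyadicCoarseFactorization 𝒜)
    (R : CoarseRefinement dyadicMeasure 𝒜 Q) (ht : Monotone t) {n N : ℕ} (p q : Fin n → ℕ)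
    (hpq : ∀ k, p k ≤ q k) (hp : ∀ k, 1 ≤ p k) (hq : ∀ k, q k ≤ N + 1)
    {x : ℕ+ → Lp 𝕜 2 (signMeasure ℤ)} {y : Lp 𝕜 2 Q} (hxy : RefLim R 𝒜 x y)
    (hx : x ∈ asympClosure (indSpan 𝕜 𝒜)) :
    Tendsto (fun i => ENNReal.ofReal
      (∑ M ∈ (gridSet t (Finset.univ.biUnion fun k => Finset.Ico (p k) (q k)) i).powerset,
        ‖walshCoeff (x i) M‖ ^ 2)) atTop
      (𝓝 (eLpNorm (Q[y | ⨆ k, R.field (t (p k)).lim (t (q k)).lim]) 2 Q ^ 2)) := by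
  refine h𝒜.tendsto_sum_walshCoeff_of_le R ht (N := N) (fun j hj => ?_)
    (iSup_le fun k => R.field_le _ _) (fun j hj A hA => ?_) (iSup_le fun k =>
      h𝒜.field_le_approxField R ht (hpq k) (Finset.subset_biUnion_of_mem
        (fun k => Finset.Ico (p k) (q k)) (Finset.mem_univ k))) hxy hx
  · obtain ⟨k, -, hk⟩ := Finset.mem_biUnion.1 hj
    have := hp k
    have := hq k
    rw [Finset.mem_Ico] at hk ⊢
    omega
  · obtain ⟨k, -, hk⟩ := Finset.mem_biUnion.1 hj
    rw [Finset.mem_Ico] at hk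
    obtain ⟨hA𝒜, A', rfl⟩ := intervalEvents_mono (ht hk.1) (ht (Nat.succ_le_of_lt hk.2)) hA
    refine le_iSup (fun k => R.field (t (p k)).lim (t (q k)).lim) k _ ?_
    exact MeasurableSpace.measurableSet_generateFrom ⟨R.measurableSet_lim _ hA𝒜, _, _,
      ht (hpq k), rfl, rfl, A', hA𝒜, EventuallyEq.refl _ _⟩

end Field

end CoarseScaling

namespace CoarseScaling

/-! ### Weak convergence of measures on the space of compact sets -/

section Portmanteau

theorem tendsto_measure_univ {X ι : Type*} [MeasurableSpace X] [TopologicalSpace X]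
    [OpensMeasurableSpace X] {μ : FiniteMeasure X} {μs : ι → FiniteMeasure X} {L : Filter ι}
    (h : Tendsto μs L (𝓝 μ)) :
    Tendsto (fun i => (μs i : Measure X) Set.univ) L (𝓝 ((μ : Measure X) Set.univ)) := by
  have := ENNReal.tendsto_coe.2 h.mass
  simpa only [FiniteMeasure.ennreal_mass] using this

variable {X ι : Type*} [MeasurableSpace X] [TopologicalSpace X] [HasOuterApproxClosed X]
  [BorelSpace X] {μ : FiniteMeasure X} {μs : ι → FiniteMeasure X} {L : Filter ι} [L.NeBot]
  {c : ℝ≥0∞}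

theorem le_measure_of_isClosed_of_tendsto (h : Tendsto μs L (𝓝 μ)) {F : Set X} (hF : IsClosed F)
    (hc : ∀ᶠ i in L, c ≤ (μs i : Measure X) F) : c ≤ (μ : Measure X) F :=
  (le_limsup_of_frequently_le hc.frequently).trans
    (FiniteMeasure.limsup_measure_closed_le_of_tendsto h hF)

/-- Pass to the complement: total masses converge and the portmanteau inequality holds for closed
sets. -/
theorem measure_le_of_isOpen_of_tendsto (h : Tendsto μs L (𝓝 μ)) {G : Set X} (hG : IsOpen G)
    (hc : ∀ᶠ i in L, (μs i : Measure X) G ≤ c) : (μ : Measure X) G ≤ c := by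
  rcases eq_or_ne c ∞ with rfl | hctop
  · exact le_top
  have h1 : (μ : Measure X) Set.univ - c ≤ (μ : Measure X) Gᶜ := by
    refine le_of_forall_lt fun a ha => ?_
    obtain ⟨b, hab, hb⟩ := exists_between ha
    refine hab.trans_le (le_measure_of_isClosed_of_tendsto h hG.isClosed_compl ?_)
    have h2 := ENNReal.Tendsto.sub (tendsto_measure_univ h) (tendsto_const_nhds (x := c))
      (Or.inl (measure_ne_top _ _))
    filter_upwards [h2.eventually_const_lt hb, hc] with i hi hi'
    refine hi.le.trans (tsub_le_iff_right.2 ?_)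
    rw [← measure_add_measure_compl hG.measurableSet, add_comm]
    gcongr
  rw [tsub_le_iff_right, ← measure_add_measure_compl hG.measurableSet, add_comm] at h1
  exact (ENNReal.add_le_add_iff_left (measure_ne_top _ _)).1 h1

/-- Portmanteau for a set squeezed between an open and a closed set whose difference is null in the
limit; the frontier of E need not be identified. -/
theorem measure_eq_of_tendsto (h : Tendsto μs L (𝓝 μ)) {G E F : Set X} (hG : IsOpen G)
    (hF : IsClosed F) (hGE : G ⊆ E) (hEF : E ⊆ F) (h0 : (μ : Measure X) (F \ G) = 0)
    (hE : Tendsto (fun i => (μs i : Measure X) E) L (𝓝 c)) : (μ : Measure X) E = c := by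
  have hFG : (μ : Measure X) F ≤ (μ : Measure X) G :=
    (measure_mono (by rw [Set.sdiff_union_self]; exact Set.subset_union_left : F ⊆ F \ G ∪ G)).trans
      ((measure_union_le _ _).trans (by rw [h0, zero_add]))
  refine le_antisymm ((measure_mono hEF).trans (hFG.trans ?_)) (le_trans ?_ (hFG.trans
    (measure_mono hGE)))
  · refine le_of_forall_gt fun b hb => ?_
    obtain ⟨b', hb', hbb⟩ := exists_between hb
    refine (measure_le_of_isOpen_of_tendsto h hG ?_).trans_lt hbb
    filter_upwards [hE.eventually_lt_const hb'] with i hi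
    exact (measure_mono hGE).trans hi.le
  · refine le_of_forall_lt fun a ha => ?_
    obtain ⟨b, hab, hb⟩ := exists_between ha
    refine hab.trans_le (le_measure_of_isClosed_of_tendsto h hF ?_)
    filter_upwards [hE.eventually_const_lt hb] with i hi
    exact hi.le.trans (measure_mono hEF)

end Portmanteau

/-! ### Hyperspace of compact subsets of ℝ: a generating π-system and a convergence criterion -/

section Compacts

/-- The union of a finite set of half-open intervals, given by their endpoints. -/
def icoUnion (S : Finset (ℝ × ℝ)) : Set ℝ := ⋃ p ∈ S, Set.Ico p.1 p.2

theorem mem_icoUnion {S : Finset (ℝ × ℝ)} {x : ℝ} :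
    x ∈ icoUnion S ↔ ∃ p ∈ S, p.1 ≤ x ∧ x < p.2 := by
  simp only [icoUnion, Set.mem_iUnion, Set.mem_Ico, exists_prop]

/-- The compact sets contained in a finite union of half-open intervals. -/
def compactsIn (S : Finset (ℝ × ℝ)) : Set (Compacts ℝ) := {M | (M : Set ℝ) ⊆ icoUnion S}

/-- Containment in an intersection is containment in each member, and containment in an open set is
an open condition. The Gδ form covers half-open intervals. -/
theorem measurableSet_subset_of_isGδ {E : Set ℝ} (hE : IsGδ E) :
    MeasurableSet {M : Compacts ℝ | (M : Set ℝ) ⊆ E} := by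
  obtain ⟨T, hT, hc, rfl⟩ := hE
  have : {M : Compacts ℝ | (M : Set ℝ) ⊆ ⋂₀ T} = ⋂ U ∈ T, {M : Compacts ℝ | (M : Set ℝ) ⊆ U} := by
    ext M
    simp [Set.subset_sInter_iff]
  rw [this]
  exact MeasurableSet.biInter hc fun U hU =>
    (Compacts.isOpen_subsets_of_isOpen (hT U hU)).measurableSet

theorem measurableSet_compactsIn (S : Finset (ℝ × ℝ)) : MeasurableSet (compactsIn S) := by
  refine measurableSet_subset_of_isGδ ?_
  refine IsGδ.biUnion S.finite_toSet fun p _ => ?_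
  rw [← Set.Ici_inter_Iio]
  exact isClosed_Ici.isGδ.inter isOpen_Iio.isGδ

/-- The set of compact sets contained in finite unions of half-open intervals is a π-system. -/
theorem exists_compactsIn_inter (S T : Finset (ℝ × ℝ)) :
    ∃ U, compactsIn S ∩ compactsIn T = compactsIn U := by
  classical
  refine ⟨(S ×ˢ T).image fun r => (max r.1.1 r.2.1, min r.1.2 r.2.2), ?_⟩
  have : icoUnion ((S ×ˢ T).image fun r => (max r.1.1 r.2.1, min r.1.2 r.2.2)) =
      icoUnion S ∩ icoUnion T := by
    ext x
    simp only [mem_icoUnion, Finset.mem_image, Finset.mem_product, Set.mem_inter_iff]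
    constructor
    · rintro ⟨_, ⟨⟨p, q⟩, ⟨hp, hq⟩, rfl⟩, h1, h2⟩
      simp only [max_le_iff, lt_min_iff] at h1 h2
      exact ⟨⟨p, hp, h1.1, h2.1⟩, ⟨q, hq, h1.2, h2.2⟩⟩
    · rintro ⟨⟨p, hp, h1, h2⟩, ⟨q, hq, h3, h4⟩⟩
      exact ⟨_, ⟨(p, q), ⟨hp, hq⟩, rfl⟩, max_le h1 h3, lt_min h2 h4⟩
  ext M
  simp [compactsIn, this, Set.subset_inter_iff]

/-- Compactness gives a finite cover, and rational endpoints leave only countably many covers to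
consider. -/
theorem exists_rat_cover {U : Set ℝ} (hU : IsOpen U) {M : Compacts ℝ} (hM : (M : Set ℝ) ⊆ U) :
    ∃ S : Finset (ℚ × ℚ), icoUnion (S.image fun p => ((p.1 : ℝ), (p.2 : ℝ))) ⊆ U ∧
      M ∈ compactsIn (S.image fun p => ((p.1 : ℝ), (p.2 : ℝ))) := by
  have hx : ∀ x ∈ U, ∃ p : ℚ × ℚ, x ∈ Set.Ioo (p.1 : ℝ) p.2 ∧ Set.Ico (p.1 : ℝ) p.2 ⊆ U := by
    intro x hx
    obtain ⟨ε, hε, h⟩ := Metric.isOpen_iff.1 hU x hx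
    obtain ⟨p, hp1, hp2⟩ := exists_rat_btwn (sub_lt_self x hε)
    obtain ⟨q, hq1, hq2⟩ := exists_rat_btwn (lt_add_of_pos_right x hε)
    refine ⟨(p, q), ⟨hp2, hq1⟩, fun y hy => h ?_⟩
    rw [Real.ball_eq_Ioo]
    exact ⟨hp1.trans_le hy.1, hy.2.trans hq2⟩
  obtain ⟨S, hS, hcov⟩ := M.isCompact.elim_finite_subcover_image
    (b := {p : ℚ × ℚ | Set.Ico (p.1 : ℝ) p.2 ⊆ U}) (c := fun p => Set.Ioo (p.1 : ℝ) p.2)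
    (fun _ _ => isOpen_Ioo) (fun x hxM => by
      obtain ⟨p, h1, h2⟩ := hx x (hM hxM)
      exact Set.mem_biUnion (x := p) h2 h1)
  refine ⟨hcov.1.toFinset, ?_, ?_⟩
  · intro x hx
    rw [mem_icoUnion] at hx
    simp only [Finset.mem_image, Set.Finite.mem_toFinset] at hx
    obtain ⟨_, ⟨p, hp, rfl⟩, h1, h2⟩ := hx
    exact hS hp ⟨h1, h2⟩
  · intro x hxM
    obtain ⟨p, hp, h1, h2⟩ := Set.mem_iUnion₂.1 (hcov.2 hxM)
    rw [mem_icoUnion]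
    exact ⟨_, Finset.mem_image_of_mem _ (hcov.1.mem_toFinset.2 hp), h1.le, h2⟩

theorem exists_mem_compactsIn_Ico (M : Compacts ℝ) :
    ∃ N : ℕ, (M : Set ℝ) ⊆ Set.Ico (-(N : ℝ)) N := by
  obtain ⟨r, hr⟩ := M.isCompact.isBounded.subset_ball 0
  obtain ⟨N, hN⟩ := exists_nat_gt r
  refine ⟨N, fun x hx => ?_⟩
  have := hr hx
  rw [Real.ball_eq_Ioo] at this
  exact ⟨by linarith [this.1], by linarith [this.2]⟩

/-- The topology has the subbasis of the conditions M ⊆ U and M ∩ U ≠ ∅ with U open. Each is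
obtained from the sets `compactsIn S` by countable operations. -/
theorem borel_compacts_eq :
    (inferInstance : MeasurableSpace (Compacts ℝ)) =
      MeasurableSpace.generateFrom (Set.range compactsIn) := by
  refine le_antisymm ?_ (MeasurableSpace.generateFrom_le ?_)
  swap
  · rintro _ ⟨S, rfl⟩
    exact measurableSet_compactsIn S
  have hgen : (Compacts.topology : TopologicalSpace (Compacts ℝ)) = generateFrom
      (Set.preimage ((↑) : Compacts ℝ → Set ℝ) ''
        (Set.powerset '' {U | IsOpen U} ∪ (fun V => {s | (s ∩ V).Nonempty}) '' {V | IsOpen V})) :=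
    induced_generateFrom_eq
  change borel (Compacts ℝ) ≤ _
  rw [borel_eq_generateFrom_of_subbasis hgen]
  refine MeasurableSpace.generateFrom_le ?_
  have hmem : ∀ S, MeasurableSet[MeasurableSpace.generateFrom (Set.range compactsIn)]
      (compactsIn S) := fun S => MeasurableSpace.measurableSet_generateFrom ⟨S, rfl⟩
  rintro _ ⟨_, ⟨U, hU, rfl⟩ | ⟨U, hU, rfl⟩, rfl⟩
  · have : ((↑) : Compacts ℝ → Set ℝ) ⁻¹' U.powerset = ⋃ S : Finset (ℚ × ℚ),
        ⋃ _ : icoUnion (S.image fun p => ((p.1 : ℝ), (p.2 : ℝ))) ⊆ U,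
          compactsIn (S.image fun p => ((p.1 : ℝ), (p.2 : ℝ))) := by
      ext M
      simp only [Set.mem_preimage, Set.mem_powerset_iff, Set.mem_iUnion, exists_prop]
      exact ⟨fun h => exists_rat_cover hU h, fun ⟨S, h1, h2⟩ => h2.trans h1⟩
    rw [this]
    exact MeasurableSet.iUnion fun S => MeasurableSet.iUnion fun _ => hmem _
  -- M misses U exactly when it misses every rational interval [p, q) ⊆ U. Since M is bounded,
  -- missing [p, q) means M ⊆ [-N, p) ∪ [q, N) for some N.
  · have : ((↑) : Compacts ℝ → Set ℝ) ⁻¹' {s | (s ∩ U).Nonempty} =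
        (⋂ p : ℚ × ℚ, ⋂ _ : Set.Ico (p.1 : ℝ) p.2 ⊆ U, ⋃ N : ℕ,
          compactsIn {(-(N : ℝ), (p.1 : ℝ)), ((p.2 : ℝ), (N : ℝ))})ᶜ := by
      ext M
      rw [Set.mem_compl_iff, ← not_iff_not, not_not]
      simp only [Set.mem_preimage, Set.mem_ofPred_eq, Set.mem_iInter, Set.mem_iUnion, compactsIn]
      constructor
      · intro h p hp
        obtain ⟨N, hN⟩ := exists_mem_compactsIn_Ico M
        refine ⟨N, fun x hx => ?_⟩
        simp only [mem_icoUnion, Finset.mem_insert, Finset.mem_singleton, exists_eq_or_imp,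
          exists_eq_left]
        by_contra hcon
        push Not at hcon
        refine h ⟨x, hx, hp ⟨?_, ?_⟩⟩
        · by_contra h'
          exact absurd (hcon.1 (hN hx).1) (not_le.2 (not_le.1 h'))
        · by_contra h'
          exact absurd (hcon.2 (not_lt.1 h')) (not_le.2 (hN hx).2)
      · rintro h ⟨x, hxM, hxU⟩
        obtain ⟨ε, hε, hb⟩ := Metric.isOpen_iff.1 (show IsOpen U from hU) x hxU
        obtain ⟨p, hp1, hp2⟩ := exists_rat_btwn (sub_lt_self x hε)
        obtain ⟨q, hq1, hq2⟩ := exists_rat_btwn (lt_add_of_pos_right x hε)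
        obtain ⟨N, hN⟩ := h (p, q) (fun y hy => hb (by
          rw [Real.ball_eq_Ioo]
          exact ⟨hp1.trans_le hy.1, hy.2.trans hq2⟩))
        have := hN hxM
        simp only [mem_icoUnion, Finset.mem_insert, Finset.mem_singleton, exists_eq_or_imp,
          exists_eq_left] at this
        rcases this with h | h <;> linarith [h.1, h.2]
    rw [this]
    exact (MeasurableSet.iInter fun p => MeasurableSet.iInter fun _ =>
      MeasurableSet.iUnion fun N => hmem _).compl

/-- A finite measure on the space of compact sets is determined by its values on the sets
`{M | M ⊆ E}`, `E` a finite union of half-open intervals. -/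
theorem ext_of_compactsIn {μ ν : FiniteMeasure (Compacts ℝ)}
    (h : ∀ S, (μ : Measure (Compacts ℝ)) (compactsIn S) =
      (ν : Measure (Compacts ℝ)) (compactsIn S)) :
    μ = ν := by
  refine FiniteMeasure.toMeasure_injective ?_
  refine Measure.ext_of_generateFrom_of_iUnion (Set.range compactsIn)
    (fun N : ℕ => compactsIn {(-(N : ℝ), (N : ℝ))}) borel_compacts_eq ?_ ?_ (fun N => ⟨_, rfl⟩)
    (fun N => measure_ne_top _ _) ?_
  · rintro _ ⟨S, rfl⟩ _ ⟨T, rfl⟩ _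
    obtain ⟨U, hU⟩ := exists_compactsIn_inter S T
    exact ⟨U, hU.symm⟩
  · refine Set.eq_univ_of_forall fun M => Set.mem_iUnion.2 ?_
    obtain ⟨N, hN⟩ := exists_mem_compactsIn_Ico M
    exact ⟨N, by simpa [compactsIn, icoUnion] using hN⟩
  · rintro _ ⟨S, rfl⟩
    exact h S

/-- A set containing s meets every neighbourhood of s. Meeting an open interval is an open
condition, so the bounds on the approximating measures pass to the limit. -/
theorem measure_mem_eq_zero {ι : Type*} {F : Filter ι} [F.NeBot]
    {μ : ι → FiniteMeasure (Compacts ℝ)} {ν : FiniteMeasure (Compacts ℝ)}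
    (h : Tendsto μ F (𝓝 ν)) (s : ℝ) (hhit : ∀ δ : ℝ≥0∞, δ ≠ 0 → ∃ ε > 0, ∀ᶠ i in F,
      (μ i : Measure (Compacts ℝ)) {M | ((M : Set ℝ) ∩ Set.Ioo (s - ε) (s + ε)).Nonempty} ≤ δ) :
    (ν : Measure (Compacts ℝ)) {M | s ∈ M} = 0 := by
  refine le_antisymm (le_of_forall_gt fun δ hδ => ?_) bot_le
  obtain ⟨δ', h0, hδ'⟩ := exists_between hδ
  obtain ⟨ε, hε, h'⟩ := hhit δ' h0.ne'
  refine lt_of_le_of_lt (measure_mono fun M hM => ?_) ((measure_le_of_isOpen_of_tendsto h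
    (Compacts.isOpen_inter_nonempty_of_isOpen isOpen_Ioo) h').trans_lt hδ')
  exact ⟨s, hM, by constructor <;> linarith⟩

/-- Replacing half-open intervals by open and by closed ones gives an open and a closed bound. A
compact set inside the closed union but not the open one contains an endpoint, which is a null
event. -/
theorem measure_compactsIn_eq {ι : Type*} {F : Filter ι} [F.NeBot]
    {μ : ι → FiniteMeasure (Compacts ℝ)} {ν : FiniteMeasure (Compacts ℝ)}
    (h : Tendsto μ F (𝓝 ν)) (hν : ∀ s : ℝ, (ν : Measure (Compacts ℝ)) {M | s ∈ M} = 0)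
    (S : Finset (ℝ × ℝ)) {c : ℝ≥0∞}
    (hS : Tendsto (fun i => (μ i : Measure (Compacts ℝ)) (compactsIn S)) F (𝓝 c)) :
    (ν : Measure (Compacts ℝ)) (compactsIn S) = c := by
  have hF : icoUnion S ⊆ ⋃ p ∈ S, Set.Icc p.1 p.2 :=
    Set.iUnion₂_mono fun p _ => Set.Ico_subset_Icc_self
  have hG : (⋃ p ∈ S, Set.Ioo p.1 p.2) ⊆ icoUnion S :=
    Set.iUnion₂_mono fun p _ => Set.Ioo_subset_Ico_self
  refine measure_eq_of_tendsto h
    (Compacts.isOpen_subsets_of_isOpen (U := ⋃ p ∈ S, Set.Ioo p.1 p.2)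
      (isOpen_biUnion fun _ _ => isOpen_Ioo))
    (Compacts.isClosed_subsets_of_isClosed (F := ⋃ p ∈ S, Set.Icc p.1 p.2)
      (S.finite_toSet.isClosed_biUnion fun _ _ => isClosed_Icc))
    (fun M hM => hM.trans hG) (fun M hM => hM.trans hF) ?_ hS
  refine measure_mono_null (t := ⋃ p ∈ S, {M : Compacts ℝ | p.1 ∈ M} ∪ {M | p.2 ∈ M}) ?_ ?_
  · rintro M ⟨h1, h2⟩
    simp only [Set.mem_ofPred_eq, Set.not_subset] at h1 h2
    obtain ⟨x, hx, hx'⟩ := h2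
    obtain ⟨p, hp, hxp⟩ := Set.mem_iUnion₂.1 (h1 hx)
    have hx'' : x ∉ Set.Ioo p.1 p.2 := fun h => hx' (Set.mem_iUnion₂.2 ⟨p, hp, h⟩)
    refine Set.mem_iUnion₂.2 ⟨p, hp, ?_⟩
    rcases hxp.1.eq_or_lt with h | h
    · exact Or.inl (by rw [Set.mem_ofPred_eq, h]; exact hx)
    · rcases hxp.2.eq_or_lt with h' | h'
      · exact Or.inr (by rw [Set.mem_ofPred_eq, ← h']; exact hx)
      · exact absurd ⟨h, h'⟩ hx''
  · exact (measure_biUnion_null_iff S.countable_toSet).2 fun p _ =>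
      measure_union_null (hν _) (hν _)

theorem exists_measure_not_subset_le (μ : FiniteMeasure (Compacts ℝ)) {ε : ℝ≥0∞} (hε : ε ≠ 0) :
    ∃ N : ℕ, (μ : Measure (Compacts ℝ)) {M | ¬ (M : Set ℝ) ⊆ Set.Icc (-(N : ℝ)) N} ≤ ε := by
  have hm : ∀ N : ℕ, MeasurableSet {M : Compacts ℝ | ¬ (M : Set ℝ) ⊆ Set.Icc (-(N : ℝ)) N} :=
    fun N => (Compacts.isClosed_subsets_of_isClosed isClosed_Icc).measurableSet.compl
  have h := tendsto_measure_iInter_atTop (μ := (μ : Measure (Compacts ℝ)))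
    (fun N => (hm N).nullMeasurableSet) (fun N N' h M hM hM' => hM (hM'.trans
      (Set.Icc_subset_Icc (neg_le_neg (Nat.cast_le.2 h)) (Nat.cast_le.2 h))))
    ⟨0, measure_ne_top _ _⟩
  have h0 : ⋂ N : ℕ, {M : Compacts ℝ | ¬ (M : Set ℝ) ⊆ Set.Icc (-(N : ℝ)) N} = ∅ := by
    refine Set.eq_empty_of_forall_notMem fun M hM => ?_
    obtain ⟨N, hN⟩ := exists_mem_compactsIn_Ico M
    exact Set.mem_iInter.1 hM N (hN.trans Set.Ico_subset_Icc_self)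
  rw [h0, measure_empty] at h
  exact (ENNReal.tendsto_nhds_zero.1 h ε (pos_iff_ne_zero.2 hε)).exists

/-- A criterion of weak convergence of finite measures on the space of compact subsets of `ℝ`. -/
theorem exists_tendsto_of_compactsIn {μ : ℕ+ → FiniteMeasure (Compacts ℝ)} {C : NNReal}
    (hmass : ∀ i, (μ i).mass ≤ C)
    (htight : ∀ ε : ℝ≥0∞, ε ≠ 0 → ∃ N : ℕ, ∀ᶠ i in atTop,
      (μ i : Measure (Compacts ℝ)) {M | ¬ (M : Set ℝ) ⊆ Set.Icc (-(N : ℝ)) N} ≤ ε)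
    (hhit : ∀ (s : ℝ) (δ : ℝ≥0∞), δ ≠ 0 → ∃ ε > 0, ∀ᶠ i in atTop,
      (μ i : Measure (Compacts ℝ)) {M | ((M : Set ℝ) ∩ Set.Ioo (s - ε) (s + ε)).Nonempty} ≤ δ)
    {ℓ : Finset (ℝ × ℝ) → ℝ≥0∞}
    (hlim : ∀ S, Tendsto (fun i => (μ i : Measure (Compacts ℝ)) (compactsIn S)) atTop (𝓝 (ℓ S))) :
    ∃ ν : FiniteMeasure (Compacts ℝ), Tendsto μ atTop (𝓝 ν) ∧
      (∀ s : ℝ, (ν : Measure (Compacts ℝ)) {M | s ∈ M} = 0) ∧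
      ∀ S, (ν : Measure (Compacts ℝ)) (compactsIn S) = ℓ S := by
  -- Eventual tightness becomes tightness for all i: the finitely many earlier measures are each
  -- tight, and N is enlarged to serve them too.
  have hN : ∀ n : ℕ, ∃ N : ℕ, ∀ i,
      (μ i : Measure (Compacts ℝ)) {M | ¬ (M : Set ℝ) ⊆ Set.Icc (-(N : ℝ)) N} ≤
        ((n + 1 : NNReal)⁻¹ : NNReal) := by
    intro n
    have hε : (((n + 1 : NNReal)⁻¹ : NNReal) : ℝ≥0∞) ≠ 0 := by
      rw [ENNReal.coe_ne_zero]; positivity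
    obtain ⟨N, hN⟩ := htight _ hε
    obtain ⟨i₀, hi₀⟩ := eventually_atTop.1 hN
    choose K hK using fun i => exists_measure_not_subset_le (μ i) hε
    obtain ⟨K', hK'⟩ := ((Finset.Iio i₀).image K).exists_le
    refine ⟨max N K', fun i => ?_⟩
    have hmono : ∀ {A B : ℕ}, A ≤ B → {M : Compacts ℝ | ¬ (M : Set ℝ) ⊆ Set.Icc (-(B : ℝ)) B} ⊆
        {M : Compacts ℝ | ¬ (M : Set ℝ) ⊆ Set.Icc (-(A : ℝ)) A} := fun h M hM hM' => hM (hM'.trans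
      (Set.Icc_subset_Icc (neg_le_neg (Nat.cast_le.2 h)) (Nat.cast_le.2 h)))
    rcases lt_or_ge i i₀ with h | h
    · exact (measure_mono (hmono ((hK' _ (Finset.mem_image_of_mem K (Finset.mem_Iio.2 h))).trans
        (le_max_right _ _)))).trans
        (hK i)
    · exact (measure_mono (hmono (le_max_left _ _))).trans (hi₀ i h)
  choose N hN using hN
  -- Prokhorov: the compact subsets of a fixed compact interval form a compact set in the
  -- hyperspace.
  have hcomp := isCompact_setOfPred_finiteMeasure_mass_le_compl_isCompact_le C
    (u := fun n : ℕ => (n + 1 : NNReal)⁻¹)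
    (K := fun n => {M : Compacts ℝ | (M : Set ℝ) ⊆ Set.Icc (-(N n : ℝ)) (N n)})
    (NNReal.tendsto_coe.1 (by simpa using tendsto_one_div_add_atTop_nhds_zero_nat (𝕜 := ℝ)))
    (fun n => Compacts.isCompact_subsets_of_isCompact isCompact_Icc) (Or.inl inferInstance)
  have hmem : ∀ᶠ i in atTop, μ i ∈ {μ : FiniteMeasure (Compacts ℝ) | μ.mass ≤ C ∧ ∀ n,
      μ {M : Compacts ℝ | (M : Set ℝ) ⊆ Set.Icc (-(N n : ℝ)) (N n)}ᶜ ≤ (n + 1 : NNReal)⁻¹} :=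
    Eventually.of_forall fun i => ⟨hmass i, fun n => by
      rw [← ENNReal.coe_le_coe, FiniteMeasure.ennreal_coeFn_eq_coeFn_toMeasure]
      exact hN n i⟩
  -- Along an ultrafilter converging to ν, the prescribed limits determine ν on the π-system. Hence
  -- there is only one cluster point.
  have hclus : ∀ ν, MapClusterPt ν atTop μ →
      (∀ s : ℝ, (ν : Measure (Compacts ℝ)) {M | s ∈ M} = 0) ∧
      ∀ S, (ν : Measure (Compacts ℝ)) (compactsIn S) = ℓ S := by
    intro ν hν
    obtain ⟨F, hF, hFν⟩ := mapClusterPt_iff_ultrafilter.1 hν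
    have h0 := fun s => measure_mem_eq_zero hFν s fun δ hδ => by
      obtain ⟨ε, hε, h⟩ := hhit s δ hδ
      exact ⟨ε, hε, hF h⟩
    exact ⟨h0, fun S => measure_compactsIn_eq hFν h0 S ((hlim S).mono_left hF)⟩
  obtain ⟨ν, -, hν⟩ := hcomp.exists_mapClusterPt (tendsto_principal.2 hmem)
  refine ⟨ν, hcomp.tendsto_nhds_of_unique_mapClusterPt hmem fun ν' _ hν' => ?_, hclus ν hν⟩
  exact ext_of_compactsIn fun S => by rw [(hclus ν hν).2, (hclus ν' hν').2]

end Compacts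

end CoarseScaling

namespace CoarseScaling

/-! ### Spectral measures of sequences of vectors -/

theorem coe_latticeSet_subset {i : ℕ+} {M : Finset ℤ} {E : Set ℝ} :
    (latticeSet i M : Set ℝ) ⊆ E ↔ ∀ k ∈ M, (k : ℝ) / i ∈ E := by
  change (fun k : ℤ => (k : ℝ) / (i : ℝ)) '' (M : Set ℤ) ⊆ E ↔ _
  rw [Set.image_subset_iff]
  rfl

section SpectralMeasure

variable {𝕜 : Type*} [RCLike 𝕜] {i : ℕ+} {f g : Lp 𝕜 2 (signMeasure ℤ)} {S : Set (Compacts ℝ)}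
  {D D' : Finset ℤ}

open Classical in
theorem spectralMeasure_apply (hS : MeasurableSet S) :
    (spectralMeasure i f : Measure (Compacts ℝ)) S =
      ∑' M, if latticeSet i M ∈ S then ENNReal.ofReal (‖walshCoeff f M‖ ^ 2) else 0 := by
  change Measure.sum (fun M : Finset ℤ =>
    ENNReal.ofReal (‖walshCoeff f M‖ ^ 2) • Measure.dirac (latticeSet i M)) S = _
  rw [Measure.sum_apply _ hS]
  refine tsum_congr fun M => ?_
  rw [Measure.smul_apply, Measure.dirac_apply' _ hS, smul_eq_mul, Set.indicator_apply]
  split_ifs <;> simp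

theorem spectralMeasure_eq_sum (hS : MeasurableSet S)
    (h : ∀ M, latticeSet i M ∈ S ↔ M ⊆ D) :
    (spectralMeasure i f : Measure (Compacts ℝ)) S =
      ENNReal.ofReal (∑ M ∈ D.powerset, ‖walshCoeff f M‖ ^ 2) := by
  classical
  rw [spectralMeasure_apply hS, ENNReal.ofReal_sum_of_nonneg fun _ _ => by positivity,
    tsum_eq_sum (s := D.powerset) fun M hM => if_neg (by rwa [h, ← Finset.mem_powerset])]
  exact Finset.sum_congr rfl fun M hM => if_pos ((h M).2 (Finset.mem_powerset.1 hM))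

/-- Serves to show that mass is small when D' ⊆ D and both sums have the same limit. -/
theorem spectralMeasure_le_sub (hS : MeasurableSet S)
    (h : ∀ M, latticeSet i M ∈ S → M ⊆ D ∧ ¬ M ⊆ D') (hD : D' ⊆ D) :
    (spectralMeasure i f : Measure (Compacts ℝ)) S ≤
      ENNReal.ofReal (∑ M ∈ D.powerset, ‖walshCoeff f M‖ ^ 2) -
        ENNReal.ofReal (∑ M ∈ D'.powerset, ‖walshCoeff f M‖ ^ 2) := by
  classical
  refine ENNReal.le_sub_of_add_le_right ENNReal.ofReal_ne_top ?_
  rw [spectralMeasure_apply hS, ENNReal.ofReal_sum_of_nonneg fun _ _ => by positivity,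
    ENNReal.ofReal_sum_of_nonneg fun _ _ => by positivity,
    tsum_eq_sum (s := D.powerset \ D'.powerset) fun M hM => if_neg fun hM' => hM (by
      simpa [Finset.mem_sdiff] using h M hM'),
    ← Finset.sum_sdiff (Finset.powerset_mono.2 hD)]
  gcongr with M
  split_ifs <;> simp

/-- Where the coefficients of g vanish, those of f and f - g agree; Bessel's inequality bounds their
sum. -/
theorem spectralMeasure_le_norm_sub (hS : MeasurableSet S)
    (h : ∀ M, latticeSet i M ∈ S → walshCoeff g M = 0) :
    (spectralMeasure i f : Measure (Compacts ℝ)) S ≤ ENNReal.ofReal (‖f - g‖ ^ 2) := by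
  classical
  have hsum := (orthonormal_walshVec (𝕜 := 𝕜)).inner_products_summable (f - g)
  rw [spectralMeasure_apply hS]
  calc _ ≤ ∑' M, ENNReal.ofReal (‖inner 𝕜 (walshVec 𝕜 M) (f - g)‖ ^ 2) := by
        refine ENNReal.tsum_le_tsum fun M => ?_
        split_ifs with hM
        · rw [inner_sub_right, ← walshCoeff_eq_inner_walshVec, ← walshCoeff_eq_inner_walshVec,
            h M hM, sub_zero]
        · exact bot_le
    _ = ENNReal.ofReal (∑' M, ‖inner 𝕜 (walshVec 𝕜 M) (f - g)‖ ^ 2) :=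
        (ENNReal.ofReal_tsum_of_nonneg (fun _ => by positivity) hsum).symm
    _ ≤ _ := ENNReal.ofReal_le_ofReal (orthonormal_walshVec.tsum_inner_products_le _)

theorem mass_spectralMeasure_le : (spectralMeasure i f).mass ≤ ‖f‖₊ ^ 2 := by
  rw [← ENNReal.coe_le_coe, FiniteMeasure.ennreal_mass]
  refine (spectralMeasure_le_norm_sub (g := 0) MeasurableSet.univ fun M _ => ?_).trans ?_
  · rw [walshCoeff_eq_inner_walshVec, inner_zero_right]
  · rw [sub_zero, ← coe_nnnorm, ← NNReal.coe_pow, ENNReal.ofReal_coe_nnreal]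

theorem walshCoeff_indLp_eq_zero {B : Set (ℤ → ℤˣ)} (hm : MeasurableSet B)
    (hB : DependsOn (· ∈ B) (D : Set ℤ)) {M : Finset ℤ} (hM : ¬ M ⊆ D) :
    walshCoeff (indLp 𝕜 (signMeasure ℤ) B) M = 0 := by
  rw [walshCoeff_eq_inner_walshVec, ← walshProj_indLp hm hB, ← inner_walshProj_left,
    walshProj_walshVec, if_neg hM, inner_zero_left]

end SpectralMeasure

/-! ### Tightness, absence of fixed points and convergence on finite unions of intervals -/

section Sequence

variable {𝕜 : Type*} [RCLike 𝕜] {𝒜 : Set (SetSeq DyadicSpace)}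
  {x : ℕ+ → Lp 𝕜 2 (signMeasure ℤ)}

theorem CoarseInstant.exists_abs_le (a : CoarseInstant) :
    ∃ N : ℕ, ∀ i : ℕ+, |(a.num i : ℝ) / i| ≤ N := by
  have h : Tendsto (fun n : ℕ => (a.num n.succPNat : ℝ) / (n.succPNat : ℕ+)) atTop (𝓝 a.lim) :=
    a.tendsto.comp (tendsto_atTop_atTop.2 fun i => ⟨i, fun n hn => by
      rw [← PNat.coe_le_coe]; simpa using hn.trans n.le_succ⟩)
  obtain ⟨C, hC⟩ := (Metric.isBounded_range_of_tendsto _ h).exists_norm_le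
  obtain ⟨N, hN⟩ := exists_nat_ge C
  refine ⟨N, fun i => (hC _ ⟨i.natPred, ?_⟩).trans hN⟩
  simp

/-- Each event depends on signs in a coarse interval that is bounded uniformly in i, and a
combination involves finitely many events. -/
theorem exists_walshCoeff_eq_zero {p : ℕ+ → Lp 𝕜 2 (signMeasure ℤ)}
    (hp : p ∈ indSpan 𝕜 (⋃ (s : CoarseInstant) (t : CoarseInstant) (_ : s ≤ t),
      intervalEvents 𝒜 s t)) :
    ∃ N : ℕ, ∀ (i : ℕ+) (M : Finset ℤ), ¬ (latticeSet i M : Set ℝ) ⊆ Set.Icc (-(N : ℝ)) N →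
      walshCoeff (p i) M = 0 := by
  simp only [walshCoeff_eq_inner_walshVec]
  have hmono : ∀ {A B : ℕ}, A ≤ B → Set.Icc (-(A : ℝ)) A ⊆ Set.Icc (-(B : ℝ)) B := fun h =>
    Set.Icc_subset_Icc (neg_le_neg (Nat.cast_le.2 h)) (Nat.cast_le.2 h)
  induction hp using Submodule.span_induction with
  | zero => exact ⟨0, fun i M _ => inner_zero_right _⟩
  | add p q _ _ hp hq =>
    obtain ⟨N, hN⟩ := hp
    obtain ⟨N', hN'⟩ := hq
    refine ⟨max N N', fun i M h => ?_⟩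
    rw [Pi.add_apply, inner_add_right, hN i M fun h' => h (h'.trans (hmono (le_max_left _ _))),
      hN' i M fun h' => h (h'.trans (hmono (le_max_right _ _))), add_zero]
  | smul c p _ hp =>
    obtain ⟨N, hN⟩ := hp
    exact ⟨N, fun i M h => by rw [Pi.smul_apply, inner_smul_right, hN i M h, mul_zero]⟩
  | mem p hp =>
    obtain ⟨B, hB, rfl⟩ := hp
    simp only [Set.mem_iUnion] at hB
    obtain ⟨s, t, -, hB⟩ := hB
    obtain ⟨N, hN⟩ := s.exists_abs_le
    obtain ⟨N', hN'⟩ := t.exists_abs_le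
    refine ⟨max N N', fun i M h => ?_⟩
    rw [← walshCoeff_eq_inner_walshVec]
    refine walshCoeff_indLp_eq_zero (D := Finset.Ico (s.num i) (t.num i))
      (intervalEvents.measurableSet hB i) ?_ fun hM => h ?_
    · rw [Finset.coe_Ico]
      exact intervalEvents.dependsOn hB i
    · refine coe_latticeSet_subset.2 fun k hk => ?_
      have hk' := Finset.mem_Ico.1 (hM hk)
      have hi : (0 : ℝ) < i := by exact_mod_cast i.pos
      have h1 := (abs_le.1 (hN i)).1
      have h2 := (abs_le.1 (hN' i)).2
      have h3 : (s.num i : ℝ) / i ≤ k / i := by gcongr; exact hk'.1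
      have h4 : (k : ℝ) / i ≤ t.num i / i := by gcongr; exact hk'.2.le
      rw [Nat.cast_max]
      exact ⟨by linarith [le_max_left (N : ℝ) N'], by linarith [le_max_right (N : ℝ) N']⟩

/-- The spectral measures of an asymptotic limit of combinations of coarse events are tight. -/
theorem IsDyadicCoarseFactorization.exists_spectralMeasure_not_subset_le
    (h𝒜 : IsDyadicCoarseFactorization 𝒜) (hx : x ∈ asympClosure (indSpan 𝕜 𝒜))
    {ε : ℝ≥0∞} (hε : ε ≠ 0) :
    ∃ N : ℕ, ∀ᶠ i in atTop, (spectralMeasure i (x i) : Measure (Compacts ℝ))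
      {M | ¬ (M : Set ℝ) ⊆ Set.Icc (-(N : ℝ)) N} ≤ ε := by
  have hx' : x ∈ asympClosure (indSpan 𝕜 (⋃ (s : CoarseInstant) (t : CoarseInstant) (_ : s ≤ t),
      intervalEvents 𝒜 s t)) := by
    refine asympClosure_le (Submodule.span_le.2 ?_) hx
    rintro _ ⟨A, hA, rfl⟩
    refine indSeq_mem_asympClosure_of_approximable (fun C hC i => ?_)
      (fun C hC => le_asympClosure (indSeq_mem_indSpan hC)) (h𝒜.subset_approximable hA)
    simp only [Set.mem_iUnion] at hC
    obtain ⟨s, t, -, hC⟩ := hC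
    exact intervalEvents.measurableSet hC i
  obtain ⟨δ, hδ, hδε⟩ : ∃ δ : ℝ, 0 < δ ∧ ENNReal.ofReal (δ ^ 2) ≤ ε := by
    rcases eq_or_ne ε ∞ with rfl | htop
    · exact ⟨1, one_pos, le_top⟩
    · refine ⟨√ε.toReal, Real.sqrt_pos.2 (ENNReal.toReal_pos hε htop), ?_⟩
      rw [Real.sq_sqrt ENNReal.toReal_nonneg, ENNReal.ofReal_toReal htop]
  obtain ⟨p, hp, hxp⟩ := hx' δ hδ
  obtain ⟨N, hN⟩ := exists_walshCoeff_eq_zero hp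
  refine ⟨N, hxp.mono fun i hi => ?_⟩
  refine (spectralMeasure_le_norm_sub
    (Compacts.isClosed_subsets_of_isClosed isClosed_Icc).measurableSet.compl
    fun M hM => hN i M hM).trans (le_trans ?_ hδε)
  gcongr

/-- The coarse instant with `t[i] = ⌈i τ_i⌉ / i`. -/
noncomputable def CoarseInstant.ofTendsto (τ : ℕ+ → ℝ) (l : ℝ) (h : Tendsto τ atTop (𝓝 l)) :
    CoarseInstant where
  num i := ⌈τ i * i⌉
  lim := l
  tendsto := by
    have h0 : Tendsto (fun i : ℕ+ => (1 : ℝ) / (i : ℝ)) atTop (𝓝 0) :=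
      tendsto_one_div_atTop_nhds_zero_nat.comp tendsto_PNat_val_atTop_atTop
    refine tendsto_of_tendsto_of_tendsto_of_le_of_le h (by simpa using h.add h0)
      (fun i => ?_) (fun i => ?_)
    all_goals have hi : (0 : ℝ) < i := by exact_mod_cast i.pos
    · exact (le_div_iff₀ hi).2 (Int.le_ceil _)
    · change (⌈τ i * i⌉ : ℝ) / i ≤ τ i + (i : ℝ)⁻¹
      rw [div_le_iff₀ hi, add_mul, inv_mul_cancel₀ hi.ne']
      exact (Int.ceil_lt_add_one _).le

/-- Rounding up makes the lattice interval between two such instants consist exactly of the lattice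
points of the half-open real interval. -/
theorem CoarseInstant.ofTendsto_num_le {τ : ℕ+ → ℝ} {l : ℝ} (h : Tendsto τ atTop (𝓝 l)) {i : ℕ+}
    {k : ℤ} : (ofTendsto τ l h).num i ≤ k ↔ τ i ≤ (k : ℝ) / i := by
  have hi : (0 : ℝ) < i := by exact_mod_cast i.pos
  rw [le_div_iff₀ hi]
  exact Int.ceil_le

theorem CoarseInstant.lt_ofTendsto_num {τ : ℕ+ → ℝ} {l : ℝ} (h : Tendsto τ atTop (𝓝 l)) {i : ℕ+}
    {k : ℤ} : k < (ofTendsto τ l h).num i ↔ (k : ℝ) / i < τ i := by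
  rw [← not_le, ofTendsto_num_le, not_le]

theorem CoarseInstant.ofTendsto_le {τ σ : ℕ+ → ℝ} {l l' : ℝ} (h : Tendsto τ atTop (𝓝 l))
    (h' : Tendsto σ atTop (𝓝 l')) (hle : ∀ i, τ i ≤ σ i) : ofTendsto τ l h ≤ ofTendsto σ l' h' := by
  intro i
  have hi : (0 : ℝ) < i := by exact_mod_cast i.pos
  exact Int.ceil_le_ceil (mul_le_mul_of_nonneg_right (hle i) hi.le)

theorem mem_gridSet_biUnion {t : ℕ → CoarseInstant} (ht : Monotone t) {n : ℕ} {p q : Fin n → ℕ}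
    (hpq : ∀ l, p l ≤ q l) {i : ℕ+} {k : ℤ} :
    k ∈ gridSet t (Finset.univ.biUnion fun l => Finset.Ico (p l) (q l)) i ↔
      ∃ l, (t (p l)).num i ≤ k ∧ k < (t (q l)).num i := by
  constructor
  · intro hk
    obtain ⟨j, hj, hk⟩ := Finset.mem_biUnion.1 hk
    obtain ⟨l, -, hl⟩ := Finset.mem_biUnion.1 hj
    rw [Finset.mem_Ico] at hk hl
    exact ⟨l, (ht hl.1 i).trans hk.1, hk.2.trans_le (ht (Nat.succ_le_of_lt hl.2) i)⟩
  · rintro ⟨l, h1, h2⟩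
    exact subset_gridSet (hpq l) (Finset.subset_biUnion_of_mem
      (fun l => Finset.Ico (p l) (q l)) (Finset.mem_univ l)) i ⟨h1, h2⟩

variable {Y : Type*} [MeasurableSpace Y] {Q : Measure Y} [IsProbabilityMeasure Q]
  {R : CoarseRefinement dyadicMeasure 𝒜 Q} {y : Lp 𝕜 2 Q}

/-- The spectral measures do not charge coarse time intervals that shrink to a point. -/
theorem IsDyadicCoarseFactorization.tendsto_spectralMeasure_zero
    (h𝒜 : IsDyadicCoarseFactorization 𝒜) (hxy : RefLim R 𝒜 x y)
    (hx : x ∈ asympClosure (indSpan 𝕜 𝒜)) {a b : CoarseInstant} (hab : a ≤ b)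
    (hlim : a.lim = b.lim) {S : ℕ+ → Set (Compacts ℝ)} (hS : ∀ i, MeasurableSet (S i))
    (hSM : ∀ i M, latticeSet i M ∈ S i → ∃ k ∈ M, a.num i ≤ k ∧ k < b.num i) :
    Tendsto (fun i => (spectralMeasure i (x i) : Measure (Compacts ℝ)) (S i)) atTop (𝓝 0) := by
  refine ENNReal.tendsto_nhds_zero.2 fun ε hε => ?_
  have hε2 : ε / 2 ≠ 0 := by simpa using hε.ne'
  obtain ⟨N, hN⟩ := h𝒜.exists_spectralMeasure_not_subset_le hx hε2
  set c := a.min (CoarseInstant.ofTendsto (fun _ => -(N : ℝ)) _ tendsto_const_nhds) with hc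
  -- The extra 1 places lattice points at N strictly below the right end of a half-open interval.
  set d := b.max (CoarseInstant.ofTendsto (fun _ => (N : ℝ) + 1) _ tendsto_const_nhds) with hd
  have hca : c ≤ a := CoarseInstant.min_le_left _ _
  have hbd : b ≤ d := CoarseInstant.le_max_left _ _
  -- The grid proper is c, a, b, d at indices 1 to 4; index 0 is a dummy, since grid indices in use
  -- start at 1.
  let t : ℕ → CoarseInstant := fun | 0 => c | 1 => c | 2 => a | 3 => b | _ => d
  have ht : Monotone t := by
    refine monotone_nat_of_le_succ fun n => ?_
    match n with
    | 0 => exact le_rfl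
    | 1 => exact hca
    | 2 => exact hab
    | 3 => exact hbd
    | _ + 4 => exact le_rfl
  have hpq : ∀ k, (![1, 2] : Fin 2 → ℕ) k ≤ ![2, 4] k := by decide
  have hpq' : ∀ k, (![1, 3] : Fin 2 → ℕ) k ≤ ![2, 4] k := by decide
  -- Compare [c, a) ∪ [a, d) with [c, a) ∪ [b, d). Their limiting fields coincide because a[∞] =
  -- b[∞], so the two sums have the same limit. Their difference bounds the mass of the sets that
  -- meet [a, b) and lie in [-N, N].
  have h1 := h𝒜.tendsto_sum_walshCoeff R ht (N := 3) ![1, 2] ![2, 4] hpq (by decide)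
    (by decide) hxy hx
  have h2 := h𝒜.tendsto_sum_walshCoeff R ht (N := 3) ![1, 3] ![2, 4] hpq' (by decide)
    (by decide) hxy hx
  have hfield : (⨆ k, R.field (t ((![1, 2] : Fin 2 → ℕ) k)).lim (t ((![2, 4] : Fin 2 → ℕ) k)).lim) =
      ⨆ k, R.field (t ((![1, 3] : Fin 2 → ℕ) k)).lim (t ((![2, 4] : Fin 2 → ℕ) k)).lim := by
    refine iSup_congr fun k => ?_
    fin_cases k
    · rfl
    · change R.field a.lim d.lim = R.field b.lim d.lim
      rw [hlim]
  rw [hfield] at h1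
  have hy : eLpNorm (Q[y | ⨆ k, R.field (t ((![1, 3] : Fin 2 → ℕ) k)).lim
      (t ((![2, 4] : Fin 2 → ℕ) k)).lim]) 2 Q ^ 2 ≠ ∞ :=
    ENNReal.pow_ne_top ((Lp.memLp y).condExp (by simp)).eLpNorm_ne_top
  have h3 := ENNReal.Tendsto.sub h1 h2 (Or.inl hy)
  rw [tsub_self] at h3
  filter_upwards [hN, ENNReal.tendsto_nhds_zero.1 h3 _ (pos_iff_ne_zero.2 hε2)] with i hi hi'
  have hmN : MeasurableSet {M : Compacts ℝ | (M : Set ℝ) ⊆ Set.Icc (-(N : ℝ)) N} :=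
    (Compacts.isClosed_subsets_of_isClosed isClosed_Icc).measurableSet
  have hsub : S i ⊆ {M | ¬ (M : Set ℝ) ⊆ Set.Icc (-(N : ℝ)) N} ∪
      (S i ∩ {M | (M : Set ℝ) ⊆ Set.Icc (-(N : ℝ)) N}) := by
    intro M hM
    by_cases h : (M : Set ℝ) ⊆ Set.Icc (-(N : ℝ)) N
    · exact Or.inr ⟨hM, h⟩
    · exact Or.inl h
  refine (measure_mono hsub).trans ((measure_union_le _ _).trans
    ((add_le_add hi (le_trans ?_ hi')).trans_eq (ENNReal.add_halves ε)))
  refine spectralMeasure_le_sub ((hS i).inter hmN) (fun M hM => ?_) (fun k hk => ?_)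
  · refine ⟨fun k hk => ?_, fun hM' => ?_⟩
    · rw [mem_gridSet_biUnion ht hpq, Fin.exists_fin_two]
      have hk' := coe_latticeSet_subset.1 hM.2 k hk
      have hck : c.num i ≤ k := (CoarseInstant.min_le_right _ _ i).trans
        ((CoarseInstant.ofTendsto_num_le _).2 hk'.1)
      have hkd : k < d.num i := ((CoarseInstant.lt_ofTendsto_num _).2
        (hk'.2.trans_lt (lt_add_one _))).trans_le (CoarseInstant.le_max_right _ _ i)
      rcases lt_or_ge k (a.num i) with h | h
      · exact Or.inl ⟨hck, h⟩
      · exact Or.inr ⟨h, hkd⟩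
    · obtain ⟨k, hk, hak, hkb⟩ := hSM i M hM.1
      have := hM' hk
      rw [mem_gridSet_biUnion ht hpq', Fin.exists_fin_two] at this
      rcases this with ⟨-, h⟩ | ⟨h, -⟩
      · exact absurd h (not_lt.2 hak)
      · exact absurd h (not_le.2 hkb)
  · rw [mem_gridSet_biUnion ht hpq', Fin.exists_fin_two] at hk
    rw [mem_gridSet_biUnion ht hpq, Fin.exists_fin_two]
    rcases hk with h | ⟨h, h'⟩
    · exact Or.inl h
    · exact Or.inr ⟨(hab i).trans h, h'⟩

/-- By contradiction and diagonal choice: if mass δ persisted in ever smaller neighbourhoods of s,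
radii tending to zero along the bad indices would give a coarse interval shrinking to s with
non-vanishing spectral mass. -/
theorem IsDyadicCoarseFactorization.exists_spectralMeasure_hit_le
    (h𝒜 : IsDyadicCoarseFactorization 𝒜) (hxy : RefLim R 𝒜 x y)
    (hx : x ∈ asympClosure (indSpan 𝕜 𝒜)) (s : ℝ) {δ : ℝ≥0∞} (hδ : δ ≠ 0) :
    ∃ ε > 0, ∀ᶠ i in atTop, (spectralMeasure i (x i) : Measure (Compacts ℝ))
      {M | ((M : Set ℝ) ∩ Set.Ioo (s - ε) (s + ε)).Nonempty} ≤ δ := by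
  classical
  by_contra! hcon
  have hfreq : ∀ n : ℕ, ∃ i : ℕ+, n.succPNat ≤ i ∧
      δ < (spectralMeasure i (x i) : Measure (Compacts ℝ))
        {M | ((M : Set ℝ) ∩ Set.Ioo (s - 1 / (n + 1)) (s + 1 / (n + 1))).Nonempty} := by
    intro n
    have h := hcon (1 / (n + 1)) (by positivity)
    obtain ⟨i, hi, h'⟩ := frequently_atTop.1 h n.succPNat
    exact ⟨i, hi, h'⟩
  choose φ hφ hδφ using hfreq
  -- A selected index receives the radius of one chosen n with φ n = i, as φ need not be injective;
  -- other indices receive 0. Indices beyond φ 0, …, φ (K - 1) have chosen n ≥ K, hence η → 0.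
  let η : ℕ+ → ℝ := fun i => if h : ∃ n, φ n = i then 1 / ((h.choose : ℝ) + 1) else 0
  have hη0 : ∀ i, 0 ≤ η i := fun i => by
    simp only [η]
    split_ifs <;> positivity
  have hη : Tendsto η atTop (𝓝 0) := by
    refine Metric.tendsto_atTop.2 fun ε hε => ?_
    obtain ⟨K, hK⟩ := exists_nat_one_div_lt hε
    obtain ⟨i₀, hi₀⟩ := ((Finset.range K).image φ).exists_le
    refine ⟨i₀ + 1, fun i hi => ?_⟩
    rw [Real.dist_0_eq_abs, abs_of_nonneg (hη0 i)]
    simp only [η]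
    split_ifs with h
    · refine lt_of_le_of_lt ?_ hK
      have hn : K ≤ h.choose := by
        by_contra hlt
        have h1 := hi₀ _ (Finset.mem_image_of_mem φ (Finset.mem_range.2 (not_le.1 hlt)))
        rw [h.choose_spec] at h1
        exact absurd (hi.trans h1) (not_le.2 (PNat.lt_add_one_iff.2 le_rfl))
      gcongr
    · exact hε
  have ha : Tendsto (fun i => s - η i) atTop (𝓝 s) := by simpa using tendsto_const_nhds.sub hη
  have hb : Tendsto (fun i => s + η i) atTop (𝓝 s) := by simpa using tendsto_const_nhds.add hη
  have hlim := h𝒜.tendsto_spectralMeasure_zero hxy hx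
    (a := CoarseInstant.ofTendsto _ _ ha) (b := CoarseInstant.ofTendsto _ _ hb)
    (CoarseInstant.ofTendsto_le _ _ fun i => by linarith [hη0 i]) rfl
    (S := fun i => {M | ((M : Set ℝ) ∩ Set.Ioo (s - η i) (s + η i)).Nonempty})
    (fun i => (Compacts.isOpen_inter_nonempty_of_isOpen isOpen_Ioo).measurableSet)
    (fun i M hM => by
      obtain ⟨_, ⟨k, hk, rfl⟩, h1, h2⟩ := hM
      exact ⟨k, hk, (CoarseInstant.ofTendsto_num_le _).2 h1.le,
        (CoarseInstant.lt_ofTendsto_num _).2 h2⟩)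
  obtain ⟨i₀, hi₀⟩ := eventually_atTop.1 (ENNReal.tendsto_nhds_zero.1 hlim δ
    (pos_iff_ne_zero.2 hδ))
  -- The index φ i₀ lies beyond i₀. The n chosen for it may differ from i₀, but the lower bound δ
  -- holds for that n as well.
  have hex : ∃ n, φ n = φ i₀ := ⟨i₀, rfl⟩
  have h1 := hi₀ (φ i₀) ((PNat.coe_le_coe _ _).1 (by
    have := (PNat.coe_le_coe _ _).2 (hφ i₀)
    simp only [Nat.succPNat_coe] at this
    omega))
  have h2 := hδφ hex.choose
  rw [hex.choose_spec] at h2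
  have h3 : η (φ i₀) = 1 / ((hex.choose : ℝ) + 1) := dif_pos hex
  rw [h3] at h1
  exact absurd h1 (not_le.2 h2)

/-- Sort all endpoints into one increasing list, so that every interval becomes a block of
consecutive grid intervals; positions are shifted by one to keep index 0 free. -/
theorem exists_monotone_index {n : ℕ} (a b : Fin n → ℝ) (hab : ∀ k, a k ≤ b k) :
    ∃ (τ : ℕ → ℝ) (N : ℕ) (p q : Fin n → ℕ), Monotone τ ∧ (∀ k, p k ≤ q k) ∧ (∀ k, 1 ≤ p k) ∧
      (∀ k, q k ≤ N + 1) ∧ (∀ k, τ (p k) = a k) ∧ ∀ k, τ (q k) = b k := by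
  classical
  set F : Finset ℝ := Finset.univ.image a ∪ Finset.univ.image b with hF
  have ha : ∀ k, a k ∈ F := fun k => Finset.mem_union_left _ (Finset.mem_image_of_mem a
    (Finset.mem_univ k))
  have hb : ∀ k, b k ∈ F := fun k => Finset.mem_union_right _ (Finset.mem_image_of_mem b
    (Finset.mem_univ k))
  rcases Nat.eq_zero_or_pos F.card with h0 | h0
  · have : IsEmpty (Fin n) := ⟨fun k => by
      rw [Finset.card_eq_zero] at h0
      exact absurd (ha k) (by simp [h0])⟩
    exact ⟨fun _ => 0, 0, fun _ => 1, fun _ => 1, monotone_const, isEmptyElim, isEmptyElim,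
      isEmptyElim, isEmptyElim, isEmptyElim⟩
  · let e := F.orderIsoOfFin rfl
    have hτ : ∀ (j : Fin F.card), (⟨min ((j : ℕ) + 1 - 1) (F.card - 1), by omega⟩ :
        Fin F.card) = j :=
      fun j => Fin.ext (by have := j.2; simp only; omega)
    -- Index j carries the endpoint of rank j - 1; truncated subtraction and the cap extend the list
    -- by constants at both ends, preserving monotonicity.
    refine ⟨fun j => (e ⟨min (j - 1) (F.card - 1), by omega⟩ : ℝ), F.card,
      fun k => e.symm ⟨a k, ha k⟩ + 1, fun k => e.symm ⟨b k, hb k⟩ + 1, ?_, fun k => ?_,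
      fun k => Nat.le_add_left _ _, fun k => ?_, fun k => ?_, fun k => ?_⟩
    · intro j j' h
      refine e.monotone (Fin.mk_le_mk.2 ?_)
      omega
    · exact Nat.add_le_add_right (e.symm.monotone (hab k)) 1
    · exact Nat.add_le_add_right (e.symm ⟨b k, hb k⟩).2.le 1
    · simp only [hτ, OrderIso.apply_symm_apply]
    · simp only [hτ, OrderIso.apply_symm_apply]

/-- The spectral measures of the set of compact subsets of a finite union of intervals converge. -/
theorem IsDyadicCoarseFactorization.tendsto_spectralMeasure_compactsIn
    (h𝒜 : IsDyadicCoarseFactorization 𝒜) (hxy : RefLim R 𝒜 x y)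
    (hx : x ∈ asympClosure (indSpan 𝕜 𝒜)) {n : ℕ} (a b : Fin n → ℝ) (hab : ∀ k, a k ≤ b k)
    {S : Finset (ℝ × ℝ)} (hS : icoUnion S = ⋃ k, Set.Ico (a k) (b k)) :
    Tendsto (fun i => (spectralMeasure i (x i) : Measure (Compacts ℝ)) (compactsIn S)) atTop
      (𝓝 (eLpNorm (Q[y | ⨆ k, R.field (a k) (b k)]) 2 Q ^ 2)) := by
  obtain ⟨τ, N, p, q, hτ, hpq, hp, hq, hτa, hτb⟩ := exists_monotone_index a b hab
  let t : ℕ → CoarseInstant := fun j =>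
    CoarseInstant.ofTendsto (fun _ => τ j) (τ j) tendsto_const_nhds
  have ht : Monotone t := fun j j' h => CoarseInstant.ofTendsto_le _ _ fun _ => hτ h
  have h := h𝒜.tendsto_sum_walshCoeff R ht p q hpq hp hq hxy hx
  have hl : ∀ j, (t j).lim = τ j := fun _ => rfl
  simp only [hl, hτa, hτb] at h
  refine h.congr fun i => (spectralMeasure_eq_sum (measurableSet_compactsIn S) fun M => ?_).symm
  rw [compactsIn, Set.mem_ofPred_eq, coe_latticeSet_subset, hS]
  refine forall₂_congr fun k _ => ?_
  rw [mem_gridSet_biUnion ht hpq]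
  simp only [t, CoarseInstant.ofTendsto_num_le, CoarseInstant.lt_ofTendsto_num, hτa, hτb,
    Set.mem_iUnion, Set.mem_Ico]

end Sequence

end CoarseScaling

/-! ### Elementary sets and the conclusion -/

namespace CoarseScaling

/-- Pairs in the wrong order give empty intervals and are discarded. -/
theorem exists_icoUnion_eq (S : Finset (ℝ × ℝ)) :
    ∃ (n : ℕ) (a b : Fin n → ℝ), (∀ k, a k ≤ b k) ∧ icoUnion S = ⋃ k, Set.Ico (a k) (b k) := by
  classical
  let T := S.filter fun p => p.1 ≤ p.2
  let e := T.equivFin.symm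
  refine ⟨T.card, fun k => (e k : ℝ × ℝ).1, fun k => (e k : ℝ × ℝ).2,
    fun k => (Finset.mem_filter.1 (e k).2).2, ?_⟩
  ext x
  simp only [mem_icoUnion, Set.mem_iUnion, Set.mem_Ico]
  constructor
  · rintro ⟨p, hp, h1, h2⟩
    exact ⟨e.symm ⟨p, Finset.mem_filter.2 ⟨hp, h1.trans h2.le⟩⟩, by simpa using ⟨h1, h2⟩⟩
  · rintro ⟨k, h⟩
    exact ⟨e k, (Finset.mem_filter.1 (e k).2).1, h⟩

/-- A measure without fixed points does not distinguish sets that differ by a finite set. -/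
theorem measure_subset_congr {μ : Measure (Compacts ℝ)} (hμ : ∀ s : ℝ, μ {M | s ∈ M} = 0)
    {E F : Set ℝ} (h : (E ∆ F).Finite) :
    μ {M | (M : Set ℝ) ⊆ E} = μ {M | (M : Set ℝ) ⊆ F} := by
  have key : ∀ E F : Set ℝ, (E ∆ F).Finite →
      μ {M | (M : Set ℝ) ⊆ E} ≤ μ {M | (M : Set ℝ) ⊆ F} := by
    intro E F h
    have h0 : μ (⋃ s ∈ E ∆ F, {M | s ∈ M}) = 0 :=
      (measure_biUnion_null_iff h.countable).2 fun s _ => hμ s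
    refine (measure_mono fun M hM => ?_).trans ((measure_union_le _ _).trans
      (by rw [h0, add_zero]) : μ ({M | (M : Set ℝ) ⊆ F} ∪ ⋃ s ∈ E ∆ F, {M | s ∈ M}) ≤ _)
    by_cases hF : (M : Set ℝ) ⊆ F
    · exact Or.inl hF
    · obtain ⟨s, hs, hsF⟩ := Set.not_subset.1 hF
      exact Or.inr (Set.mem_iUnion₂.2 ⟨s, Or.inl ⟨hM hs, hsF⟩, hs⟩)
  exact le_antisymm (key E F h) (key F E (by rwa [symmDiff_comm]))

end CoarseScaling

theorem mainTheorem4 {𝕜 : Type*} [RCLike 𝕜] (𝒜 : Set (SetSeq DyadicSpace))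
    (h𝒜 : IsDyadicCoarseFactorization 𝒜) (x : coarseL2 𝕜 dyadicMeasure 𝒜) :
    ∃ μ : FiniteMeasure (Compacts ℝ),
      Tendsto (fun i => spectralMeasure i ((x : lp (fun i => Lp 𝕜 2 (dyadicMeasure i)) ∞) i))
        atTop (𝓝 μ) ∧
      ∀ {Ω' : Type*} [MeasurableSpace Ω'] (Q : Measure Ω') [IsProbabilityMeasure Q]
        (R : CoarseRefinement dyadicMeasure 𝒜 Q),
        IsSpectralMeasure R.field (R.limL2 𝕜 h𝒜.isCoarseSigmaField x) μ := by
  have hs := h𝒜.isCoarseSigmaField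
  have hx := coarseL2_apply_mem_asympClosure x.2
  -- One auxiliary refinement suffices to obtain the limits and hence μ; the others enter only
  -- through uniqueness of limits.
  obtain ⟨Q₀, ⟨R₀⟩⟩ := exists_coarseRefinement hs
  have hx₀ := refLim_limL2 (R := R₀) hs x
  have hlim : ∀ S, ∃ c, Tendsto (fun i => (spectralMeasure i
      ((x : lp (fun i => Lp 𝕜 2 (dyadicMeasure i)) ∞) i) : Measure (Compacts ℝ)) (compactsIn S))
      atTop (𝓝 c) := fun S => by
    obtain ⟨n, a, b, hab, hS⟩ := exists_icoUnion_eq S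
    exact ⟨_, h𝒜.tendsto_spectralMeasure_compactsIn hx₀ hx a b hab hS⟩
  choose c hc using hlim
  obtain ⟨μ, hμ, hμ0, hμc⟩ := exists_tendsto_of_compactsIn
    (C := ‖(x : lp (fun i => Lp 𝕜 2 (dyadicMeasure i)) ∞)‖₊ ^ 2)
    (fun i => mass_spectralMeasure_le.trans
      (pow_le_pow_left₀ (norm_nonneg _) (lp.norm_apply_le_norm (by simp) _ i) 2))
    (fun ε hε => h𝒜.exists_spectralMeasure_not_subset_le hx hε)
    (fun s δ hδ => h𝒜.exists_spectralMeasure_hit_le hx₀ hx s hδ) hc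
  refine ⟨μ, hμ, fun {Ω'} _ Q _ R n a b hab E hE => ?_⟩
  classical
  let S : Finset (ℝ × ℝ) := Finset.univ.image fun k => (a k, b k)
  have hS : icoUnion S = ⋃ k, Set.Ico (a k) (b k) := by
    ext t
    simp [S, mem_icoUnion]
  -- The same sequence of masses converges to the norm computed in R, so the value found in the
  -- auxiliary refinement equals it.
  have h1 := tendsto_nhds_unique (hc S)
    (h𝒜.tendsto_spectralMeasure_compactsIn (refLim_limL2 (R := R) hs x) hx a b hab hS)
  rw [← h1, ← hμc S, compactsIn, hS]
  -- E differs from the union of half-open intervals by its given finite discrepancy and by left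
  -- endpoints a_k.
  refine measure_subset_congr hμ0 ((hE.union (Set.finite_range a)).subset fun t ht => ?_)
  simp only [Set.mem_symmDiff, Set.mem_iUnion, Set.mem_union, Set.mem_range, Set.mem_Ico,
    Set.mem_Ioo] at ht ⊢
  by_contra! hcon
  rcases ht with ⟨h1, h2⟩ | ⟨⟨k, hk⟩, h2⟩
  · obtain ⟨k, hk⟩ := hcon.1.1 h1
    exact h2 ⟨k, hk.1.le, hk.2⟩
  · exact h2 (hcon.1.2 ⟨k, lt_of_le_of_ne hk.1 (hcon.2 k), hk.2⟩)
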